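/- **Conventions.** $\mathbb R^{2m}$ carries $\Omega_{2m}=\sum_i dx_i\wedge dy_i$; on $\mathbb R^{2m+1}=\mathbb R\times\mathbb R^{2m}$, $\Omega_{2m}$ also denotes its pullback under the projection to $\mathbb R^{2m}$; and $\mathbb R^{2n}=\mathbb R\times\mathbb R\times\mathbb R^{2n-2}\ni(y,t,\cdot)$ carries $\Omega_{2n}=dy\wedge dt+\Omega_{2n-2}$. A two-form $\omega$ on an odd-dimensional manifold is *maximally nondegenerate* if $\ker\omega$ is everywhere one-dimensional. A *characteristic* of $\omega$ is a smooth curve, defined on an interval, whose velocity spans $\ker\omega$ at every time; it is *closed* if it is defined on a circle. **Symplectic plugs.** Let $n>2$ and $\delta>0$. A symplectic plug for dimension $2n$ (and the given $\delta$) is a product $P=[-1,1]\times N$, where $N$ is a compact manifold (with boundary) of dimension $2n-2$, with an exact maximally nondegenerate two-form $\omega$ on $P$ and smooth embeddings $j:P\to\mathbb R^{2n-1}$ and $J:P\to\mathbb R^{2n}$, such that * (P.1) $\ker\omega$ is parallel to $[-1,1]$ near $\partial P$; * (P.2) there is a point $(-1,\tilde p)\in\{-1\}\times N$ such that no characteristic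 of $\omega$ through it meets $\{1\}\times N$; * (P.3) a characteristic through $(-1,p)$ that meets $\{1\}\times N$ does so at $(1,p)$; * (P.4) $\omega$ has no closed characteristics in $P$; * (P.5) $j^*\Omega_{2n-2}=\omega$ near $\partial P$; * (P.6) $J(P)\subseteq[-\delta,\delta]\times\mathbb R^{2n-1}$ and $J^*\Omega_{2n}=\omega$; moreover, with $\tilde j=(0,j)$, $J=\tilde j$ near $\partial P$, and $J$ is isotopic to $\tilde j$ through smooth embeddings that do not change near $\partial P$. **Theorem, part 1 ($n=3$).** Let $R>0$, $0<\varepsilon<1$, let $T^3$ have coordinates $\theta=(\theta_1,\theta_2,\theta_3)$ modulo $2\pi$, and put $\eta=R\cos\theta_3\,d\theta_1+R\sin\theta_3\,d\theta_2$. (Then $(T^3,\eta)$ is the cotangent circle bundle of radius $R$ of the flat torus $T^2$ with the restricted Liouville form.) Let $N=[-\varepsilon,\varepsilon]\times T^3\ni(x,\theta)$, $P=[-1,1]\times N\ni(t,x,\theta)$, and $\rho=d((1+x)\eta)$ on $N$. Let $\tilde\theta_3$ be an irrational angle, i.e. $\cos\tilde\theta_3$ and $\sin\tilde\theta_3$ are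 rationally independent. Call a pair of smooth functions $A(\theta_3,x,t)$, $B(x,t)$ on $P$ *admissible* if * $A>0$; * $A'_x\ge0$, with equality exactly at the two points $(\theta_3,x,t)=(\tilde\theta_3,0,\pm\frac12)$, and these are exactly the critical points of $A$; * $A=1+x$ and $B=0$ near $\partial P$; * $A$ is even in $t$ and $B$ is odd in $t$; * $B=x$ near $(x,t)=(0,\frac12)$ and $B=-x$ near $(0,-\frac12)$. (a) There is a smooth embedding $\varphi:N\to\mathbb R^4$ with $\varphi^*\Omega_4=\rho$. (b) There is a function $A$ such that for every $\delta>0$ there is a $B$ with $|B|\le\delta$ for which $(A,B)$ is admissible. (c) Let $(A,B)$ be any admissible pair and $\omega=d(A\eta+B\,dt)$. The trap of $(P,\omega)$ is the flat geodesic flow: $\ker d\eta$ is spanned at every point of $T^3$ by the geodesic vector field $\cos\theta_3\,\partial_{\theta_1}+\sin\theta_3\,\partial_{\theta_2}$; on the torus $\{\theta_3=\tilde\theta_3\}$ this field has no closed orbits; on the tori $\{(\theta_3,x,t)=(\tilde\theta_3,0,\pm\frac12)\}$ in $P$ it spans $\ker\omega$; and there is a point $(-1,\tilde p)\in\{-1\}\times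 N$ such that some characteristic of $\omega$ on a half-open interval starts at it and asymptotically approaches the torus $\{(\theta_3,x,t)=(\tilde\theta_3,0,-\frac12)\}$, while no characteristic through it meets $\{1\}\times N$. (d) Let moreover $\varphi$ be any embedding as in (a), and let $\delta>0$ with $|B|\le\delta$. Put $j(t,p)=(t,\varphi(p))$ for $(t,p)\in[-1,1]\times N$, and $J=f\circ j$, where $f(t,x,\theta)=(B,t,A-1,\theta)$ and $P$ is identified with $j(P)\subset\mathbb R^5$; explicitly, $J(t,x,\theta)=(B,t,\varphi(A-1,\theta))$. Then $(P,\omega,j,J)$ is a symplectic plug for dimension $6$ and the given $\delta$. **Theorem, part 2.** For every $n\ge3$ there is $\varepsilon\in(0,1)$ such that for every $\delta>0$ there is a symplectic plug for dimension $2n$ and the given $\delta$ on $P=[-1,1]\times N$, where $N\cong[-\varepsilon,\varepsilon]\times ST^*T^{n-1}$ is the closed neighbourhood $\{1-\varepsilon\le|q|\le1+\varepsilon\}$ of the unit cotangent bundle of the flat torus $T^{n-1}$ in $T^*T^{n-1}=\mathbb R^{n-1}\times T^{n-1}\ni(q,\theta)$. -/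

import Mathlib

open Set Filter Topology
open scoped ContDiff

noncomputable section

/-! ### Compact manifolds with corners of the form `K / Γ`

A compact manifold with corners is presented as `K / Γ`, where `K` is a closed domain with corners
in a finite-dimensional vector space and `Γ` is a discrete group of translations that preserves
`K`. Points, curves, functions, maps and differential forms on the manifold are the corresponding
`Γ`-periodic objects on `K`. An object is smooth on `K` if it extends smoothly to a neighbourhood
of each point of `K`. Its derivatives at points of `K` depend only on its restriction to `K`,
because `K` is contained in the closure of its interior. -/

/-- `K` is a closed domain with corners: near each of its points it is cut out by finitely many
inequalities `g i ≥ 0` with linearly independent differentials (none at all near an interior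
point). -/
def IsCornerDomain {E : Type*} [NormedAddCommGroup E] [NormedSpace ℝ E] (K : Set E) : Prop :=
  IsClosed K ∧ ∀ p ∈ K, ∃ (k : ℕ) (g : Fin k → E → ℝ),
    (∀ i, ContDiffAt ℝ ∞ (g i) p ∧ g i p = 0) ∧
    LinearIndependent ℝ (fun i => fderiv ℝ (g i) p) ∧
    ∀ᶠ q in 𝓝 p, (q ∈ K ↔ ∀ i, 0 ≤ g i q)

/-- `K / Γ` is a compact `d`-dimensional manifold with corners: `Γ` is a discrete group of
translations that preserves the domain with corners `K`, with a compact quotient. -/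
structure IsCompactQuotient {E : Type*} [NormedAddCommGroup E] [NormedSpace ℝ E]
    (d : ℕ) (K : Set E) (Γ : AddSubgroup E) : Prop where
  finiteDimensional : FiniteDimensional ℝ E
  dim : Module.finrank ℝ E = d
  domain : IsCornerDomain K
  discrete : DiscreteTopology Γ
  invariant : ∀ p ∈ K, ∀ τ ∈ Γ, p + τ ∈ K
  cocompact : ∃ C : Set E, IsCompact C ∧ C ⊆ K ∧ ∀ p ∈ K, ∃ q ∈ C, p - q ∈ Γ

/-- `f` is `Γ`-periodic on `D`, that is, it descends to a map on `D / Γ`. -/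
def PeriodicOn {E F : Type*} [AddCommGroup E] (D : Set E) (Γ : AddSubgroup E) (f : E → F) : Prop :=
  ∀ z ∈ D, ∀ τ ∈ Γ, f (z + τ) = f z

/-- `f` is smooth on `D` (up to the boundary). -/
def SmoothOn {E F : Type*} [NormedAddCommGroup E] [NormedSpace ℝ E] [NormedAddCommGroup F]
    [NormedSpace ℝ F] (D : Set E) (f : E → F) : Prop :=
  ∀ z ∈ D, ContDiffAt ℝ ∞ f z

/-- `f` descends to a smooth embedding of the compact manifold `D / Γ`, that is, to an injective
immersion. -/
structure IsEmbeddingOn {E F : Type*} [NormedAddCommGroup E] [NormedSpace ℝ E]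
    [NormedAddCommGroup F] [NormedSpace ℝ F] (D : Set E) (Γ : AddSubgroup E) (f : E → F) :
    Prop where
  smooth : SmoothOn D f
  periodic : PeriodicOn D Γ f
  immersion : ∀ z ∈ D, Function.Injective (fderiv ℝ f z)
  injective : ∀ z ∈ D, ∀ w ∈ D, f z = f w → z - w ∈ Γ

/-! ### Two-forms and their characteristics -/

/-- The kernel of an alternating bilinear form. -/
def formKer {E : Type*} [NormedAddCommGroup E] [NormedSpace ℝ E] (a : E [⋀^Fin 2]→L[ℝ] ℝ) :
    Submodule ℝ E where
  carrier := {v | ∀ w, a ![v, w] = 0}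
  add_mem' := by
    intro u v hu hv w
    have h := a.vecCons_add ![w] u v
    rw [h]
    exact (congrArg₂ (· + ·) (hu w) (hv w)).trans (add_zero 0)
  zero_mem' := by
    intro w
    exact a.map_coord_zero 0 rfl
  smul_mem' := by
    intro c v hv w
    have h := a.vecCons_smul ![w] c v
    rw [h]
    exact (congrArg (c • ·) (hv w)).trans (smul_zero c)

/-- `σ` is exact on `D / Γ`: it is the exterior derivative of a smooth one-form on `D / Γ`. -/
def IsExactOn {E : Type*} [NormedAddCommGroup E] [NormedSpace ℝ E] (D : Set E) (Γ : AddSubgroup E)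
    (σ : E → E [⋀^Fin 2]→L[ℝ] ℝ) : Prop :=
  ∃ α : E → E [⋀^Fin 1]→L[ℝ] ℝ, SmoothOn D α ∧ PeriodicOn D Γ α ∧
    ∀ z ∈ D, σ z = extDeriv α z

/-- `σ` is maximally nondegenerate on `D`: its kernel is everywhere one-dimensional. -/
def MaximallyNondegenerateOn {E : Type*} [NormedAddCommGroup E] [NormedSpace ℝ E] (D : Set E)
    (σ : E → E [⋀^Fin 2]→L[ℝ] ℝ) : Prop :=
  ∀ z ∈ D, Module.finrank ℝ (formKer (σ z)) = 1

/-- A characteristic of `σ` on `D`, defined on the interval `S`: a smooth curve in `D` whose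
velocity spans the kernel of `σ` at every time. (Curves in `D / Γ` on an interval are given by
their lifts to `D`.) -/
structure IsCharacteristic {E : Type*} [NormedAddCommGroup E] [NormedSpace ℝ E] (D : Set E)
    (σ : E → E [⋀^Fin 2]→L[ℝ] ℝ) (S : Set ℝ) (γ : ℝ → E) : Prop where
  interval : S.OrdConnected
  smooth : ContDiffOn ℝ ∞ γ S
  mem : ∀ s ∈ S, γ s ∈ D
  spans : ∀ s ∈ S, formKer (σ (γ s)) = Submodule.span ℝ {derivWithin γ S s}

/-- A closed characteristic of `σ` on `D / Γ`: a characteristic on the circle `ℝ / ℤ`, given by a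
lift to `D`. -/
def IsClosedCharacteristic {E : Type*} [NormedAddCommGroup E] [NormedSpace ℝ E] (D : Set E)
    (Γ : AddSubgroup E) (σ : E → E [⋀^Fin 2]→L[ℝ] ℝ) (γ : ℝ → E) : Prop :=
  IsCharacteristic D σ univ γ ∧ ∃ τ ∈ Γ, ∀ s, γ (s + 1) = γ s + τ

/-! ### The standard symplectic spaces -/

/-- `ℝ^{2m}`, with coordinates `(x_1, y_1, …, x_m, y_m)`. -/
abbrev StdSpace (m : ℕ) : Type := Fin m → ℝ × ℝ

/-- The canonical symplectic form `∑ dx_i ∧ dy_i` of `ℝ^{2m}`. -/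
def stdForm (m : ℕ) (u v : StdSpace m) : ℝ :=
  ∑ i, ((u i).1 * (v i).2 - (u i).2 * (v i).1)

/-- The canonical symplectic form `dy ∧ dt + ∑ dx_i ∧ dy_i` of
`ℝ^{2m+2} = ℝ × (ℝ × ℝ^{2m})`, with coordinates `(y, (t, x_1, y_1, …, x_m, y_m))`. -/
def stdFormSucc (m : ℕ) (u v : ℝ × (ℝ × StdSpace m)) : ℝ :=
  (u.1 * v.2.1 - u.2.1 * v.1) + stdForm m u.2.2 v.2.2

/-! ### Symplectic plugs -/

/-- The domain `[-1, 1] × K`, which presents `P = [-1, 1] × N` when `N = K / Γ`. -/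
def plugDomain {E : Type*} (K : Set E) : Set (ℝ × E) := Icc (-1 : ℝ) 1 ×ˢ K

/-- The group of translations `0 × Γ`, so that `P = plugDomain K / plugGroup Γ`. -/
def plugGroup {E : Type*} [AddCommGroup E] (Γ : AddSubgroup E) : AddSubgroup (ℝ × E) :=
  (⊥ : AddSubgroup ℝ).prod Γ

/-- `Q z` holds for all `z ∈ P` near `∂P`. -/
def NearBoundary {E : Type*} [TopologicalSpace E] (K : Set E) (Q : ℝ × E → Prop) : Prop :=
  ∀ᶠ z in 𝓝ˢ (frontier (plugDomain K)), z ∈ plugDomain K → Q z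

/-- `j' = (0, j)` and `J` are isotopic relative to `∂P`: they are joined by a smooth family of
embeddings that does not change near `∂P`. -/
def IsotopicRelBoundary {E F : Type*} [NormedAddCommGroup E] [NormedSpace ℝ E]
    [NormedAddCommGroup F] [NormedSpace ℝ F] (K : Set E) (Γ : AddSubgroup E)
    (j' J : ℝ × E → F) : Prop :=
  ∃ F : ℝ → ℝ × E → F,
    SmoothOn (Icc (0 : ℝ) 1 ×ˢ plugDomain K) (fun q : ℝ × (ℝ × E) => F q.1 q.2) ∧
    (∀ s ∈ Icc (0 : ℝ) 1, IsEmbeddingOn (plugDomain K) (plugGroup Γ) (F s)) ∧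
    (∀ z ∈ plugDomain K, F 0 z = j' z) ∧
    (∀ z ∈ plugDomain K, F 1 z = J z) ∧
    NearBoundary K (fun z => ∀ s ∈ Icc (0 : ℝ) 1, F s z = j' z)

/-- `(P, σ, j, J)` is a symplectic plug for dimension `2n`, with the embedding `J` adapted to the
given `δ > 0`. Here `P = [-1, 1] × N` and `N = K / Γ` is a compact manifold of dimension
`2n - 2`. -/
structure IsSymplecticPlug {E : Type*} [NormedAddCommGroup E] [NormedSpace ℝ E] (n : ℕ)
    (K : Set E) (Γ : AddSubgroup E) (δ : ℝ) (σ : ℝ × E → (ℝ × E) [⋀^Fin 2]→L[ℝ] ℝ)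
    (j : ℝ × E → ℝ × StdSpace (n - 1)) (J : ℝ × E → ℝ × (ℝ × StdSpace (n - 1))) : Prop where
  two_lt : 2 < n
  manifold : IsCompactQuotient (2 * n - 2) K Γ
  exact : IsExactOn (plugDomain K) (plugGroup Γ) σ
  nondegenerate : MaximallyNondegenerateOn (plugDomain K) σ
  embedding_j : IsEmbeddingOn (plugDomain K) (plugGroup Γ) j
  embedding_J : IsEmbeddingOn (plugDomain K) (plugGroup Γ) J
  /-- The kernel of `σ` is vertical near `∂P`. -/
  P1 : NearBoundary K (fun z => formKer (σ z) = Submodule.span ℝ {((1 : ℝ), (0 : E))})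
  /-- Some trajectory that enters `P` never leaves it. -/
  P2 : ∃ p ∈ K, ∀ (S : Set ℝ) (γ : ℝ → ℝ × E), IsCharacteristic (plugDomain K) σ S γ →
    ∀ s ∈ S, γ s = (-1, p) → ∀ u ∈ S, (γ u).1 ≠ 1
  /-- Entry and exit points match. -/
  P3 : ∀ (S : Set ℝ) (γ : ℝ → ℝ × E), IsCharacteristic (plugDomain K) σ S γ →
    ∀ s ∈ S, ∀ u ∈ S, (γ s).1 = -1 → (γ u).1 = 1 → (γ u).2 - (γ s).2 ∈ Γ
  /-- There are no closed characteristics. -/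
  P4 : ¬ ∃ γ : ℝ → ℝ × E, IsClosedCharacteristic (plugDomain K) (plugGroup Γ) σ γ
  /-- `j^* Ω_{2n-2} = σ` near `∂P`. -/
  P5 : NearBoundary K (fun z => ∀ v w,
    stdForm (n - 1) (fderiv ℝ j z v).2 (fderiv ℝ j z w).2 = σ z ![v, w])
  /-- `J` maps `P` into `[-δ, δ] × ℝ^{2n-1}`. -/
  P6_range : ∀ z ∈ plugDomain K, (J z).1 ∈ Icc (-δ) δ
  /-- `J^* Ω_{2n} = σ`. -/
  P6_pullback : ∀ z ∈ plugDomain K, ∀ v w,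
    stdFormSucc (n - 1) (fderiv ℝ J z v) (fderiv ℝ J z w) = σ z ![v, w]
  /-- `J = j'` near `∂P`, where `j' = (0, j)`. -/
  P6_boundary : NearBoundary K (fun z => J z = (0, j z))
  P6_isotopic : IsotopicRelBoundary K Γ (fun z => ((0 : ℝ), j z)) J

/-! ### The plug for `n = 3`

Coordinates are `(θ₁, θ₂, θ₃)` on `M = T³`, `(x, θ)` on `N = [-ε, ε] × M`, and `(t, x, θ)` on
`P = [-1, 1] × N`. All angles are real numbers modulo `2π`. -/

/-- The space of `(θ₁, θ₂, θ₃)`. -/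
abbrev Angles : Type := ℝ × ℝ × ℝ

/-- The lattice `(2πℤ)³`. -/
def angleLattice : AddSubgroup Angles :=
  (AddSubgroup.zmultiples (2 * Real.pi)).prod
    ((AddSubgroup.zmultiples (2 * Real.pi)).prod (AddSubgroup.zmultiples (2 * Real.pi)))

/-- `[-ε, ε] × ℝ³`, which covers `N = [-ε, ε] × T³`. -/
def collar (ε : ℝ) : Set (ℝ × Angles) := Icc (-ε) ε ×ˢ univ

/-- The group of translations with `N = collar ε / collarGroup`. -/
def collarGroup : AddSubgroup (ℝ × Angles) := (⊥ : AddSubgroup ℝ).prod angleLattice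

/-- A covector field as a differential one-form. -/
def oneForm {E : Type*} [NormedAddCommGroup E] [NormedSpace ℝ E] (α : E → E →L[ℝ] ℝ) :
    E → E [⋀^Fin 1]→L[ℝ] ℝ :=
  fun z => ContinuousAlternatingMap.ofSubsingleton ℝ E ℝ 0 (α z)

/-- The one-form `η = R cos θ₃ dθ₁ + R sin θ₃ dθ₂`. It is the restriction of the Liouville form
`p₁ dθ₁ + p₂ dθ₂` of `T^*T²` to the cotangent bundle `M` of radius `R`, parametrized by
`(p₁, p₂) = (R cos θ₃, R sin θ₃)`. -/
def eta (R : ℝ) (θ : Angles) : Angles →L[ℝ] ℝ :=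
  (R * Real.cos θ.2.2) • ContinuousLinearMap.fst ℝ ℝ (ℝ × ℝ) +
    (R * Real.sin θ.2.2) •
      ((ContinuousLinearMap.fst ℝ ℝ ℝ).comp (ContinuousLinearMap.snd ℝ ℝ (ℝ × ℝ)))

/-- The vector field of the geodesic flow of the flat metric on the unit cotangent bundle `T³` of
`T²`: the point with covector `(cos θ₃, sin θ₃)` moves in the direction `(cos θ₃, sin θ₃)`, and
`θ₃` is constant. -/
def geodesicField (θ : Angles) : Angles := (Real.cos θ.2.2, Real.sin θ.2.2, 0)

/-- `θ` is irrational: `(cos θ, sin θ)` is a rationally independent pair. -/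
def IrrationalAngle (θ : ℝ) : Prop :=
  ∀ k l : ℤ, k * Real.cos θ + l * Real.sin θ = 0 → k = 0 ∧ l = 0

/-- The two-form `σ = d(A(θ₃, x, t) η + B(x, t) dt)` on `P`. -/
def plugForm (R : ℝ) (A : ℝ → ℝ → ℝ → ℝ) (B : ℝ → ℝ → ℝ) :
    ℝ × (ℝ × Angles) → (ℝ × (ℝ × Angles)) [⋀^Fin 2]→L[ℝ] ℝ :=
  extDeriv (oneForm fun z =>
    A z.2.2.2.2 z.2.1 z.1 • (eta R z.2.2).comp
      ((ContinuousLinearMap.snd ℝ ℝ Angles).comp (ContinuousLinearMap.snd ℝ ℝ (ℝ × Angles))) +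
    B z.2.1 z.1 • ContinuousLinearMap.fst ℝ ℝ (ℝ × Angles))

/-- The two-form `ρ = d((1 + x) η)` on `N`. -/
def collarForm (R : ℝ) : ℝ × Angles → (ℝ × Angles) [⋀^Fin 2]→L[ℝ] ℝ :=
  extDeriv (oneForm fun p =>
    (1 + p.1) • (eta R p.2).comp (ContinuousLinearMap.snd ℝ ℝ Angles))

/-- `(θ₃, x, t)` is one of the two points `(θ₀, 0, ±1/2)`, with angles modulo `2π`. -/
def IsTrapPoint (θ₀ θ x t : ℝ) : Prop :=
  θ - θ₀ ∈ AddSubgroup.zmultiples (2 * Real.pi) ∧ x = 0 ∧ (t = 1 / 2 ∨ t = -(1 / 2))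

/-- The conditions on the functions `A` and `B`. They concern the restrictions to
`(x, t) ∈ [-ε, ε] × [-1, 1]` only; since these are `1 + x` and `0` near the boundary, it is no
restriction to let `A` and `B` be smooth on the whole space. -/
structure PlugFunctions (ε θ₀ : ℝ) (A : ℝ → ℝ → ℝ → ℝ) (B : ℝ → ℝ → ℝ) : Prop where
  smooth_A : ContDiff ℝ ∞ (fun q : ℝ × ℝ × ℝ => A q.1 q.2.1 q.2.2)
  smooth_B : ContDiff ℝ ∞ (fun q : ℝ × ℝ => B q.1 q.2)
  periodic_A : ∀ θ x t, A (θ + 2 * Real.pi) x t = A θ x t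
  A1 : ∀ θ, ∀ x ∈ Icc (-ε) ε, ∀ t ∈ Icc (-1 : ℝ) 1, 0 < A θ x t
  A2 : ∀ θ, ∀ x ∈ Icc (-ε) ε, ∀ t ∈ Icc (-1 : ℝ) 1, 0 ≤ deriv (fun y => A θ y t) x ∧
    (deriv (fun y => A θ y t) x = 0 ↔ IsTrapPoint θ₀ θ x t)
  A2_critical : ∀ θ, ∀ x ∈ Icc (-ε) ε, ∀ t ∈ Icc (-1 : ℝ) 1,
    (fderiv ℝ (fun q : ℝ × ℝ × ℝ => A q.1 q.2.1 q.2.2) (θ, x, t) = 0 ↔ IsTrapPoint θ₀ θ x t)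
  A3 : ∃ r > 0, ∀ θ, ∀ x ∈ Icc (-ε) ε, ∀ t ∈ Icc (-1 : ℝ) 1,
    (ε - r < |x| ∨ 1 - r < |t|) → A θ x t = 1 + x
  A4 : ∀ θ, ∀ x ∈ Icc (-ε) ε, ∀ t ∈ Icc (-1 : ℝ) 1, A θ x (-t) = A θ x t
  B1 : ∃ r > 0, ∀ x ∈ Icc (-ε) ε, ∀ t ∈ Icc (-1 : ℝ) 1,
    (ε - r < |x| ∨ 1 - r < |t|) → B x t = 0
  B2_pos : ∀ᶠ q in 𝓝 ((0 : ℝ), (1 / 2 : ℝ)), B q.1 q.2 = q.1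
  B2_neg : ∀ᶠ q in 𝓝 ((0 : ℝ), (-(1 / 2) : ℝ)), B q.1 q.2 = -q.1
  B3 : ∀ x ∈ Icc (-ε) ε, ∀ t ∈ Icc (-1 : ℝ) 1, B x (-t) = -B x t

/-- `φ : (N, ρ) → (ℝ⁴, Ω₄)` is a symplectic embedding. -/
def IsCollarEmbedding (R ε : ℝ) (φ : ℝ × Angles → StdSpace 2) : Prop :=
  IsEmbeddingOn (collar ε) collarGroup φ ∧
    ∀ p ∈ collar ε, ∀ v w, stdForm 2 (fderiv ℝ φ p v) (fderiv ℝ φ p w) = collarForm R p ![v, w]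

/-- The map `j(t, p) = (t, φ(p))`. -/
def plugJ (φ : ℝ × Angles → StdSpace 2) (z : ℝ × (ℝ × Angles)) : ℝ × StdSpace 2 :=
  (z.1, φ z.2)

/-- The map `f(t, x, θ) = (B, t, A - 1, θ)` from `P` to `ℝ × P`. -/
def plugF (A : ℝ → ℝ → ℝ → ℝ) (B : ℝ → ℝ → ℝ) (z : ℝ × (ℝ × Angles)) :
    ℝ × (ℝ × (ℝ × Angles)) :=
  (B z.2.1 z.1, (z.1, (A z.2.2.2.2 z.2.1 z.1 - 1, z.2.2)))

/-- The map `J = f ∘ j`, where `P` is identified with `j(P) ⊆ ℝ⁵`, and `ℝ × P` with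
`ℝ × j(P) ⊆ ℝ × ℝ⁵ = ℝ⁶`. -/
def plugBigJ (A : ℝ → ℝ → ℝ → ℝ) (B : ℝ → ℝ → ℝ) (φ : ℝ × Angles → StdSpace 2)
    (z : ℝ × (ℝ × Angles)) : ℝ × (ℝ × StdSpace 2) :=
  ((plugF A B z).1, plugJ φ (plugF A B z).2)

/-- The trap of `(P, σ)` is the flat geodesic flow on the cotangent bundle `M` of radius `R`,
on the invariant torus of the angle `θ₀`. -/
structure HasFlatGeodesicTrap (R ε θ₀ : ℝ)
    (σ : ℝ × (ℝ × Angles) → (ℝ × (ℝ × Angles)) [⋀^Fin 2]→L[ℝ] ℝ) : Prop where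
  /-- The characteristics of `(M, dη)` are the orbits of the geodesic flow. -/
  geodesic : ∀ θ : Angles,
    formKer (extDeriv (oneForm (eta R)) θ) = Submodule.span ℝ {geodesicField θ}
  /-- The geodesic flow is aperiodic on the torus `θ₃ = θ₀`. -/
  aperiodic : ∀ θ : Angles, θ.2.2 = θ₀ → ∀ s : ℝ, s ≠ 0 → s • geodesicField θ ∉ angleLattice
  /-- The tori `{t = ±1/2, x = 0, θ₃ = θ₀}` in `P` are invariant, and the characteristics of `σ`
  on them are the orbits of the geodesic flow. -/
  tori : ∀ t : ℝ, (t = 1 / 2 ∨ t = -(1 / 2)) → ∀ θ : Angles, θ.2.2 = θ₀ →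
    formKer (σ (t, (0, θ))) =
      Submodule.span ℝ {((0 : ℝ), ((0 : ℝ), geodesicField θ))}
  /-- Some characteristic that enters `P` is trapped: it asymptotically approaches the torus
  `{t = -1/2, x = 0, θ₃ = θ₀}`, and no characteristic through its entry point leaves `P`. -/
  trapped : ∃ p ∈ collar ε,
    (∃ γ : ℝ → ℝ × (ℝ × Angles), IsCharacteristic (plugDomain (collar ε)) σ (Ico 0 1) γ ∧
      γ 0 = (-1, p) ∧
      Tendsto (fun s => ((γ s).1, (γ s).2.1, (γ s).2.2.2.2)) (𝓝[<] 1)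
        (𝓝 (-(1 / 2), 0, θ₀))) ∧
    ∀ (S : Set ℝ) (γ : ℝ → ℝ × (ℝ × Angles)),
      IsCharacteristic (plugDomain (collar ε)) σ S γ →
      ∀ s ∈ S, γ s = (-1, p) → ∀ u ∈ S, (γ u).1 ≠ 1

/-! ### Higher dimensions -/

/-- `{(q, θ) : 1 - ε ≤ |q| ≤ 1 + ε} ⊆ ℝ^m × ℝ^m`. Modulo `shellGroup m` it is the closed
neighbourhood `[-ε, ε] × M` of the unit cotangent bundle `M = {|q| = 1}` in `T^*T^m`. -/
def shell (m : ℕ) (ε : ℝ) : Set (EuclideanSpace ℝ (Fin m) × (Fin m → ℝ)) :=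
  {p | 1 - ε ≤ ‖p.1‖ ∧ ‖p.1‖ ≤ 1 + ε}

/-- The group of translations `0 × (2πℤ)^m`. -/
def shellGroup (m : ℕ) : AddSubgroup (EuclideanSpace ℝ (Fin m) × (Fin m → ℝ)) :=
  (⊥ : AddSubgroup (EuclideanSpace ℝ (Fin m))).prod
    (AddSubgroup.pi univ fun _ => AddSubgroup.zmultiples (2 * Real.pi))

end

/-! ### Curves on an interval -/

section Curves

variable {E : Type*} [NormedAddCommGroup E] [NormedSpace ℝ E]

/-! Both families of plugs come from one mechanism, abstracted in `TrapFlow` and `IsSymplectic`. On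
[-1, 1] × N there are a coordinate x along a vector e, a transverse coordinate y, a function a(y, x,
t) that equals x near the boundary, and a function b(y, x, t) that vanishes there. Let ψ = `push 1`
replace x by a. The two-form is σ = db ∧ dt + ψ*ρ with ρ symplectic on N, and its kernel is spanned
by (∂ₓa, -∂ₜa e + W), where W leaves x and y fixed (`formKer_eq`).

Dynamics. Both y and a are conserved: at fixed y, the pair (x, t) follows the Hamiltonian flow of a
up to a change of time. Since ∂ₓa ≥ 0, the coordinate t is monotone on every characteristic. The
zeros of ∂ₓa lie at x = x₀, t = ±1/2 and are critical points of a, hence equilibria of the (x,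
t)-motion; there only W remains, in an irrational direction. A closed characteristic would have
constant t, would lie in the trap and would close up along W, which is impossible (`not_periodic`).
A characteristic that enters on the level of the trap would meet the trap at t = 1/2, because a is
strictly increasing in x; but an equilibrium is not reached in finite time (`fst_ne_one`).
`exists_trapped_curve` constructs such a characteristic, converging to the trap at t = -1/2. On a
characteristic that crosses, t serves as the parameter. As a is even in t, so is x; as W is odd, the
drift ∫ W/∂ₓa dt over the second half undoes that of the first, and the exit lies over the entry
(`snd_eq_of_crossing`).

Embedding. J = (b, t, φ ∘ ψ) pulls the standard form back to σ. The map ψ is injective but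
degenerates at the trap; there ∂ₓb ≠ 0 makes J an immersion. Only the slope of b at the trap
matters, so b can be as small as desired. Interpolating ψ with the identity and scaling b gives the
isotopy (`isEmbeddingOn_isotopy`).

Instances. Over T³, x is the radial coordinate, y = θ₃ and a = A - 1 (`collarFlow`). In higher
dimensions, x = ⟨w, q⟩ for a unit vector w of irrational direction and y is the part of q orthogonal
to w (`shellFlow`). The model for a is x minus a bump of slope exactly one at the trap; φ comes from
action-angle coordinates. -/

theorem eq_of_hasDerivWithinAt_zero {S : Set ℝ} (hS : S.OrdConnected) {f : ℝ → E}
    (hf : ∀ s ∈ S, HasDerivWithinAt f 0 S s) {s u : ℝ} (hs : s ∈ S) (hu : u ∈ S) :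
    f u = f s := by
  have := hS.convex.norm_image_sub_le_of_norm_hasDerivWithin_le (C := 0) hf (by simp) hs hu
  rw [zero_mul, norm_le_zero_iff, sub_eq_zero] at this
  exact this

/-- Near s₀ the factor is the quotient l(D)/l(V) for a functional l with l(V s₀) ≠ 0. -/
theorem continuousOn_of_eq_smul {S : Set ℝ} {c : ℝ → ℝ} {D V : ℝ → E} (hD : ContinuousOn D S)
    (hV : ContinuousOn V S) (h0 : ∀ s ∈ S, V s ≠ 0) (h : ∀ s ∈ S, D s = c s • V s) :
    ContinuousOn c S := by
  intro s₀ hs₀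
  obtain ⟨l, -, hl⟩ := exists_dual_vector ℝ (V s₀) (norm_ne_zero_iff.2 (h0 s₀ hs₀))
  have hl0 : l (V s₀) ≠ 0 := by simpa [hl] using h0 s₀ hs₀
  have hlV : ContinuousWithinAt (fun s => l (V s)) S s₀ := l.continuous.continuousAt.comp_continuousWithinAt (hV s₀ hs₀)
  have hlD : ContinuousWithinAt (fun s => l (D s)) S s₀ := l.continuous.continuousAt.comp_continuousWithinAt (hD s₀ hs₀)
  have key := hlD.div hlV hl0
  refine key.congr_of_eventuallyEq ?_ ?_
  · filter_upwards [hlV.eventually_ne hl0, self_mem_nhdsWithin] with s hs hsS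
    rw [Pi.div_apply, eq_div_iff hs, h s hsS, map_smul, smul_eq_mul]
  · rw [Pi.div_apply, eq_div_iff hl0, h s₀ hs₀, map_smul, smul_eq_mul]

theorem pos_or_neg_of_continuousOn {S : Set ℝ} (hS : S.OrdConnected) {c : ℝ → ℝ}
    (hc : ContinuousOn c S) (h0 : ∀ s ∈ S, c s ≠ 0) :
    (∀ s ∈ S, 0 < c s) ∨ ∀ s ∈ S, c s < 0 := by
  by_contra! h
  obtain ⟨⟨s, hs, hs'⟩, u, hu, hu'⟩ := h
  obtain ⟨r, hr, hr'⟩ := hS.isPreconnected.intermediate_value hs hu hc ⟨hs', hu'⟩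
  exact h0 r hr hr'

/-- A curve tangent to a vector field that passes through a zero of it is constant. -/
theorem eq_of_hasDerivWithinAt_smul_of_zero {S : Set ℝ} (hS : S.OrdConnected) {v : E → E}
    (hv : ContDiff ℝ 1 v) {c : ℝ → ℝ} (hc : ContinuousOn c S) {q : ℝ → E}
    (hq : ∀ s ∈ S, HasDerivWithinAt q (c s • v (q s)) S s) {s₁ : ℝ} (hs₁ : s₁ ∈ S)
    (h0 : v (q s₁) = 0) {s₂ : ℝ} (hs₂ : s₂ ∈ S) : q s₂ = q s₁ := by
  have hqc : ContinuousOn q S := fun s hs => (hq s hs).continuousWithinAt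
  have hsub : uIcc s₁ s₂ ⊆ S := hS.uIcc_subset hs₁ hs₂
  set T := q '' uIcc s₁ s₂ with hT
  have hTc : IsCompact T := isCompact_uIcc.image_of_continuousOn (hqc.mono hsub)
  obtain ⟨L, hL⟩ := (hv.locallyLipschitz.locallyLipschitzOn (s := T)).exists_lipschitzOnWith_of_compact hTc
  obtain ⟨C, hC⟩ := (isCompact_uIcc (a := s₁) (b := s₂)).exists_bound_of_continuousOn (hc.mono hsub)
  -- On the compact trajectory the fields c(t)·v are Lipschitz with a common constant, so the
  -- constant curve at the zero is the only solution through it.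
  have hlip : ∀ t ∈ uIcc s₁ s₂, LipschitzOnWith (C.toNNReal * L) (fun z => c t • v z) T := by
    intro t ht
    refine LipschitzOnWith.of_dist_le_mul fun x hx y hy => ?_
    rw [dist_smul₀]
    have h1 := hL.dist_le_mul x hx y hy
    have h2 := hC t ht
    have h3 : 0 ≤ C := (norm_nonneg _).trans h2
    push_cast
    rw [Real.coe_toNNReal _ h3, mul_assoc]
    gcongr
  have hmem : ∀ t ∈ uIcc s₁ s₂, q t ∈ T := fun t ht => mem_image_of_mem q ht
  rcases le_total s₁ s₂ with h | h
  · rw [uIcc_of_le h] at *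
    refine ODE_solution_unique_of_mem_Icc_right (v := fun t z => c t • v z) (s := fun _ => T) (f := q)
      (g := fun _ => q s₁)
      (fun t ht => hlip t ⟨ht.1, ht.2.le⟩) (hqc.mono hsub) ?_ (fun t ht => hmem t ⟨ht.1, ht.2.le⟩)
      continuousOn_const ?_ (fun t ht => hmem s₁ ⟨le_rfl, h⟩) rfl ⟨h, le_rfl⟩
    · intro t ht
      refine ((hq t (hsub ⟨ht.1, ht.2.le⟩)).mono (hsub.trans' (Icc_subset_Icc_left ht.1))).mono_of_mem_nhdsWithin ?_
      exact Icc_mem_nhdsGE ht.2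
    · intro t ht
      simpa [h0] using hasDerivWithinAt_const t (Ici t) (q s₁)
  · rw [uIcc_of_ge h] at *
    refine ODE_solution_unique_of_mem_Icc_left (v := fun t z => c t • v z) (s := fun _ => T) (f := q)
      (g := fun _ => q s₁)
      (fun t ht => hlip t ⟨ht.1.le, ht.2⟩) (hqc.mono hsub) ?_ (fun t ht => hmem t ⟨ht.1.le, ht.2⟩)
      continuousOn_const ?_ (fun t ht => hmem s₁ ⟨h, le_rfl⟩) rfl ⟨le_rfl, h⟩
    · intro t ht
      refine ((hq t (hsub ⟨ht.1.le, ht.2⟩)).mono (hsub.trans' (Icc_subset_Icc_right ht.2))).mono_of_mem_nhdsWithin ?_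
      exact Icc_mem_nhdsLE ht.1
    · intro t ht
      simpa [h0] using hasDerivWithinAt_const t (Iic t) (q s₁)

/-- A continuous injective function on a compact interval has a continuous inverse. -/
theorem exists_continuousOn_inverse {f : ℝ → ℝ} {s u : ℝ} (hf : ContinuousOn f (uIcc s u))
    (hinj : InjOn f (uIcc s u)) :
    ∃ g : ℝ → ℝ, ContinuousOn g (uIcc (f s) (f u)) ∧
      ∀ τ ∈ uIcc (f s) (f u), g τ ∈ uIcc s u ∧ f (g τ) = τ := by
  have hsurj : ∀ τ : uIcc (f s) (f u), ∃ r : uIcc s u, f r = τ := by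
    rintro ⟨τ, hτ⟩
    obtain ⟨r, hr, hr'⟩ := intermediate_value_uIcc hf hτ
    exact ⟨⟨r, hr⟩, hr'⟩
  choose g hg using hsurj
  have hemb : IsClosedEmbedding ((uIcc s u).domRestrict f) := by
    have : CompactSpace (uIcc s u) := isCompact_iff_compactSpace.1 isCompact_uIcc
    exact (continuousOn_iff_continuous_domRestrict.1 hf).isClosedEmbedding
      ((injOn_iff_injective).1 hinj)
  have hgc : Continuous g := by
    rw [hemb.isInducing.continuous_iff]
    refine continuous_subtype_val.congr fun τ => ?_
    simp [domRestrict, hg]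
  classical
  refine ⟨fun τ => if h : τ ∈ uIcc (f s) (f u) then g ⟨τ, h⟩ else s, ?_, fun τ hτ => ?_⟩
  · rw [continuousOn_iff_continuous_domRestrict]
    refine (continuous_subtype_val.comp hgc).congr fun τ => ?_
    simp [domRestrict_apply]
  · simp only
    rw [dif_pos hτ]
    exact ⟨(g ⟨τ, hτ⟩).2, hg ⟨τ, hτ⟩⟩

/-- Equal values at two points would make the monotone f constant between them, so f' would vanish
on a whole interval and not only at x₀. -/
theorem strictMonoOn_of_deriv_nonneg_of_zero {X : Set ℝ} (hX : X.OrdConnected) {f f' : ℝ → ℝ}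
    {x₀ : ℝ} (hf : ∀ x, HasDerivAt f (f' x) x) (h0 : ∀ x ∈ X, 0 ≤ f' x)
    (h1 : ∀ x ∈ X, f' x = 0 → x = x₀) : StrictMonoOn f X := by
  have hc : Continuous f := continuous_iff_continuousAt.2 fun x => (hf x).continuousAt
  have hm : MonotoneOn f X := monotoneOn_of_deriv_nonneg hX.convex hc.continuousOn
    (fun x _ => (hf x).differentiableAt.differentiableWithinAt)
    (fun x hx => by rw [(hf x).deriv]; exact h0 x (interior_subset hx))
  intro x hx y hy hxy
  refine lt_of_le_of_ne (hm hx hy hxy.le) fun he => ?_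
  have hz : ∀ z ∈ Ioo x y, f' z = 0 := by
    intro z hz
    have hev : f =ᶠ[𝓝 z] fun _ => f x := by
      filter_upwards [Ioo_mem_nhds hz.1 hz.2] with r hr
      have hrX : r ∈ X := hX.out hx hy ⟨hr.1.le, hr.2.le⟩
      exact le_antisymm ((hm hrX hy hr.2.le).trans he.ge) (hm hx hrX hr.1.le)
    exact (hf z).unique ((hasDerivAt_const z (f x)).congr_of_eventuallyEq hev)
  obtain ⟨r, hr⟩ := exists_between hxy
  obtain ⟨r', hr'⟩ := exists_between hr.1
  have e1 := h1 r (hX.out hx hy ⟨hr.1.le, hr.2.le⟩) (hz r hr)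
  have e2 := h1 r' (hX.out hx hy ⟨hr'.1.le, (hr'.2.trans hr.2).le⟩) (hz r' ⟨hr'.1, hr'.2.trans hr.2⟩)
  exact hr'.2.ne (e2.trans e1.symm)

/-- The velocity of a characteristic is a continuous nonvanishing multiple of a vector field that
spans the kernel. -/
theorem IsCharacteristic.exists_smul {D : Set E} {σ : E → E [⋀^Fin 2]→L[ℝ] ℝ} {S : Set ℝ}
    {γ : ℝ → E} (hγ : IsCharacteristic D σ S γ) {V : E → E} (hV : ContinuousOn V D)
    (h0 : ∀ z ∈ D, V z ≠ 0) (hker : ∀ z ∈ D, formKer (σ z) = Submodule.span ℝ {V z}) :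
    ∃ c : ℝ → ℝ, ContinuousOn c S ∧ (∀ s ∈ S, c s ≠ 0) ∧
      ∀ s ∈ S, HasDerivWithinAt γ (c s • V (γ s)) S s := by
  have hex : ∀ s, ∃ c : ℝ, s ∈ S → derivWithin γ S s = c • V (γ s) := by
    intro s
    by_cases hs : s ∈ S
    · have : derivWithin γ S s ∈ Submodule.span ℝ {V (γ s)} := by
        rw [← hker _ (hγ.mem s hs), hγ.spans s hs]
        exact Submodule.mem_span_singleton_self _
      obtain ⟨c, hc⟩ := Submodule.mem_span_singleton.1 this
      exact ⟨c, fun _ => hc.symm⟩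
    · exact ⟨0, fun h => absurd h hs⟩
  choose c hc using hex
  have hVγ : ∀ s ∈ S, V (γ s) ≠ 0 := fun s hs => h0 _ (hγ.mem s hs)
  have hVc : ContinuousOn (fun s => V (γ s)) S := hV.comp hγ.smooth.continuousOn hγ.mem
  refine ⟨c, ?_, ?_, ?_⟩
  -- `derivWithin` is continuous on sets of unique differentiability, and a one-point interval is
  -- not one.
  · rcases S.subsingleton_or_nontrivial with hS | hS
    · exact hS.continuousOn c
    · have hu : UniqueDiffOn ℝ S := by
        obtain ⟨x, hx, y, hy, hxy⟩ := hS.exists_lt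
        refine uniqueDiffOn_convex hγ.interval.convex ?_
        have : (interior (Icc x y)).Nonempty := by rw [interior_Icc]; exact nonempty_Ioo.2 hxy
        exact this.mono (interior_mono (hγ.interval.out hx hy))
      exact continuousOn_of_eq_smul (hγ.smooth.continuousOn_derivWithin hu (by simp)) hVc hVγ hc
  · intro s hs h
    have h2 := hγ.spans s hs
    rw [hc s hs, h, zero_smul, hker _ (hγ.mem s hs)] at h2
    have : V (γ s) ∈ Submodule.span ℝ {(0 : E)} := h2 ▸ Submodule.mem_span_singleton_self _
    rw [Submodule.span_zero_singleton, Submodule.mem_bot] at this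
    exact hVγ s hs this
  · intro s hs
    rw [← hc s hs]
    exact ((hγ.smooth s hs).differentiableWithinAt (by simp)).hasDerivWithinAt

end Curves

/-! ### Flows with a trap -/

/-- A vector field `(∂ₓa, -∂ₜa • e + W)` on `[-1, 1] × K`, where `x = ξ p` is the coordinate
along `e`, the transverse coordinate `y = υ p` is conserved, and `W` spans the trapped directions.
It is reversible under `t ↦ -t`, and its first component vanishes only at points with `x = x₀` and
`t = ±1/2`. -/
structure TrapFlow (E Y : Type*) [NormedAddCommGroup E] [NormedSpace ℝ E]
    [NormedAddCommGroup Y] [NormedSpace ℝ Y] where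
  K : Set E
  Γ : AddSubgroup E
  e : E
  ξ : E →L[ℝ] ℝ
  υ : E →L[ℝ] Y
  X : Set ℝ
  x₀ : ℝ
  a : Y × ℝ × ℝ → ℝ
  W : Y × ℝ × ℝ → E
  ξ_e : ξ e = 1
  υ_e : υ e = 0
  ξ_W : ∀ q, ξ (W q) = 0
  υ_W : ∀ q, υ (W q) = 0
  ξ_Γ : ∀ τ ∈ Γ, ξ τ = 0
  ordConnected : X.OrdConnected
  x₀_mem : x₀ ∈ X
  ξ_mem : ∀ p ∈ K, ξ p ∈ X
  contDiff_a : ContDiff ℝ ∞ a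
  continuousOn_W : ContinuousOn W (univ ×ˢ X ×ˢ Icc (-1) 1)
  nonneg : ∀ y, ∀ x ∈ X, ∀ t ∈ Icc (-1 : ℝ) 1, 0 ≤ fderiv ℝ a (y, x, t) (0, 1, 0)
  trap_eq : ∀ y, ∀ x ∈ X, ∀ t ∈ Icc (-1 : ℝ) 1, fderiv ℝ a (y, x, t) (0, 1, 0) = 0 →
    x = x₀ ∧ (t = 1 / 2 ∨ t = -(1 / 2))
  trap_critical : ∀ y, ∀ x ∈ X, ∀ t ∈ Icc (-1 : ℝ) 1, fderiv ℝ a (y, x, t) (0, 1, 0) = 0 →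
    fderiv ℝ a (y, x, t) = 0
  trap_W : ∀ y, ∀ x ∈ X, ∀ t ∈ Icc (-1 : ℝ) 1, fderiv ℝ a (y, x, t) (0, 1, 0) = 0 →
    ∀ c : ℝ, c ≠ 0 → c • W (y, x, t) ∉ Γ
  a_even : ∀ y, ∀ x ∈ X, ∀ t ∈ Icc (-1 : ℝ) 1, a (y, x, -t) = a (y, x, t)
  ax_even : ∀ y, ∀ x ∈ X, ∀ t ∈ Icc (-1 : ℝ) 1,
    fderiv ℝ a (y, x, -t) (0, 1, 0) = fderiv ℝ a (y, x, t) (0, 1, 0)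
  W_odd : ∀ y, ∀ x ∈ X, ∀ t ∈ Icc (-1 : ℝ) 1, W (y, x, -t) = -W (y, x, t)

namespace TrapFlow

variable {E Y : Type*} [NormedAddCommGroup E] [NormedSpace ℝ E]
    [NormedAddCommGroup Y] [NormedSpace ℝ Y] (M : TrapFlow E Y)

/-- The arguments `(y, x, t)` of `a` at a point of `[-1, 1] × K`. -/
noncomputable def coord : ℝ × E →L[ℝ] Y × ℝ × ℝ :=
  (M.υ.comp (ContinuousLinearMap.snd ℝ ℝ E)).prod
    ((M.ξ.comp (ContinuousLinearMap.snd ℝ ℝ E)).prod (ContinuousLinearMap.fst ℝ ℝ E))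

@[simp] theorem coord_apply (z : ℝ × E) : M.coord z = (M.υ z.2, M.ξ z.2, z.1) := rfl

/-- The partial derivative of `a` along `x`. -/
noncomputable def ax (q : Y × ℝ × ℝ) : ℝ := fderiv ℝ M.a q (0, 1, 0)

/-- The partial derivative of `a` along `t`. -/
noncomputable def at' (q : Y × ℝ × ℝ) : ℝ := fderiv ℝ M.a q (0, 0, 1)

/-- The vector field. -/
noncomputable def field (z : ℝ × E) : ℝ × E :=
  (M.ax (M.coord z), -M.at' (M.coord z) • M.e + M.W (M.coord z))

theorem contDiff_ax : ContDiff ℝ ∞ M.ax :=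
  (M.contDiff_a.fderiv_right (m := ∞) (by simp)).clm_apply contDiff_const

theorem contDiff_at : ContDiff ℝ ∞ M.at' :=
  (M.contDiff_a.fderiv_right (m := ∞) (by simp)).clm_apply contDiff_const

theorem hasFDerivAt_a (q : Y × ℝ × ℝ) : HasFDerivAt M.a (fderiv ℝ M.a q) q :=
  (M.contDiff_a.differentiable (by simp) q).hasFDerivAt

theorem fderiv_a_apply (q : Y × ℝ × ℝ) (y : Y) (x t : ℝ) :
    fderiv ℝ M.a q (y, x, t) = fderiv ℝ M.a q (y, 0, 0) + x * M.ax q + t * M.at' q := by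
  have : (y, x, t) = (y, (0 : ℝ), (0 : ℝ)) + x • ((0 : Y), (1 : ℝ), (0 : ℝ)) +
      t • ((0 : Y), (0 : ℝ), (1 : ℝ)) := by simp
  rw [this, map_add, map_add, map_smul, map_smul]
  rfl

theorem fderiv_a_eq_zero {z : ℝ × E} (hz : z ∈ plugDomain M.K) (h : M.ax (M.coord z) = 0) :
    fderiv ℝ M.a (M.coord z) = 0 :=
  M.trap_critical _ _ (M.ξ_mem _ hz.2) _ hz.1 h

theorem at_eq_zero {z : ℝ × E} (hz : z ∈ plugDomain M.K) (h : M.ax (M.coord z) = 0) :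
    M.at' (M.coord z) = 0 := by
  rw [at', M.fderiv_a_eq_zero hz h]; rfl

theorem smul_W_notMem {z : ℝ × E} (hz : z ∈ plugDomain M.K) (h : M.ax (M.coord z) = 0) {c : ℝ}
    (hc : c ≠ 0) : c • M.W (M.coord z) ∉ M.Γ :=
  M.trap_W _ _ (M.ξ_mem _ hz.2) _ hz.1 h c hc

theorem field_ne_zero {z : ℝ × E} (hz : z ∈ plugDomain M.K) : M.field z ≠ 0 := by
  intro h
  have h1 : M.ax (M.coord z) = 0 := congrArg Prod.fst h
  have h3 : M.W (M.coord z) = 0 := by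
    have := congrArg Prod.snd h
    simp only [field, M.at_eq_zero hz h1] at this
    simpa only [neg_zero, zero_smul, zero_add, Prod.snd_zero] using this
  exact M.smul_W_notMem hz h1 one_ne_zero (by rw [h3, smul_zero]; exact M.Γ.zero_mem)

theorem continuousOn_field : ContinuousOn M.field (plugDomain M.K) := by
  have hW : ContinuousOn (fun z => M.W (M.coord z)) (plugDomain M.K) :=
    M.continuousOn_W.comp M.coord.continuous.continuousOn
      fun z hz => ⟨mem_univ _, M.ξ_mem _ hz.2, hz.1⟩
  have h1 := M.contDiff_ax.continuous.comp M.coord.continuous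
  have h2 := M.contDiff_at.continuous.comp M.coord.continuous
  exact h1.continuousOn.prodMk ((h2.neg.smul continuous_const).continuousOn.add hW)

/-- For fixed y and t the derivative can vanish at x₀ only. This makes x a function of the conserved
quantities and of t. -/
theorem strictMonoOn_a (y : Y) {t : ℝ} (ht : t ∈ Icc (-1 : ℝ) 1) :
    StrictMonoOn (fun x => M.a (y, x, t)) M.X := by
  refine strictMonoOn_of_deriv_nonneg_of_zero M.ordConnected (f' := fun x => M.ax (y, x, t))
    (x₀ := M.x₀) (fun x => ?_) (fun x hx => M.nonneg y x hx t ht)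
    (fun x hx h => (M.trap_eq y x hx t ht h).1)
  have h : HasDerivAt (fun x : ℝ => (y, x, t)) ((0 : Y), (1 : ℝ), (0 : ℝ)) x :=
    (hasDerivAt_const x y).prodMk ((hasDerivAt_id x).prodMk (hasDerivAt_const x t))
  exact (M.hasFDerivAt_a (y, x, t)).comp_hasDerivAt x h

/-- A curve in `[-1, 1] × K` whose velocity is a continuous nonvanishing multiple of the field. -/
structure IsOrbit (S : Set ℝ) (γ : ℝ → ℝ × E) (c : ℝ → ℝ) : Prop where
  interval : S.OrdConnected
  mem : ∀ s ∈ S, γ s ∈ plugDomain M.K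
  continuousOn : ContinuousOn c S
  ne_zero : ∀ s ∈ S, c s ≠ 0
  hasDeriv : ∀ s ∈ S, HasDerivWithinAt γ (c s • M.field (γ s)) S s

/-! ### Conserved quantities, trapping and crossing of orbits -/

namespace IsOrbit

variable {M} {S : Set ℝ} {γ : ℝ → ℝ × E} {c : ℝ → ℝ} (h : M.IsOrbit S γ c)
include h

theorem X_mem {s : ℝ} (hs : s ∈ S) : M.ξ (γ s).2 ∈ M.X := M.ξ_mem _ (h.mem s hs).2

theorem t_mem {s : ℝ} (hs : s ∈ S) : (γ s).1 ∈ Icc (-1 : ℝ) 1 := (h.mem s hs).1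

theorem hasDeriv_fst {s : ℝ} (hs : s ∈ S) :
    HasDerivWithinAt (fun s => (γ s).1) (c s * M.ax (M.coord (γ s))) S s :=
  (ContinuousLinearMap.fst ℝ ℝ E).hasFDerivAt.comp_hasDerivWithinAt s (h.hasDeriv s hs)

theorem hasDeriv_snd {s : ℝ} (hs : s ∈ S) :
    HasDerivWithinAt (fun s => (γ s).2) (c s • (M.field (γ s)).2) S s :=
  (ContinuousLinearMap.snd ℝ ℝ E).hasFDerivAt.comp_hasDerivWithinAt s (h.hasDeriv s hs)

theorem hasDeriv_ξ {s : ℝ} (hs : s ∈ S) :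
    HasDerivWithinAt (fun s => M.ξ (γ s).2) (c s * -M.at' (M.coord (γ s))) S s := by
  have := M.ξ.hasFDerivAt.comp_hasDerivWithinAt s (h.hasDeriv_snd hs)
  refine this.congr_deriv ?_
  simp [field, M.ξ_e, M.ξ_W]

theorem hasDeriv_υ {s : ℝ} (hs : s ∈ S) : HasDerivWithinAt (fun s => M.υ (γ s).2) 0 S s := by
  have := M.υ.hasFDerivAt.comp_hasDerivWithinAt s (h.hasDeriv_snd hs)
  refine this.congr_deriv ?_
  simp [field, M.υ_e, M.υ_W]

theorem υ_eq {s u : ℝ} (hs : s ∈ S) (hu : u ∈ S) : M.υ (γ u).2 = M.υ (γ s).2 :=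
  eq_of_hasDerivWithinAt_zero h.interval (fun _ hs => h.hasDeriv_υ hs) hs hu

/-- For fixed y the function a is a Hamiltonian of the (x, t)-motion: ∂ₓa·(-∂ₜa) + ∂ₜa·∂ₓa = 0. -/
theorem a_eq {s u : ℝ} (hs : s ∈ S) (hu : u ∈ S) :
    M.a (M.coord (γ u)) = M.a (M.coord (γ s)) := by
  refine eq_of_hasDerivWithinAt_zero h.interval (f := fun s => M.a (M.coord (γ s)))
    (fun s hs => ?_) hs hu
  have h1 : HasDerivWithinAt (fun s => M.coord (γ s))
      ((0 : Y), c s * -M.at' (M.coord (γ s)), c s * M.ax (M.coord (γ s))) S s :=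
    (h.hasDeriv_υ hs).prodMk ((h.hasDeriv_ξ hs).prodMk (h.hasDeriv_fst hs))
  refine ((M.hasFDerivAt_a _).comp_hasDerivWithinAt s h1).congr_deriv ?_
  rw [fderiv_a_apply, show ((0 : Y), (0 : ℝ), (0 : ℝ)) = 0 from rfl, map_zero]
  ring

/-- The orbits through a point of the trap stay in the trap. -/
theorem eq_of_ax_eq_zero {s u : ℝ} (hs : s ∈ S) (hu : u ∈ S) (h0 : M.ax (M.coord (γ s)) = 0) :
    M.coord (γ u) = M.coord (γ s) := by
  set y := M.υ (γ s).2 with hy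
  -- With y frozen, (x, t) alone follows a smooth planar field up to the factor c. This field
  -- vanishes at the trap, which can therefore be neither reached nor left.
  have hv : ContDiff ℝ 1 fun q : ℝ × ℝ => (-M.at' (y, q), M.ax (y, q)) := by
    have h1 : ContDiff ℝ ∞ fun q : ℝ × ℝ => (y, q) := contDiff_const.prodMk contDiff_id
    exact ((M.contDiff_at.comp h1).neg.prodMk (M.contDiff_ax.comp h1)).of_le (by simp)
  have hq : ∀ r ∈ S, HasDerivWithinAt (fun r => (M.coord (γ r)).2)
      (c r • (fun q : ℝ × ℝ => (-M.at' (y, q), M.ax (y, q))) (M.coord (γ r)).2) S r := by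
    intro r hr
    refine ((h.hasDeriv_ξ hr).prodMk (h.hasDeriv_fst hr)).congr_deriv ?_
    simp [hy, ← h.υ_eq hs hr]
  have h2 := eq_of_hasDerivWithinAt_smul_of_zero h.interval hv h.continuousOn hq hs ?_ hu
  · simp only [coord_apply, Prod.mk.injEq] at h2
    simp [h2.1, h2.2, h.υ_eq hs hu]
  · simp only [Prod.mk_eq_zero, neg_eq_zero]
    exact ⟨M.at_eq_zero (h.mem s hs) h0, h0⟩

theorem hasDerivAt_fst_of_mem_Ioo {r₁ r₂ r : ℝ} (h₁ : r₁ ∈ S) (h₂ : r₂ ∈ S) (hr : r ∈ Ioo r₁ r₂) :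
    HasDerivAt (fun s => (γ s).1) (c r * M.ax (M.coord (γ r))) r :=
  (h.hasDeriv_fst (h.interval.out h₁ h₂ ⟨hr.1.le, hr.2.le⟩)).hasDerivAt
    (mem_of_superset (Icc_mem_nhds hr.1 hr.2) (h.interval.out h₁ h₂))

theorem continuousOn_curve : ContinuousOn γ S := fun s hs => (h.hasDeriv s hs).continuousWithinAt

/-- An orbit does not cross `[-1, 1] × K` if it enters on the level of `a` that contains the
trap. -/
theorem fst_ne_one {s u : ℝ} (hs : s ∈ S) (hu : u ∈ S) (hs1 : (γ s).1 = -1)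
    (hsa : M.a (M.coord (γ s)) = M.a (M.υ (γ s).2, M.x₀, 1 / 2))
    (hsx : M.ax (M.υ (γ s).2, M.x₀, 1 / 2) = 0) : (γ u).1 ≠ 1 := by
  intro hu1
  have hsub : uIcc s u ⊆ S := h.interval.uIcc_subset hs hu
  have hc : ContinuousOn (fun s => (γ s).1) (uIcc s u) :=
    (continuous_fst.comp_continuousOn h.continuousOn_curve).mono hsub
  have hmem : (1 / 2 : ℝ) ∈ uIcc (γ s).1 (γ u).1 := by
    rw [hs1, hu1, uIcc_of_le (by norm_num)]; norm_num
  obtain ⟨r, hr, hr'⟩ := intermediate_value_uIcc hc hmem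
  have hrS := hsub hr
  simp only at hr'
  -- At t = 1/2 the level of a determines x, so the orbit sits on the trap and would have t = 1/2 at
  -- all times.
  have hrx : M.ξ (γ r).2 = M.x₀ := by
    refine (M.strictMonoOn_a (M.υ (γ s).2) (t := 1 / 2) (by norm_num)).injOn (h.X_mem hrS)
      M.x₀_mem ?_
    have := h.a_eq hs hrS
    rw [hsa] at this
    simpa [h.υ_eq hs hrS, hr'] using this
  have hr0 : M.ax (M.coord (γ r)) = 0 := by
    simpa [h.υ_eq hs hrS, hr', hrx] using hsx
  have := h.eq_of_ax_eq_zero hrS hs hr0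
  simp only [coord_apply, Prod.mk.injEq] at this
  linarith [this.2.2]

/-- Entry and exit points match. -/
theorem snd_eq_of_crossing {s u : ℝ} (hs : s ∈ S) (hu : u ∈ S) (hs1 : (γ s).1 = -1)
    (hu1 : (γ u).1 = 1) : (γ u).2 = (γ s).2 := by
  have hsub : uIcc s u ⊆ S := h.interval.uIcc_subset hs hu
  -- A zero of ∂ₓa would pin t at ±1/2 for the whole orbit, which starts at t = -1.
  have hne : ∀ r ∈ S, M.ax (M.coord (γ r)) ≠ 0 := by
    intro r hr h0
    have := h.eq_of_ax_eq_zero hr hs h0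
    have h2 := (M.trap_eq _ _ (h.X_mem hr) _ (h.t_mem hr) h0).2
    simp only [coord_apply, Prod.mk.injEq] at this
    rcases h2 with h2 | h2 <;> linarith [this.2.2]
  have hc : ContinuousOn (fun s => (γ s).1) (uIcc s u) :=
    (continuous_fst.comp_continuousOn h.continuousOn_curve).mono hsub
  have hinj : InjOn (fun s => (γ s).1) (uIcc s u) := by
    have key : ∀ r₁ ∈ uIcc s u, ∀ r₂ ∈ uIcc s u, r₁ < r₂ → (γ r₁).1 ≠ (γ r₂).1 := by
      intro r₁ hr₁ r₂ hr₂ hlt he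
      obtain ⟨r, hr, hr'⟩ := exists_hasDerivAt_eq_zero hlt
        (hc.mono (ordConnected_uIcc.out hr₁ hr₂)) he
        (fun r hr => h.hasDerivAt_fst_of_mem_Ioo (hsub hr₁) (hsub hr₂) hr)
      have hrS := h.interval.out (hsub hr₁) (hsub hr₂) ⟨hr.1.le, hr.2.le⟩
      exact mul_ne_zero (h.ne_zero r hrS) (hne r hrS) hr'
    intro r₁ hr₁ r₂ hr₂ he
    rcases lt_trichotomy r₁ r₂ with hl | hl | hl
    · exact absurd he (key _ hr₁ _ hr₂ hl)
    · exact hl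
    · exact absurd he.symm (key _ hr₂ _ hr₁ hl)
  -- By Rolle's theorem t is injective along the orbit. From here τ = t is the parameter, and ψ(τ)
  -- is the original time.
  obtain ⟨ψ, hψc, hψ⟩ := exists_continuousOn_inverse hc hinj
  simp only [hs1, hu1, uIcc_of_le (show (-1 : ℝ) ≤ 1 by norm_num)] at hψc hψ
  have hψs : ψ (-1) = s := hinj (hψ (-1) (by norm_num)).1 left_mem_uIcc
    (by simp only [(hψ (-1) (by norm_num)).2, hs1])
  have hψu : ψ 1 = u := hinj (hψ 1 (by norm_num)).1 right_mem_uIcc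
    (by simp only [(hψ 1 (by norm_num)).2, hu1])
  -- the position on the two halves of the orbit
  have hx : ∀ τ ∈ Icc (-1 : ℝ) 1, M.coord (γ (ψ (-τ))) = (M.υ (γ s).2, M.ξ (γ (ψ τ)).2, -τ) := by
    intro τ hτ
    have hτ' : -τ ∈ Icc (-1 : ℝ) 1 := ⟨by linarith [hτ.2], by linarith [hτ.1]⟩
    have hS₁ := hsub (hψ τ hτ).1
    have hS₂ := hsub (hψ (-τ) hτ').1
    have e1 := (hψ τ hτ).2
    have e2 := (hψ (-τ) hτ').2
    have h3 := h.a_eq hS₁ hS₂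
    simp only [coord_apply, h.υ_eq hs hS₁, h.υ_eq hs hS₂, e1, e2] at h3 ⊢
    rw [M.a_even _ _ (h.X_mem hS₂) _ hτ] at h3
    rw [(M.strictMonoOn_a (M.υ (γ s).2) hτ).injOn (h.X_mem hS₂) (h.X_mem hS₁) h3]
  -- The position without its x-component. Its velocity in τ is W/∂ₓa, where the factor c has
  -- cancelled; x being even in τ, this velocity is odd.
  set θ : ℝ → E := fun r => (γ r).2 - M.ξ (γ r).2 • M.e with hθ
  have hθd : ∀ r ∈ S, HasDerivWithinAt θ
      (c r • M.W (M.coord (γ r))) S r := by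
    intro r hr
    refine ((h.hasDeriv_snd hr).sub ((h.hasDeriv_ξ hr).smul_const M.e)).congr_deriv ?_
    simp only [field]
    module
  set w : ℝ → E := fun τ => (M.ax (M.coord (γ (ψ τ))))⁻¹ • M.W (M.coord (γ (ψ τ))) with hw
  have hθψ : ∀ τ ∈ Ioo (-1 : ℝ) 1, HasDerivAt (fun τ => θ (ψ τ)) (w τ) τ := by
    intro τ hτ
    have hτ' : τ ∈ Icc (-1 : ℝ) 1 := ⟨hτ.1.le, hτ.2.le⟩
    have hS := hsub (hψ τ hτ').1
    have hnhds : S ∈ 𝓝 (ψ τ) := by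
      have hI : ψ τ ∈ uIoo s u := by
        have h1 : ψ τ ≠ s := fun e => by
          have := (hψ τ hτ').2; rw [e, hs1] at this; linarith [hτ.1]
        have h2 : ψ τ ≠ u := fun e => by
          have := (hψ τ hτ').2; rw [e, hu1] at this; linarith [hτ.2]
        have := (hψ τ hτ').1
        rcases le_total s u with hsu | hsu
        · rw [uIoo_of_le hsu]; rw [uIcc_of_le hsu] at this
          exact ⟨lt_of_le_of_ne this.1 h1.symm, lt_of_le_of_ne this.2 h2⟩
        · rw [uIoo_of_ge hsu]; rw [uIcc_of_ge hsu] at this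
          exact ⟨lt_of_le_of_ne this.1 h2.symm, lt_of_le_of_ne this.2 h1⟩
      exact mem_of_superset (isOpen_Ioo.mem_nhds hI) (uIoo_subset_uIcc_self.trans hsub)
    have hf := (h.hasDeriv_fst hS).hasDerivAt hnhds
    have hf0 : c (ψ τ) * M.ax (M.coord (γ (ψ τ))) ≠ 0 := mul_ne_zero (h.ne_zero _ hS) (hne _ hS)
    have hψd := HasDerivAt.of_local_left_inverse
      (hψc.continuousAt (Icc_mem_nhds hτ.1 hτ.2)) hf hf0
      (by filter_upwards [Icc_mem_nhds hτ.1 hτ.2] with r hr using (hψ r hr).2)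
    refine (((hθd _ hS).hasDerivAt hnhds).scomp τ hψd).congr_deriv ?_
    rw [hw, smul_smul, mul_inv]
    congr 1
    have := h.ne_zero _ hS
    field_simp
  have hodd : ∀ τ ∈ Ioo (-1 : ℝ) 1, w (-τ) = -w τ := by
    intro τ hτ
    have hτ' : τ ∈ Icc (-1 : ℝ) 1 := ⟨hτ.1.le, hτ.2.le⟩
    have hS := hsub (hψ τ hτ').1
    have e1 := (hψ τ hτ').2
    have h3 := hx τ hτ'
    simp only [hw, h3]
    simp only [coord_apply, e1, h.υ_eq hs hS, ax]
    rw [M.ax_even _ _ (h.X_mem hS) _ hτ', M.W_odd _ _ (h.X_mem hS) _ hτ']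
    simp
  have hcont : ContinuousOn (fun τ => θ (ψ τ)) (Icc (-1) 1) := by
    have : ContinuousOn θ S := fun r hr => (hθd r hr).continuousWithinAt
    exact this.comp hψc fun τ hτ => hsub (hψ τ hτ).1
  have hmaps : MapsTo (fun τ : ℝ => -τ) (Icc 0 1) (Icc (-1) 1) :=
    fun τ hτ => ⟨by linarith [hτ.2], by linarith [hτ.1]⟩
  -- The difference has derivative w(τ) + w(-τ) = 0 and vanishes at τ = 0; at τ = 1 it compares exit
  -- and entry.
  have hconst := constant_of_has_deriv_right_zero (f := fun τ => θ (ψ τ) - θ (ψ (-τ))) (a := 0) (b := 1)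
    ((hcont.mono (Icc_subset_Icc_left (by norm_num))).sub
      (hcont.comp continuous_neg.continuousOn hmaps))
    (fun τ hτ => by
      have hτ' : τ ∈ Ioo (-1 : ℝ) 1 := ⟨by linarith [hτ.1], hτ.2⟩
      have hτ'' : -τ ∈ Ioo (-1 : ℝ) 1 := ⟨by linarith [hτ.2], by linarith [hτ.1]⟩
      have hd := (hθψ τ hτ').sub ((hθψ (-τ) hτ'').scomp τ (hasDerivAt_neg τ))
      refine (hd.congr_deriv ?_).hasDerivWithinAt
      simp [hodd τ hτ'])
    1 (by norm_num)
  simp only [hψs, hψu, neg_zero, sub_self, sub_eq_zero, hθ] at hconst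
  have h5 := hx 1 (by norm_num)
  simp only [hψs, hψu, coord_apply, Prod.mk.injEq] at h5
  rw [h5.2.1] at hconst
  exact sub_left_injective hconst

end IsOrbit

/-- No orbit is closed. -/
theorem not_periodic {γ : ℝ → ℝ × E} {c : ℝ → ℝ} (h : M.IsOrbit univ γ c) {τ : ℝ × E}
    (hτ : τ ∈ plugGroup M.Γ) (hper : ∀ s, γ (s + 1) = γ s + τ) : False := by
  have hτ1 : τ.1 = 0 := by simpa using hτ.1
  have hτ2 : τ.2 ∈ M.Γ := hτ.2
  have hd : ∀ s, HasDerivAt (fun s => (γ s).1) (c s * M.ax (M.coord (γ s))) s := fun s =>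
    (h.hasDeriv_fst (mem_univ s)).hasDerivAt univ_mem
  have hax : ∀ s, 0 ≤ M.ax (M.coord (γ s)) := fun s =>
    M.nonneg _ _ (h.X_mem (mem_univ s)) _ (h.t_mem (mem_univ s))
  have hnat : ∀ (s : ℝ) (k : ℕ), (γ (s + k)).1 = (γ s).1 := by
    intro s k
    induction k with
    | zero => simp
    | succ k ih =>
      rw [Nat.cast_succ, ← add_assoc, hper, Prod.fst_add, hτ1, add_zero, ih]
  -- The factor c has constant sign, so t is monotone in s; being also periodic, it is constant.
  have hconst : ∀ s u, (γ s).1 = (γ u).1 := by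
    have hcases : Monotone (fun s => (γ s).1) ∨ Antitone (fun s => (γ s).1) := by
      rcases pos_or_neg_of_continuousOn h.interval h.continuousOn h.ne_zero with hc | hc
      · exact .inl (monotone_of_hasDerivAt_nonneg hd fun s => mul_nonneg (hc s (mem_univ s)).le (hax s))
      · exact .inr (antitone_of_hasDerivAt_nonpos hd fun s =>
          mul_nonpos_of_nonpos_of_nonneg (hc s (mem_univ s)).le (hax s))
    have key : ∀ s u, s ≤ u → (γ s).1 = (γ u).1 := by
      intro s u hsu
      obtain ⟨k, hk⟩ := exists_nat_ge (u - s)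
      have hk' : u ≤ s + k := by linarith
      rcases hcases with hm | hm
      · exact le_antisymm (hm hsu) ((hm hk').trans (hnat s k).le)
      · exact le_antisymm ((hnat s k).ge.trans (hm hk')) (hm hsu)
    intro s u
    rcases le_total s u with hsu | hsu
    · exact key s u hsu
    · exact (key u s hsu).symm
  have h0 : ∀ s, M.ax (M.coord (γ s)) = 0 := by
    intro s
    have h1 : (fun s => (γ s).1) = fun _ => (γ 0).1 := funext fun u => hconst u 0
    have h2 := hd s
    rw [h1] at h2
    exact (mul_eq_zero.1 (h2.unique (hasDerivAt_const s _))).resolve_left (h.ne_zero s (mem_univ s))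
  have hcoord : ∀ s, M.coord (γ s) = M.coord (γ 0) := fun s =>
    h.eq_of_ax_eq_zero (mem_univ 0) (mem_univ s) (h0 0)
  set W₀ := M.W (M.coord (γ 0)) with hW₀
  have hW : ∀ c : ℝ, c ≠ 0 → c • W₀ ∉ M.Γ := fun c hc => M.smul_W_notMem (h.mem 0 (mem_univ 0)) (h0 0) hc
  have hWne : W₀ ≠ 0 := by
    intro he
    refine hW 1 one_ne_zero ?_
    rw [he, smul_zero]
    exact M.Γ.zero_mem
  have hsnd : ∀ s, HasDerivAt (fun s => (γ s).2) (c s • W₀) s := by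
    intro s
    refine ((h.hasDeriv_snd (mem_univ s)).hasDerivAt univ_mem).congr_deriv ?_
    have hat := M.at_eq_zero (h.mem s (mem_univ s)) (h0 s)
    simp only [field, hat]
    rw [hcoord s, ← hW₀]
    module
  -- Since the velocity is c·W₀, the function l(γ)/l(W₀) is a primitive of c. Hence the displacement
  -- over one period is a multiple of W₀.
  obtain ⟨l, -, hl⟩ := exists_dual_vector ℝ W₀ (norm_ne_zero_iff.2 hWne)
  have hlne : l W₀ ≠ 0 := by simpa [hl] using hWne
  have hlam : ∀ s, HasDerivAt (fun s => l (γ s).2 / l W₀) (c s) s := by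
    intro s
    refine ((l.hasFDerivAt.comp_hasDerivAt s (hsnd s)).div_const (l W₀)).congr_deriv ?_
    simp [hlne]
  have hdiff := eq_of_hasDerivWithinAt_zero (S := univ) ordConnected_univ
    (f := fun s => (γ s).2 - (l (γ s).2 / l W₀) • W₀) (fun s _ => by
      refine (((hsnd s).sub ((hlam s).smul_const W₀)).congr_deriv ?_).hasDerivWithinAt
      exact sub_self _) (mem_univ (0 : ℝ)) (mem_univ (1 : ℝ))
  have hτ' : τ.2 = (l (γ 1).2 / l W₀ - l (γ 0).2 / l W₀) • W₀ := by
    have h1 := hper 0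
    rw [zero_add] at h1
    have h2 : (γ 1).2 = (γ 0).2 + τ.2 := by rw [h1]; rfl
    rw [sub_smul, ← sub_eq_iff_eq_add'.2 h2]
    rw [sub_eq_sub_iff_add_eq_add] at hdiff ⊢
    rw [add_comm ((l (γ 1).2 / l W₀) • W₀), hdiff]
  -- By Rolle's theorem a zero displacement would give a zero of c.
  have hne : l (γ 0).2 / l W₀ ≠ l (γ 1).2 / l W₀ := by
    intro he
    obtain ⟨r, -, hr⟩ := exists_hasDerivAt_eq_zero (f := fun s => l (γ s).2 / l W₀) zero_lt_one
      (fun s _ => (hlam s).continuousAt.continuousWithinAt) he (fun s _ => hlam s)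
    exact h.ne_zero r (mem_univ r) hr
  exact hW _ (sub_ne_zero.2 hne.symm) (hτ' ▸ hτ2)

end TrapFlow

/-! ### Symplectic plugs from flows with a trap -/

namespace TrapFlow

variable {E Y : Type*} [NormedAddCommGroup E] [NormedSpace ℝ E]
    [NormedAddCommGroup Y] [NormedSpace ℝ Y] (M : TrapFlow E Y)

/-- The map that moves the coordinate `x = ξ p` of `p` to `(1 - s) x + s a`. -/
noncomputable def push (s : ℝ) (z : ℝ × E) : E := z.2 + (s * (M.a (M.coord z) - M.ξ z.2)) • M.e

/-- The derivative of `push s`. -/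
noncomputable def dpush (s : ℝ) (z v : ℝ × E) : E :=
  v.2 + (s * (fderiv ℝ M.a (M.coord z) (M.coord v) - M.ξ v.2)) • M.e

/-- The derivative of `b ∘ coord`. -/
noncomputable def db (b : Y × ℝ × ℝ → ℝ) (z v : ℝ × E) : ℝ := fderiv ℝ b (M.coord z) (M.coord v)

variable {M}

theorem ξ_dpush (z v : ℝ × E) : M.ξ (M.dpush 1 z v) = fderiv ℝ M.a (M.coord z) (M.coord v) := by
  simp [dpush, M.ξ_e]

theorem υ_dpush (s : ℝ) (z v : ℝ × E) : M.υ (M.dpush s z v) = M.υ v.2 := by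
  simp [dpush, M.υ_e]

theorem db_eq (b : Y × ℝ × ℝ → ℝ) (z v : ℝ × E) : M.db b z v =
    fderiv ℝ b (M.coord z) (M.υ v.2, 0, 0) + M.ξ v.2 * fderiv ℝ b (M.coord z) (0, 1, 0) +
      v.1 * fderiv ℝ b (M.coord z) (0, 0, 1) := by
  have : M.coord v = (M.υ v.2, (0 : ℝ), (0 : ℝ)) + M.ξ v.2 • ((0 : Y), (1 : ℝ), (0 : ℝ)) +
      v.1 • ((0 : Y), (0 : ℝ), (1 : ℝ)) := by simp
  rw [db, this, map_add, map_add, map_smul, map_smul]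
  rfl

theorem fderiv_a_coord (z v : ℝ × E) : fderiv ℝ M.a (M.coord z) (M.coord v) =
    fderiv ℝ M.a (M.coord z) (M.υ v.2, 0, 0) + M.ξ v.2 * M.ax (M.coord z) +
      v.1 * M.at' (M.coord z) :=
  M.fderiv_a_apply _ _ _ _

theorem dpush_field (z : ℝ × E) :
    M.dpush 1 z (M.field z) = M.W (M.coord z) := by
  have h1 : M.υ (M.field z).2 = 0 := by simp [field, M.υ_e, M.υ_W]
  have h2 : M.ξ (M.field z).2 = -M.at' (M.coord z) := by simp [field, M.ξ_e, M.ξ_W]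
  rw [dpush, fderiv_a_coord, h1, h2, show ((0 : Y), (0 : ℝ), (0 : ℝ)) = 0 from rfl, map_zero]
  simp only [field]
  module

/-- The data that make the product of a flow with a trap a symplectic plug: an embedding `φ` of `K`
with pull-back `ρ` of the symplectic form, and the two-form `σ` with the characteristic field of
the flow. -/
structure IsSymplectic (M : TrapFlow E Y) (m : ℕ) (b : Y × ℝ × ℝ → ℝ) (φ : E → StdSpace m)
    (ρ : E → E →ₗ[ℝ] E →ₗ[ℝ] ℝ) (σ : ℝ × E → (ℝ × E) [⋀^Fin 2]→L[ℝ] ℝ) : Prop where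
  contDiff_b : ContDiff ℝ ∞ b
  embedding : IsEmbeddingOn M.K M.Γ φ
  pullback : ∀ p ∈ M.K, ∀ v w, stdForm m (fderiv ℝ φ p v) (fderiv ℝ φ p w) = ρ p v w
  nondegenerate : ∀ p ∈ M.K, ∀ v, (∀ w, ρ p v w = 0) → v = 0
  trap_b : ∀ z ∈ plugDomain M.K, M.ax (M.coord z) = 0 → fderiv ℝ b (M.coord z) (0, 1, 0) ≠ 0
  ρ_W : ∀ z ∈ plugDomain M.K, ∀ w, ρ (M.push 1 z) (M.W (M.coord z)) w =
    fderiv ℝ b (M.coord z) (0, 1, 0) * (M.ξ w - fderiv ℝ M.a (M.coord z) (M.υ w, 0, 0)) +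
      M.ax (M.coord z) * fderiv ℝ b (M.coord z) (M.υ w, 0, 0)
  σ_eq : ∀ z ∈ plugDomain M.K, ∀ v w, σ z ![v, w] =
    (M.db b z v * w.1 - v.1 * M.db b z w) + ρ (M.push 1 z) (M.dpush 1 z v) (M.dpush 1 z w)
  exact : IsExactOn (plugDomain M.K) (plugGroup M.Γ) σ
  push_mem : ∀ z ∈ plugDomain M.K, ∀ s ∈ Icc (0 : ℝ) 1, M.push s z ∈ M.K
  add_mem : ∀ p ∈ M.K, ∀ τ ∈ M.Γ, p + τ ∈ M.K
  a_periodic : ∀ z ∈ plugDomain M.K, ∀ τ ∈ plugGroup M.Γ, M.a (M.coord (z + τ)) = M.a (M.coord z)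
  b_periodic : ∀ z ∈ plugDomain M.K, ∀ τ ∈ plugGroup M.Γ, b (M.coord (z + τ)) = b (M.coord z)
  near : NearBoundary M.K fun z => M.a (M.coord z) = M.ξ z.2 ∧
    (∀ q, fderiv ℝ M.a (M.coord z) q = q.2.1) ∧ b (M.coord z) = 0 ∧ fderiv ℝ b (M.coord z) = 0 ∧
    M.W (M.coord z) = 0
  trapped : ∃ p ∈ M.K, M.a (M.υ p, M.ξ p, -1) = M.a (M.υ p, M.x₀, 1 / 2) ∧
    M.ax (M.υ p, M.x₀, 1 / 2) = 0

variable (M) in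
/-- The isotopy from `(0, j)` to `J`. -/
noncomputable def isotopy {m : ℕ} (b : Y × ℝ × ℝ → ℝ) (φ : E → StdSpace m) (s : ℝ) (z : ℝ × E) : ℝ × (ℝ × StdSpace m) :=
  (s * b (M.coord z), z.1, φ (M.push s z))

namespace IsSymplectic

variable {m : ℕ} {b : Y × ℝ × ℝ → ℝ} {φ : E → StdSpace m} {ρ : E → E →ₗ[ℝ] E →ₗ[ℝ] ℝ}
  {σ : ℝ × E → (ℝ × E) [⋀^Fin 2]→L[ℝ] ℝ} (h : M.IsSymplectic m b φ ρ σ)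
include h

/-- That the field lies in the kernel is a direct cancellation based on `ρ_W`. For the converse,
where ∂ₓa ≠ 0 a multiple of the field removes the t-component, and then `dpush` is invertible on the
rest and ρ nondegenerate. On the trap `dpush` has the extra kernel e, and ∂ₓb ≠ 0 replaces the
missing information. -/
theorem formKer_eq {z : ℝ × E} (hz : z ∈ plugDomain M.K) :
    formKer (σ z) = Submodule.span ℝ {M.field z} := by
  have hmem : ∀ v, v ∈ formKer (σ z) ↔ ∀ w, (M.db b z v * w.1 - v.1 * M.db b z w) +
      ρ (M.push 1 z) (M.dpush 1 z v) (M.dpush 1 z w) = 0 := by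
    intro v
    refine forall_congr' fun w => ?_
    rw [h.σ_eq z hz]
  have hfield : M.field z ∈ formKer (σ z) := by
    rw [hmem]
    intro w
    rw [dpush_field, h.ρ_W z hz, ξ_dpush, υ_dpush, fderiv_a_coord, db_eq, db_eq]
    have h1 : M.υ (M.field z).2 = 0 := by simp [field, M.υ_e, M.υ_W]
    have h2 : M.ξ (M.field z).2 = -M.at' (M.coord z) := by simp [field, M.ξ_e, M.ξ_W]
    rw [h1, h2, show (M.field z).1 = M.ax (M.coord z) from rfl,
      show ((0 : Y), (0 : ℝ), (0 : ℝ)) = 0 from rfl, map_zero]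
    ring
  have hK := h.push_mem z hz 1 (by simp)
  refine le_antisymm (fun v hv => ?_) ((Submodule.span_singleton_le_iff_mem _ _).2 hfield)
  rw [Submodule.mem_span_singleton]
  by_cases h0 : M.ax (M.coord z) = 0
  · have hcrit := M.fderiv_a_eq_zero hz h0
    have hat := M.at_eq_zero hz h0
    have hbx := h.trap_b z hz h0
    set β := fderiv ℝ b (M.coord z) (0, 1, 0) with hβ
    have hd : ∀ w, M.dpush 1 z w = w.2 - M.ξ w.2 • M.e := by
      intro w
      simp [-coord_apply, dpush, hcrit, sub_eq_add_neg]
    have hW : ∀ w, ρ (M.push 1 z) (M.W (M.coord z)) w = β * M.ξ w := by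
      intro w
      rw [h.ρ_W z hz, hcrit, h0]
      simp [hβ]
    rw [hmem] at hv
    -- At a trap point `dpush` kills (0, e) and (1, 0), so these two vectors test the term db ∧ dt
    -- alone.
    have hv1 : v.1 = 0 := by
      have h1 := hv (0, M.e)
      rw [hd (0, M.e), db_eq b z (0, M.e)] at h1
      simpa [-coord_apply, M.ξ_e, M.υ_e, ← hβ, hbx, show ((0 : Y), (0 : ℝ), (0 : ℝ)) = 0 from rfl]
        using h1
    have hdb : M.db b z v = 0 := by
      have h1 := hv (1, 0)
      rw [hd (1, 0)] at h1
      simpa [-coord_apply, hv1] using h1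
    set u := v.2 - M.ξ v.2 • M.e with hu
    have hρ : ∀ w : E, ρ (M.push 1 z) u (w - M.ξ w • M.e) = 0 := by
      intro w
      have h1 := hv (0, w)
      rw [hd, hd, hdb, hv1, ← hu] at h1
      simpa using h1
    -- Both ρ(u, ·) and ρ(W, ·) vanish on the kernel of ξ, so they are proportional, and so are u
    -- and W by nondegeneracy.
    have hv2 : u = (ρ (M.push 1 z) u M.e / β) • M.W (M.coord z) := by
      rw [← sub_eq_zero]
      refine h.nondegenerate _ hK _ fun w => ?_
      have h1 := hρ w
      rw [map_sub, map_smul, LinearMap.sub_apply, LinearMap.smul_apply, hW]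
      rw [map_sub, map_smul, sub_eq_zero] at h1
      rw [h1]
      simp only [smul_eq_mul]
      field_simp
      ring
    have hυ : M.υ v.2 = 0 := by
      have h1 : M.υ u = 0 := by rw [hv2, map_smul, M.υ_W, smul_zero]
      simpa [hu, M.υ_e] using h1
    have hξ : M.ξ v.2 = 0 := by
      rw [db_eq, hv1, hυ, ← hβ] at hdb
      simpa [-coord_apply, hbx, show ((0 : Y), (0 : ℝ), (0 : ℝ)) = 0 from rfl] using hdb
    have huv : u = v.2 := by rw [hu, hξ, zero_smul, sub_zero]
    refine ⟨ρ (M.push 1 z) u M.e / β, Prod.ext ?_ ?_⟩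
    · simp only [field, Prod.smul_mk, h0, hv1, smul_zero]
    · rw [← huv]
      conv_rhs => rw [hv2]
      simp only [field, Prod.smul_mk, hat]
      rw [neg_zero, zero_smul, zero_add]
  · have hker : v - (v.1 / M.ax (M.coord z)) • M.field z ∈ formKer (σ z) :=
      Submodule.sub_mem _ hv (Submodule.smul_mem _ _ hfield)
    set u := v - (v.1 / M.ax (M.coord z)) • M.field z with hu
    have hu1 : u.1 = 0 := by
      have : u.1 = v.1 - v.1 / M.ax (M.coord z) * M.ax (M.coord z) := rfl
      rw [this, div_mul_cancel₀ _ h0, sub_self]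
    rw [hmem] at hker
    -- As ∂ₓa ≠ 0, every w is the image under `dpush` of an explicit vector with zero t-component,
    -- so u is tested against all of E.
    have hGu : M.dpush 1 z u = 0 := by
      refine h.nondegenerate _ hK _ fun w => ?_
      have h1 := hker (0, w + ((M.ξ w - fderiv ℝ M.a (M.coord z) (M.υ w, 0, 0)) /
        M.ax (M.coord z) - M.ξ w) • M.e)
      have h2 : M.dpush 1 z (0, w + ((M.ξ w - fderiv ℝ M.a (M.coord z) (M.υ w, 0, 0)) /
        M.ax (M.coord z) - M.ξ w) • M.e) = w := by
        rw [dpush, fderiv_a_coord]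
        simp only [map_add, map_smul, M.υ_e, M.ξ_e, smul_zero, add_zero, smul_eq_mul, mul_one,
          zero_mul, one_mul, add_sub_cancel, div_mul_cancel₀ _ h0]
        module
      rw [h2, hu1] at h1
      simpa using h1
    have hu2 : u.2 = 0 := by
      have h1 := hGu
      have h2 : u.2 = M.ξ u.2 • M.e := by
        have h3 : M.ξ (M.dpush 1 z u) = 0 := by rw [hGu, map_zero]
        rw [ξ_dpush] at h3
        rw [dpush, h3] at h1
        rw [← sub_eq_zero]
        simpa [sub_eq_add_neg] using h1
      have h3 : M.υ u.2 = 0 := by rw [h2, map_smul, M.υ_e, smul_zero]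
      have h4 : M.ξ (M.dpush 1 z u) = 0 := by rw [hGu, map_zero]
      rw [ξ_dpush, fderiv_a_coord, h3, hu1, show ((0 : Y), (0 : ℝ), (0 : ℝ)) = 0 from rfl,
        map_zero, zero_mul, zero_add, add_zero] at h4
      rw [h2, (mul_eq_zero.1 h4).resolve_right h0, zero_smul]
    refine ⟨v.1 / M.ax (M.coord z), ?_⟩
    have : u = 0 := Prod.ext hu1 hu2
    rw [hu, sub_eq_zero] at this
    exact this.symm

theorem contDiffAt_isotopy {s : ℝ} (hs : s ∈ Icc (0 : ℝ) 1) {z : ℝ × E}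
    (hz : z ∈ plugDomain M.K) :
    ContDiffAt ℝ ∞ (fun q : ℝ × (ℝ × E) => M.isotopy b φ q.1 q.2) (s, z) := by
  have hcoord : ContDiff ℝ ∞ fun q : ℝ × (ℝ × E) => M.coord q.2 :=
    M.coord.contDiff.comp contDiff_snd
  have hpush : ContDiff ℝ ∞ fun q : ℝ × (ℝ × E) => M.push q.1 q.2 :=
    (contDiff_snd.comp contDiff_snd).add ((contDiff_fst.mul ((M.contDiff_a.comp hcoord).sub
      (M.ξ.contDiff.comp (contDiff_snd.comp contDiff_snd)))).smul contDiff_const)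
  have h1 : ContDiffAt ℝ ∞ (fun q : ℝ × (ℝ × E) => φ (M.push q.1 q.2)) (s, z) :=
    ContDiffAt.comp (s, z) (h.embedding.smooth _ (h.push_mem z hz s hs)) hpush.contDiffAt
  exact (contDiff_fst.mul (h.contDiff_b.comp hcoord)).contDiffAt.prodMk
    ((contDiff_fst.comp contDiff_snd).contDiffAt.prodMk h1)

theorem fderiv_isotopy {s : ℝ} (hs : s ∈ Icc (0 : ℝ) 1) {z : ℝ × E} (hz : z ∈ plugDomain M.K)
    (v : ℝ × E) : fderiv ℝ (M.isotopy b φ s) z v =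
      (s * M.db b z v, v.1, fderiv ℝ φ (M.push s z) (M.dpush s z v)) := by
  have ha : HasFDerivAt (fun z => M.a (M.coord z)) ((fderiv ℝ M.a (M.coord z)).comp M.coord) z :=
    (M.hasFDerivAt_a _).comp z M.coord.hasFDerivAt
  have hb : HasFDerivAt (fun z => b (M.coord z)) ((fderiv ℝ b (M.coord z)).comp M.coord) z :=
    (h.contDiff_b.differentiable (by simp) _).hasFDerivAt.comp z M.coord.hasFDerivAt
  have hξ : HasFDerivAt (fun z : ℝ × E => M.ξ z.2) (M.ξ.comp (ContinuousLinearMap.snd ℝ ℝ E)) z :=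
    M.ξ.hasFDerivAt.comp z (ContinuousLinearMap.snd ℝ ℝ E).hasFDerivAt
  have hp := (ContinuousLinearMap.snd ℝ ℝ E).hasFDerivAt (x := z) |>.add
    (((ha.sub hξ).const_mul s).smul_const M.e)
  have hφ := ((h.embedding.smooth _ (h.push_mem z hz s hs)).differentiableAt (by simp)).hasFDerivAt
  have := (hb.const_mul s).prodMk ((ContinuousLinearMap.fst ℝ ℝ E).hasFDerivAt (x := z) |>.prodMk
    (hφ.comp z hp))
  have h2 := this.fderiv
  change fderiv ℝ (M.isotopy b φ s) z = _ at h2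
  rw [h2]
  rfl

theorem push_add {s : ℝ} {z τ : ℝ × E} (hz : z ∈ plugDomain M.K) (hτ : τ ∈ plugGroup M.Γ) :
    M.push s (z + τ) = M.push s z + τ.2 := by
  rw [push, push, h.a_periodic z hz τ hτ, Prod.snd_add, map_add, M.ξ_Γ _ hτ.2, add_zero]
  abel

/-- For fixed y and t the map acts on x as (1 - s)x + s·a, which is strictly increasing; this gives
injectivity without the help of b. Its slope 1 - s + s·∂ₓa vanishes only for s = 1 on the trap, and
there the first component has slope ∂ₓb ≠ 0. -/
theorem isEmbeddingOn_isotopy {s : ℝ} (hs : s ∈ Icc (0 : ℝ) 1) :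
    IsEmbeddingOn (plugDomain M.K) (plugGroup M.Γ) (M.isotopy b φ s) where
  smooth z hz := (h.contDiffAt_isotopy hs hz).comp z
    (contDiff_const.prodMk contDiff_id).contDiffAt
  periodic z hz τ hτ := by
    have hτ1 : τ.1 = 0 := by simpa using hτ.1
    rw [isotopy, isotopy, h.b_periodic z hz τ hτ, Prod.fst_add, hτ1, add_zero, h.push_add hz hτ, h.embedding.periodic _ (h.push_mem z hz s hs) _ hτ.2]
  immersion z hz := by
    rw [injective_iff_map_eq_zero]
    intro v hv
    rw [h.fderiv_isotopy hs hz] at hv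
    simp only [Prod.mk_eq_zero] at hv
    obtain ⟨h1, h2, h3⟩ := hv
    have h4 := (injective_iff_map_eq_zero _).1
      (h.embedding.immersion _ (h.push_mem z hz s hs)) _ h3
    have hυ : M.υ v.2 = 0 := by rw [← υ_dpush s z v, h4, map_zero]
    have ha : fderiv ℝ M.a (M.coord z) (M.coord v) = M.ξ v.2 * M.ax (M.coord z) := by
      rw [fderiv_a_coord, hυ, h2, show ((0 : Y), (0 : ℝ), (0 : ℝ)) = 0 from rfl, map_zero]
      ring
    have h5 : M.ξ v.2 * (1 - s + s * M.ax (M.coord z)) = 0 := by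
      have h6 : M.ξ (M.dpush s z v) = 0 := by rw [h4, map_zero]
      rw [dpush, ha, map_add, map_smul, M.ξ_e, smul_eq_mul] at h6
      linarith
    have hax : 0 ≤ M.ax (M.coord z) := M.nonneg _ _ (M.ξ_mem _ hz.2) _ hz.1
    have hξ : M.ξ v.2 = 0 := by
      rcases mul_eq_zero.1 h5 with h6 | h6
      · exact h6
      · have h7 := mul_nonneg hs.1 hax
        have h8 : s = 1 := by linarith [hs.2]
        have h9 : M.ax (M.coord z) = 0 := by rw [h8] at h6; linarith
        rw [h8, one_mul, db_eq, h2, zero_mul, add_zero, hυ,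
          show ((0 : Y), (0 : ℝ), (0 : ℝ)) = 0 from rfl, map_zero, zero_add] at h1
        exact (mul_eq_zero.1 h1).resolve_right (h.trap_b z hz h9)
    have h7 : v.2 = 0 := by
      rw [dpush, ha, hξ] at h4
      simpa using h4
    exact Prod.ext h2 h7
  injective z hz w hw he := by
    simp only [isotopy, Prod.mk.injEq] at he
    obtain ⟨-, ht, hp⟩ := he
    have hτ := h.embedding.injective _ (h.push_mem z hz s hs) _ (h.push_mem w hw s hs) hp
    set τ := M.push s z - M.push s w with hτd
    have hτ' : ((0 : ℝ), τ) ∈ plugGroup M.Γ := ⟨by simp, hτ⟩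
    have hw' : w + (0, τ) ∈ plugDomain M.K :=
      ⟨by simpa using hw.1, h.add_mem _ hw.2 _ hτ⟩
    have h1 : M.push s (w + (0, τ)) = M.push s z := by
      rw [h.push_add hw hτ', hτd, add_sub_cancel]
    have ht' : (w + (0, τ)).1 = z.1 := by simp [ht]
    -- `push` commutes with translations by Γ, so after moving w by τ the two pushed points coincide
    -- exactly; then y, t and finally x agree.
    have hzw : z = w + (0, τ) := by
      generalize w + (0, τ) = w' at hw' h1 ht'
      have hυ : M.υ w'.2 = M.υ z.2 := by
        have := congrArg M.υ h1
        simpa [push, M.υ_e] using this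
      have hξ : M.ξ w'.2 + s * (M.a (M.coord w') - M.ξ w'.2) =
          M.ξ z.2 + s * (M.a (M.coord z) - M.ξ z.2) := by
        have := congrArg M.ξ h1
        simpa [push, M.ξ_e] using this
      have hξ' : M.ξ w'.2 = M.ξ z.2 := by
        have hm := M.strictMonoOn_a (M.υ z.2) hz.1
        simp only [coord_apply, hυ, ht'] at hξ
        have key : ∀ x ∈ M.X, ∀ x' ∈ M.X, x < x' → x + s * (M.a (M.υ z.2, x, z.1) - x) <
            x' + s * (M.a (M.υ z.2, x', z.1) - x') := by
          intro x hx x' hx' hxx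
          have h2 := hm hx hx' hxx
          simp only at h2
          rcases eq_or_lt_of_le hs.2 with h3 | h3
          · rw [h3]; linarith
          · nlinarith [mul_nonneg hs.1 (sub_nonneg.2 h2.le), mul_pos (sub_pos.2 h3) (sub_pos.2 hxx)]
        rcases lt_trichotomy (M.ξ w'.2) (M.ξ z.2) with hl | hl | hl
        · exact absurd hξ (key _ (M.ξ_mem _ hw'.2) _ (M.ξ_mem _ hz.2) hl).ne
        · exact hl
        · exact absurd hξ (key _ (M.ξ_mem _ hz.2) _ (M.ξ_mem _ hw'.2) hl).ne'
      have hc : M.coord w' = M.coord z := by simp [hυ, hξ', ht']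
      refine Prod.ext ht'.symm ?_
      rw [push, push, hc, hξ'] at h1
      exact (add_right_cancel h1).symm
    rw [hzw, add_sub_cancel_left]
    exact hτ'

theorem isOrbit {S : Set ℝ} {γ : ℝ → ℝ × E} (hγ : IsCharacteristic (plugDomain M.K) σ S γ) :
    ∃ c, M.IsOrbit S γ c := by
  obtain ⟨c, h1, h2, h3⟩ := hγ.exists_smul M.continuousOn_field (fun z hz => M.field_ne_zero hz)
    (fun z hz => h.formKer_eq hz)
  exact ⟨c, hγ.interval, hγ.mem, h1, h2, h3⟩

theorem fst_ne_one {p : E} (hp : M.a (M.υ p, M.ξ p, -1) = M.a (M.υ p, M.x₀, 1 / 2))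
    (hp0 : M.ax (M.υ p, M.x₀, 1 / 2) = 0) {S : Set ℝ} {γ : ℝ → ℝ × E}
    (hγ : IsCharacteristic (plugDomain M.K) σ S γ) {s : ℝ} (hs : s ∈ S) (hsp : γ s = (-1, p))
    {u : ℝ} (hu : u ∈ S) : (γ u).1 ≠ 1 := by
  obtain ⟨c, hc⟩ := h.isOrbit hγ
  exact hc.fst_ne_one hs hu (by rw [hsp]) (by rw [hsp]; exact hp) (by rw [hsp]; exact hp0)

end IsSymplectic

/-- A flow with a trap that is the characteristic flow of `σ` gives a symplectic plug. -/
theorem IsSymplectic.isSymplecticPlug {n : ℕ} {b : Y × ℝ × ℝ → ℝ} {φ : E → StdSpace (n - 1)}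
    {ρ : E → E →ₗ[ℝ] E →ₗ[ℝ] ℝ} {σ : ℝ × E → (ℝ × E) [⋀^Fin 2]→L[ℝ] ℝ}
    (h : M.IsSymplectic (n - 1) b φ ρ σ) (hn : 2 < n) (hK : IsCompactQuotient (2 * n - 2) M.K M.Γ)
    {δ : ℝ} (hδ : ∀ z ∈ plugDomain M.K, |b (M.coord z)| ≤ δ) :
    IsSymplecticPlug n M.K M.Γ δ σ (fun z => (z.1, φ z.2)) (M.isotopy b φ 1) := by
  have h0 : ∀ z, M.isotopy b φ 0 z = (0, z.1, φ z.2) := fun z => by simp [isotopy, push]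
  have h0' : M.isotopy b φ 0 = fun z => (0, z.1, φ z.2) := funext h0
  have h01 : (0 : ℝ) ∈ Icc (0 : ℝ) 1 := by simp
  have h11 : (1 : ℝ) ∈ Icc (0 : ℝ) 1 := by simp
  -- At s = 0 the isotopy is (0, j), so j inherits its periodicity and injectivity.
  have he0 := h.isEmbeddingOn_isotopy h01
  have hfj : ∀ z ∈ plugDomain M.K, ∀ v, fderiv ℝ (fun z : ℝ × E => (z.1, φ z.2)) z v =
      (v.1, fderiv ℝ φ z.2 v.2) := by
    intro z hz v
    have hφ := ((h.embedding.smooth _ hz.2).differentiableAt (by simp)).hasFDerivAt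
    have := ((ContinuousLinearMap.fst ℝ ℝ E).hasFDerivAt (x := z)).prodMk
      (hφ.comp z (ContinuousLinearMap.snd ℝ ℝ E).hasFDerivAt)
    have h2 := this.fderiv
    change fderiv ℝ (fun z : ℝ × E => (z.1, φ z.2)) z = _ at h2
    rw [h2]
    rfl
  have hnear_push : ∀ z : ℝ × E, M.a (M.coord z) = M.ξ z.2 → ∀ s, M.push s z = z.2 := by
    intro z hz s
    simp [-coord_apply, push, hz]
  exact {
    two_lt := hn
    manifold := hK
    exact := h.exact
    nondegenerate := fun z hz => by
      rw [h.formKer_eq hz]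
      exact finrank_span_singleton (M.field_ne_zero hz)
    embedding_j := by
      refine ⟨fun z hz => ?_, fun z hz τ hτ => ?_, fun z hz => ?_, fun z hz w hw hzw => ?_⟩
      · exact contDiff_fst.contDiffAt.prodMk
          (ContDiffAt.comp z (h.embedding.smooth _ hz.2) contDiff_snd.contDiffAt)
      · have := he0.periodic z hz τ hτ
        rw [h0, h0] at this
        exact congrArg Prod.snd this
      · rw [injective_iff_map_eq_zero]
        intro v hv
        rw [hfj z hz, Prod.mk_eq_zero] at hv
        exact Prod.ext hv.1 ((injective_iff_map_eq_zero _).1 (h.embedding.immersion _ hz.2) _ hv.2)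
      · refine he0.injective z hz w hw ?_
        rw [h0, h0]
        exact congrArg (Prod.mk 0) hzw
    embedding_J := h.isEmbeddingOn_isotopy h11
    P1 := by
      unfold NearBoundary at *
      filter_upwards [h.near] with z hz hzP
      obtain ⟨-, h2, -, -, h5⟩ := hz hzP
      rw [h.formKer_eq hzP]
      congr 2
      simp [-coord_apply, field, ax, at', h2, h5]
    P2 := by
      obtain ⟨p, hp, hp1, hp2⟩ := h.trapped
      exact ⟨p, hp, fun S γ hγ s hs hsp u hu => h.fst_ne_one hp1 hp2 hγ hs hsp hu⟩
    P3 := by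
      intro S γ hγ s hs u hu hs1 hu1
      obtain ⟨c, hc⟩ := h.isOrbit hγ
      rw [hc.snd_eq_of_crossing hs hu hs1 hu1, sub_self]
      exact M.Γ.zero_mem
    P4 := by
      rintro ⟨γ, hγ, τ, hτ, hper⟩
      obtain ⟨c, hc⟩ := h.isOrbit hγ
      exact M.not_periodic hc hτ hper
    P5 := by
      unfold NearBoundary at *
      filter_upwards [h.near] with z hz hzP v w
      obtain ⟨h1, h2, -, h4, -⟩ := hz hzP
      have hd : ∀ v, M.dpush 1 z v = v.2 := fun v => by simp [-coord_apply, dpush, h2, M.coord_apply v]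
      rw [hfj z hzP, hfj z hzP, h.σ_eq z hzP, hnear_push z h1, hd, hd, h.pullback _ hzP.2]
      simp [-coord_apply, db, h4]
    P6_range := fun z hz => by
      have := abs_le.1 (hδ z hz)
      simpa [isotopy] using this
    P6_pullback := fun z hz v w => by
      rw [h.fderiv_isotopy h11 hz, h.fderiv_isotopy h11 hz, h.σ_eq z hz, stdFormSucc,
        h.pullback _ (h.push_mem z hz 1 h11)]
      simp only [one_mul]
    P6_boundary := by
      unfold NearBoundary at *
      filter_upwards [h.near] with z hz hzP
      obtain ⟨h1, -, h3, -, -⟩ := hz hzP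
      rw [isotopy, h3, hnear_push z h1, mul_zero]
    P6_isotopic := by
      refine ⟨M.isotopy b φ, fun q hq => h.contDiffAt_isotopy hq.1 hq.2,
        fun s hs => h.isEmbeddingOn_isotopy hs, fun z _ => h0 z, fun z _ => rfl, ?_⟩
      unfold NearBoundary at *
      filter_upwards [h.near] with z hz hzP s hs
      obtain ⟨h1, -, h3, -, -⟩ := hz hzP
      rw [isotopy, h3, hnear_push z h1, mul_zero] }

end TrapFlow

/-! ### The exterior derivative of a one-form -/

section OneForm

variable {E : Type*} [NormedAddCommGroup E] [NormedSpace ℝ E]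

theorem extDeriv_oneForm_apply {α : E → E →L[ℝ] ℝ} {z : E} (h : DifferentiableAt ℝ α z) (v w : E) :
    extDeriv (oneForm α) z ![v, w] = fderiv ℝ α z v w - fderiv ℝ α z w v := by
  have hd : DifferentiableAt ℝ (oneForm α) z :=
    (ContinuousAlternatingMap.ofSubsingletonLIE (𝕜 := ℝ) (E := E) (F := ℝ)
      (0 : Fin 1)).toContinuousLinearEquiv.differentiable.differentiableAt.comp z h
  have hα : ∀ u, fderiv ℝ (fun z => α z u) z = (fderiv ℝ α z).flip u := by
    intro u
    rw [fderiv_clm_apply h (differentiableAt_const u)]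
    simp
  rw [extDeriv_apply hd, Fin.sum_univ_two]
  have e0 : (fun z => oneForm α z (Fin.removeNth 0 ![v, w])) = fun z => α z w := rfl
  have e1 : (fun z => oneForm α z (Fin.removeNth 1 ![v, w])) = fun z => α z v := rfl
  rw [e0, e1, hα, hα]
  simp [sub_eq_add_neg]

theorem contDiffAt_oneForm {α : E → E →L[ℝ] ℝ} {z : E} (h : ContDiffAt ℝ ∞ α z) :
    ContDiffAt ℝ ∞ (oneForm α) z :=
  (ContinuousAlternatingMap.ofSubsingletonLIE (𝕜 := ℝ) (E := E) (F := ℝ)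
    (0 : Fin 1)).toContinuousLinearEquiv.contDiff.contDiffAt.comp z h

end OneForm

/-! ### Bump functions -/

theorem expNegInvGlue_lt {u c : ℝ} (h : u < c) (hc : 0 < c) :
    expNegInvGlue u < expNegInvGlue c := by
  rcases le_or_gt u 0 with hu | hu
  · rw [expNegInvGlue.zero_of_nonpos hu]
    exact expNegInvGlue.pos_of_pos hc
  · simp only [expNegInvGlue, not_le.2 hu, not_le.2 hc, if_false]
    rw [Real.exp_lt_exp, neg_lt_neg_iff]
    exact inv_strictAnti₀ hu h

/-- A smooth antitone function with value `1` at `0` that vanishes on `[c, ∞)`. -/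
noncomputable def decay (c u : ℝ) : ℝ := expNegInvGlue (c - u) / expNegInvGlue c

section decay

variable {c u : ℝ}

theorem contDiff_decay (c : ℝ) : ContDiff ℝ ∞ (decay c) :=
  ((expNegInvGlue.contDiff (n := ⊤)).comp (contDiff_const.sub contDiff_id)).div_const _

theorem decay_nonneg (c u : ℝ) : 0 ≤ decay c u :=
  div_nonneg (expNegInvGlue.nonneg _) (expNegInvGlue.nonneg _)

theorem decay_zero (hc : 0 < c) : decay c 0 = 1 := by
  rw [decay, sub_zero, div_self (expNegInvGlue.pos_of_pos hc).ne']

/-- Strictness matters: the slope of a must degenerate at isolated values of x and t, and a bump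
with a plateau would make it vanish on an open set. -/
theorem decay_lt_one (hc : 0 < c) (hu : 0 < u) : decay c u < 1 :=
  (div_lt_one (expNegInvGlue.pos_of_pos hc)).2 (expNegInvGlue_lt (by linarith) hc)

theorem decay_le_one (hc : 0 < c) (hu : 0 ≤ u) : decay c u ≤ 1 := by
  rcases hu.eq_or_lt with rfl | hu
  · exact (decay_zero hc).le
  · exact (decay_lt_one hc hu).le

theorem decay_eq_one (hc : 0 < c) (hu : 0 ≤ u) (h : decay c u = 1) : u = 0 := by
  by_contra hne
  exact (decay_lt_one hc (lt_of_le_of_ne hu (Ne.symm hne))).ne h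

theorem decay_eq_zero (h : c ≤ u) : decay c u = 0 := by
  rw [decay, expNegInvGlue.zero_of_nonpos (by linarith), zero_div]

theorem decay_antitone (c : ℝ) : Antitone (decay c) := fun u v h =>
  div_le_div_of_nonneg_right (expNegInvGlue.monotone (by linarith)) (expNegInvGlue.nonneg _)

end decay

/-- A compactly supported function that is tangent to the identity at `0`. -/
noncomputable def bend (r x : ℝ) : ℝ := decay (r ^ 2) (x ^ 2) * x

section bend

variable {r x : ℝ}

theorem contDiff_bend (r : ℝ) : ContDiff ℝ ∞ (bend r) :=
  ((contDiff_decay _).comp (contDiff_id.pow 2)).mul contDiff_id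

theorem bend_zero (r : ℝ) : bend r 0 = 0 := by simp [bend]

theorem bend_eq_zero (hr : 0 ≤ r) (h : r ≤ |x|) : bend r x = 0 := by
  rw [bend, decay_eq_zero, zero_mul]
  rw [← sq_abs x]
  exact pow_le_pow_left₀ hr h 2

theorem deriv_bend (r x : ℝ) :
    deriv (bend r) x = decay (r ^ 2) (x ^ 2) + 2 * x ^ 2 * deriv (decay (r ^ 2)) (x ^ 2) := by
  have h1 := ((contDiff_decay (r ^ 2)).differentiable (by simp) (x ^ 2)).hasDerivAt
  have h2 := (HasDerivAt.comp (h := fun x : ℝ => x ^ 2) x h1 (hasDerivAt_pow 2 x)).mul (hasDerivAt_id x)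
  have h3 := h2.deriv
  change deriv (bend r) x = _ at h3
  rw [h3]
  simp
  ring

/-- The discarded term 2x²·decay'(x²) is nonpositive. With `decay_lt_one` this isolates x = 0 as the
only point of slope one. -/
theorem deriv_bend_le (r x : ℝ) : deriv (bend r) x ≤ decay (r ^ 2) (x ^ 2) := by
  rw [deriv_bend]
  have : deriv (decay (r ^ 2)) (x ^ 2) ≤ 0 := (decay_antitone _).deriv_nonpos
  nlinarith [sq_nonneg x]

theorem deriv_bend_le_one (hr : 0 < r) (x : ℝ) : deriv (bend r) x ≤ 1 :=
  (deriv_bend_le r x).trans (decay_le_one (by positivity) (sq_nonneg x))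

theorem deriv_bend_eq_one (hr : 0 < r) (h : deriv (bend r) x = 1) : x = 0 := by
  have h1 := deriv_bend_le r x
  have h2 := decay_le_one (show 0 < r ^ 2 by positivity) (sq_nonneg x)
  have h3 := decay_eq_one (show 0 < r ^ 2 by positivity) (sq_nonneg x) (by linarith)
  exact pow_eq_zero_iff two_ne_zero |>.1 h3

theorem deriv_bend_zero (hr : 0 < r) : deriv (bend r) 0 = 1 := by
  rw [deriv_bend]
  simp [decay_zero (show 0 < r ^ 2 by positivity)]

end bend

/-- An even bump function with maximum `1` at `±1/2`, supported in `(-1, 1)`. -/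
noncomputable def twoPeaks (t : ℝ) : ℝ := decay (1 / 4) ((t ^ 2 - 1 / 4) ^ 2)

theorem contDiff_twoPeaks : ContDiff ℝ ∞ twoPeaks :=
  (contDiff_decay _).comp (((contDiff_id.pow 2).sub contDiff_const).pow 2)

theorem twoPeaks_nonneg (t : ℝ) : 0 ≤ twoPeaks t := decay_nonneg _ _

theorem twoPeaks_le_one (t : ℝ) : twoPeaks t ≤ 1 := decay_le_one (by norm_num) (sq_nonneg _)

theorem twoPeaks_neg (t : ℝ) : twoPeaks (-t) = twoPeaks t := by simp [twoPeaks]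

theorem twoPeaks_eq_one_iff {t : ℝ} : twoPeaks t = 1 ↔ t = 1 / 2 ∨ t = -(1 / 2) := by
  constructor
  · intro h
    have h1 := decay_eq_one (by norm_num) (sq_nonneg _) h
    have h2 : (t - 1 / 2) * (t + 1 / 2) = 0 := by
      have := pow_eq_zero_iff two_ne_zero |>.1 h1
      linarith
    rcases mul_eq_zero.1 h2 with h3 | h3
    · exact .inl (by linarith)
    · exact .inr (by linarith)
  · rintro (rfl | rfl) <;> norm_num [twoPeaks, decay_zero]

/-- The constant works because (81/100 - 1/4)² = (14/25)² > 1/4. -/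
theorem twoPeaks_eq_zero {t : ℝ} (h : 9 / 10 ≤ |t|) : twoPeaks t = 0 := by
  refine decay_eq_zero ?_
  have : 81 / 100 ≤ t ^ 2 := by
    rw [← sq_abs]; nlinarith
  nlinarith

/-- A function bounded by `κ`, odd in `t`, that is `±x` near `(0, ±1/2)` and vanishes for
`|x| ≥ κ` and for `|t| ≥ 3/4`. -/
structure IsOddBump (κ : ℝ) (b : ℝ × ℝ → ℝ) : Prop where
  contDiff : ContDiff ℝ ∞ b
  odd : ∀ x t, b (x, -t) = -b (x, t)
  abs_le : ∀ q, |b q| ≤ κ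
  eq_zero : ∀ x t, κ ≤ |x| ∨ 3 / 4 ≤ |t| → b (x, t) = 0
  near_pos : ∀ᶠ q in 𝓝 ((0 : ℝ), (1 / 2 : ℝ)), b q = q.1
  near_neg : ∀ᶠ q in 𝓝 ((0 : ℝ), (-(1 / 2) : ℝ)), b q = -q.1

/-- Take x·χ(x)·(μ(t) - μ(-t)), with μ supported in [1/4, 3/4] and χ in [-κ, κ]. Near (0, ±1/2) one
of the two terms in μ is zero and the other factors are on their plateaus; the factor x is what
makes the bound κ possible with slope ±1. -/
theorem exists_odd_bump {κ : ℝ} (hκ : 0 < κ) : ∃ b, IsOddBump κ b := by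
  let χ : ContDiffBump (0 : ℝ) := ⟨κ / 2, κ, by positivity, by linarith⟩
  let μ : ContDiffBump (1 / 2 : ℝ) := ⟨1 / 8, 1 / 4, by norm_num, by norm_num⟩
  have hμ0 : ∀ t, (t ≤ 1 / 4 ∨ 3 / 4 ≤ t) → μ t = 0 := by
    intro t ht
    refine μ.zero_of_le_dist ?_
    rw [Real.dist_eq]
    rcases ht with ht | ht
    · rw [abs_of_nonpos (by linarith)]; change (1 / 4 : ℝ) ≤ _; linarith
    · rw [abs_of_nonneg (by linarith)]; change (1 / 4 : ℝ) ≤ _; linarith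
  have hχ0 : ∀ x, κ ≤ |x| → χ x = 0 := by
    intro x hx
    refine χ.zero_of_le_dist ?_
    rwa [Real.dist_eq, sub_zero]
  refine ⟨fun q => q.1 * χ q.1 * (μ q.2 - μ (-q.2)), ?_, ?_, ?_, ?_, ?_, ?_⟩
  · exact (contDiff_fst.mul (χ.contDiff.comp contDiff_fst)).mul
      ((μ.contDiff.comp contDiff_snd).sub (μ.contDiff.comp contDiff_snd.neg))
  · intro x t
    simp only [neg_neg]
    ring
  · rintro ⟨x, t⟩
    simp only [abs_mul]
    have h1 : |μ t - μ (-t)| ≤ 1 := by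
      rw [abs_le]
      constructor <;> linarith [μ.nonneg (x := t), μ.le_one (x := t), μ.nonneg (x := -t), μ.le_one (x := -t)]
    have h2 : |x| * |χ x| ≤ κ := by
      rcases le_or_gt κ |x| with hx | hx
      · rw [hχ0 x hx, abs_zero, mul_zero]; exact hκ.le
      · rw [abs_of_nonneg χ.nonneg]
        exact (mul_le_of_le_one_right (abs_nonneg x) χ.le_one).trans hx.le
    calc |x| * |χ x| * |μ t - μ (-t)| ≤ κ * 1 := by gcongr
      _ = κ := mul_one κ
  · rintro x t (h | h)
    · simp [hχ0 x h]
    · have h1 : μ t = 0 := hμ0 t (by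
        rcases le_abs.1 h with h | h
        · exact .inr h
        · exact .inl (by linarith))
      have h2 : μ (-t) = 0 := hμ0 (-t) (by
        rcases le_abs.1 h with h | h
        · exact .inl (by linarith)
        · exact .inr h)
      simp [h1, h2]
  · have h1 : ∀ᶠ q : ℝ × ℝ in 𝓝 ((0 : ℝ), (1 / 2 : ℝ)), χ q.1 = 1 :=
      continuous_fst.continuousAt.eventually (p := fun x => χ x = 1) χ.eventuallyEq_one
    have h2 : ∀ᶠ q : ℝ × ℝ in 𝓝 ((0 : ℝ), (1 / 2 : ℝ)), μ q.2 = 1 :=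
      continuous_snd.continuousAt.eventually (p := fun x => μ x = 1) μ.eventuallyEq_one
    have h3 : ∀ᶠ q : ℝ × ℝ in 𝓝 ((0 : ℝ), (1 / 2 : ℝ)), 0 < q.2 :=
      continuous_snd.continuousAt.eventually (lt_mem_nhds (by norm_num))
    filter_upwards [h1, h2, h3] with q h1 h2 h3
    rw [h1, h2, hμ0 (-q.2) (.inl (by linarith))]
    ring
  · have h1 : ∀ᶠ q : ℝ × ℝ in 𝓝 ((0 : ℝ), (-(1 / 2) : ℝ)), χ q.1 = 1 :=
      continuous_fst.continuousAt.eventually (p := fun x => χ x = 1) χ.eventuallyEq_one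
    have h2 : ∀ᶠ q : ℝ × ℝ in 𝓝 ((0 : ℝ), (-(1 / 2) : ℝ)), μ (-q.2) = 1 :=
      continuous_snd.neg.continuousAt.eventually (p := fun x => μ x = 1)
        (by
          change ∀ᶠ x in 𝓝 (- -(1 / 2 : ℝ)), μ x = 1
          rw [neg_neg]
          exact μ.eventuallyEq_one)
    have h3 : ∀ᶠ q : ℝ × ℝ in 𝓝 ((0 : ℝ), (-(1 / 2) : ℝ)), q.2 < 0 :=
      continuous_snd.continuousAt.eventually (gt_mem_nhds (by norm_num))
    filter_upwards [h1, h2, h3] with q h1 h2 h3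
    rw [h1, h2, hμ0 q.2 (.inl (by linarith))]
    ring

/-! ### Angles -/

/-- Two angles with the same sine and cosine agree modulo `2π`. -/
theorem sub_mem_zmultiples_of_cos_sin {a b : ℝ} (hc : Real.cos a = Real.cos b)
    (hs : Real.sin a = Real.sin b) : a - b ∈ AddSubgroup.zmultiples (2 * Real.pi) := by
  have : Real.cos (a - b) = 1 := by
    rw [Real.cos_sub, hc, hs, ← sq, ← sq, Real.cos_sq_add_sin_sq]
  obtain ⟨k, hk⟩ := (Real.cos_eq_one_iff _).1 this
  exact ⟨k, by simpa using hk⟩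

theorem cos_add_of_mem_zmultiples {a τ : ℝ} (h : τ ∈ AddSubgroup.zmultiples (2 * Real.pi)) :
    Real.cos (a + τ) = Real.cos a := by
  obtain ⟨k, rfl⟩ := h
  simp

theorem sin_add_of_mem_zmultiples {a τ : ℝ} (h : τ ∈ AddSubgroup.zmultiples (2 * Real.pi)) :
    Real.sin (a + τ) = Real.sin a := by
  obtain ⟨k, rfl⟩ := h
  simp

/-- Every angle has a representative in `[0, 2π]`. -/
theorem exists_mem_Icc_sub_mem_zmultiples (a : ℝ) :
    ∃ b ∈ Icc 0 (2 * Real.pi), a - b ∈ AddSubgroup.zmultiples (2 * Real.pi) := by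
  refine ⟨toIcoMod Real.two_pi_pos 0 a, ?_, ?_⟩
  · have := toIcoMod_mem_Ico Real.two_pi_pos 0 a
    rw [zero_add] at this
    exact ⟨this.1, this.2.le⟩
  · rw [self_sub_toIcoMod]
    exact AddSubgroup.zsmul_mem_zmultiples _ _

/-- A discrete subset remains discrete in a product with a point. -/
theorem discreteTopology_prod {E F : Type*} [AddCommGroup E] [TopologicalSpace E] [AddCommGroup F]
    [TopologicalSpace F] (Γ : AddSubgroup E) (Δ : AddSubgroup F) [DiscreteTopology Γ]
    [DiscreteTopology Δ] : DiscreteTopology (Γ.prod Δ) := by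
  have h1 : Continuous fun q : Γ.prod Δ => ((⟨q.1.1, q.2.1⟩, ⟨q.1.2, q.2.2⟩) : Γ × Δ) :=
    ((continuous_fst.comp continuous_subtype_val).subtype_mk _).prodMk
      ((continuous_snd.comp continuous_subtype_val).subtype_mk _)
  refine DiscreteTopology.of_continuous_injective h1 ?_
  rintro ⟨⟨a, b⟩, _⟩ ⟨⟨a', b'⟩, _⟩ h
  simpa using h

/-! ### Action-angle coordinates -/

/-- The symplectic polar coordinates of the plane, as a function of action and angle. -/
noncomputable def polar (q : ℝ × ℝ) : ℝ × ℝ :=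
  (√(2 * q.1) * Real.cos q.2, √(2 * q.1) * Real.sin q.2)

section polar

variable {q q' : ℝ × ℝ}

theorem contDiffAt_polar (h : 0 < q.1) : ContDiffAt ℝ ∞ polar q := by
  have h1 : ContDiffAt ℝ ∞ (fun q : ℝ × ℝ => √(2 * q.1)) q :=
    (contDiffAt_const.mul contDiffAt_fst).sqrt (by positivity)
  exact (h1.mul (Real.contDiff_cos.comp contDiff_snd).contDiffAt).prodMk
    (h1.mul (Real.contDiff_sin.comp contDiff_snd).contDiffAt)

/-- The radius r = √(2s) satisfies r dr = ds, so the area form r dr ∧ dϑ becomes ds ∧ dϑ. -/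
theorem polar_area (h : 0 < q.1) (u v : ℝ × ℝ) :
    (fderiv ℝ polar q u).1 * (fderiv ℝ polar q v).2 -
      (fderiv ℝ polar q u).2 * (fderiv ℝ polar q v).1 = u.1 * v.2 - u.2 * v.1 := by
  have hs : HasFDerivAt (fun q : ℝ × ℝ => √(2 * q.1))
      ((1 / (2 * √(2 * q.1))) • ((2 : ℝ) • ContinuousLinearMap.fst ℝ ℝ ℝ)) q :=
    ((ContinuousLinearMap.fst ℝ ℝ ℝ).hasFDerivAt.const_mul 2).sqrt (by simpa using h.ne')
  have hc : HasFDerivAt (fun q : ℝ × ℝ => Real.cos q.2)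
      (-Real.sin q.2 • ContinuousLinearMap.snd ℝ ℝ ℝ) q :=
    (ContinuousLinearMap.snd ℝ ℝ ℝ).hasFDerivAt.cos
  have hsin : HasFDerivAt (fun q : ℝ × ℝ => Real.sin q.2)
      (Real.cos q.2 • ContinuousLinearMap.snd ℝ ℝ ℝ) q :=
    (ContinuousLinearMap.snd ℝ ℝ ℝ).hasFDerivAt.sin
  have hp := (hs.mul hc).prodMk (hs.mul hsin)
  have hf := hp.fderiv
  change fderiv ℝ polar q = _ at hf
  have h0 : √(2 * q.1) ≠ 0 := (Real.sqrt_pos.2 (by positivity)).ne'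
  have hcs := Real.cos_sq_add_sin_sq q.2
  rw [hf]
  generalize √(2 * q.1) = c at h0
  simp only [ContinuousLinearMap.prod_apply, add_apply,
    smul_apply, ContinuousLinearMap.coe_fst', ContinuousLinearMap.coe_snd',
    smul_eq_mul]
  field_simp
  linear_combination c ^ 2 * (u.1 * v.2 - u.2 * v.1) * hcs

theorem polar_injective (h : 0 < q.1) (h' : 0 < q'.1) (he : polar q = polar q') :
    q.1 = q'.1 ∧ q.2 - q'.2 ∈ AddSubgroup.zmultiples (2 * Real.pi) := by
  simp only [polar, Prod.mk.injEq] at he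
  obtain ⟨h1, h2⟩ := he
  have e1 : 2 * q.1 = 2 * q'.1 := by
    have s1 := Real.sq_sqrt (show 0 ≤ 2 * q.1 by positivity)
    have s2 := Real.sq_sqrt (show 0 ≤ 2 * q'.1 by positivity)
    have c1 := Real.cos_sq_add_sin_sq q.2
    have c2 := Real.cos_sq_add_sin_sq q'.2
    have e : (√(2 * q.1) * Real.cos q.2) ^ 2 + (√(2 * q.1) * Real.sin q.2) ^ 2 =
        (√(2 * q'.1) * Real.cos q'.2) ^ 2 + (√(2 * q'.1) * Real.sin q'.2) ^ 2 := by rw [h1, h2]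
    rw [mul_pow, mul_pow, mul_pow, mul_pow, s1, s2, ← mul_add, ← mul_add, c1, c2] at e
    linarith
  have h0 : √(2 * q'.1) ≠ 0 := (Real.sqrt_pos.2 (by positivity)).ne'
  rw [e1] at h1 h2
  exact ⟨by linarith, sub_mem_zmultiples_of_cos_sin (mul_left_cancel₀ h0 h1)
    (mul_left_cancel₀ h0 h2)⟩

theorem polar_add {s ϑ τ : ℝ} (h : τ ∈ AddSubgroup.zmultiples (2 * Real.pi)) :
    polar (s, ϑ + τ) = polar (s, ϑ) := by
  simp only [polar, cos_add_of_mem_zmultiples h, sin_add_of_mem_zmultiples h]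

end polar

/-! ### Domains and lattices -/

/-- The domains in use have no actual corners: zero inequalities at an interior point, one at a
boundary point. -/
theorem isCornerDomain_of_smooth_boundary {E : Type*} [NormedAddCommGroup E] [NormedSpace ℝ E]
    {K : Set E} (hK : IsClosed K) (h : ∀ p ∈ K, K ∈ 𝓝 p ∨ ∃ g : E → ℝ, ContDiffAt ℝ ∞ g p ∧
      g p = 0 ∧ fderiv ℝ g p ≠ 0 ∧ ∀ᶠ q in 𝓝 p, (q ∈ K ↔ 0 ≤ g q)) : IsCornerDomain K := by
  refine ⟨hK, fun p hp => ?_⟩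
  rcases h p hp with h | ⟨g, h1, h2, h3, h4⟩
  · refine ⟨0, fun i => i.elim0, fun i => i.elim0, linearIndependent_empty_type, ?_⟩
    filter_upwards [h] with q hq
    exact ⟨fun _ i => i.elim0, fun _ => hq⟩
  · refine ⟨1, fun _ => g, fun _ => ⟨h1, h2⟩, ?_, ?_⟩
    · exact linearIndependent_unique_iff.2 h3
    · filter_upwards [h4] with q hq
      rw [hq]
      exact ⟨fun h _ => h, fun h => h 0⟩

theorem discreteTopology_pi {ι : Type*} [Finite ι] (Γ : AddSubgroup ℝ) [DiscreteTopology Γ] :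
    DiscreteTopology (AddSubgroup.pi univ fun _ : ι => Γ) := by
  have h1 : Continuous fun (q : AddSubgroup.pi univ fun _ : ι => Γ) (i : ι) =>
      (⟨q.1 i, q.2 i (mem_univ i)⟩ : Γ) :=
    continuous_pi fun i => ((continuous_apply i).comp continuous_subtype_val).subtype_mk _
  refine DiscreteTopology.of_continuous_injective h1 ?_
  rintro ⟨a, _⟩ ⟨a', _⟩ h
  ext i
  simpa using congrArg Subtype.val (congrFun h i)

/-- The derivative of a function that is even or odd in `t`, along directions with constant `t`. -/
theorem fderiv_neg_time {Y : Type*} [NormedAddCommGroup Y] [NormedSpace ℝ Y] {f : Y × ℝ × ℝ → ℝ}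
    (hf : Differentiable ℝ f) {c : ℝ} (h : ∀ y x t, f (y, x, -t) = c * f (y, x, t)) (y : Y)
    (x t : ℝ) (u : Y) (r : ℝ) :
    fderiv ℝ f (y, x, -t) (u, r, 0) = c * fderiv ℝ f (y, x, t) (u, r, 0) := by
  let L : Y × ℝ × ℝ →L[ℝ] Y × ℝ × ℝ := (ContinuousLinearMap.fst ℝ Y (ℝ × ℝ)).prod
    (((ContinuousLinearMap.fst ℝ ℝ ℝ).comp (ContinuousLinearMap.snd ℝ Y (ℝ × ℝ))).prod
      (-((ContinuousLinearMap.snd ℝ ℝ ℝ).comp (ContinuousLinearMap.snd ℝ Y (ℝ × ℝ)))))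
  have h1 : HasFDerivAt (f ∘ L) ((fderiv ℝ f (y, x, -t)).comp L) (y, x, t) :=
    HasFDerivAt.comp (y, x, t) (hf (L (y, x, t))).hasFDerivAt L.hasFDerivAt
  have h2 : f ∘ L = fun q => c * f q := funext fun q => h q.1 q.2.1 q.2.2
  rw [h2] at h1
  have h3 := h1.unique ((hf (y, x, t)).hasFDerivAt.const_mul c)
  have h4 := DFunLike.congr_fun h3 (u, r, 0)
  simpa [L] using h4

/-! ### The shell and its symplectic embedding -/

section Shell

variable {m : ℕ}

theorem isClosed_shell (m : ℕ) (ε : ℝ) : IsClosed (shell m ε) :=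
  (isClosed_le continuous_const continuous_fst.norm).inter
    (isClosed_le continuous_fst.norm continuous_const)

theorem mem_nhds_shell {ε : ℝ} {p : EuclideanSpace ℝ (Fin m) × (Fin m → ℝ)}
    (h₁ : 1 - ε < ‖p.1‖) (h₂ : ‖p.1‖ < 1 + ε) : shell m ε ∈ 𝓝 p := by
  filter_upwards [continuous_fst.norm.continuousAt.eventually (lt_mem_nhds h₁),
    continuous_fst.norm.continuousAt.eventually (gt_mem_nhds h₂)] with q hq₁ hq₂
  exact ⟨hq₁.le, hq₂.le⟩

/-- The squared norm is the defining function on either side: it is smooth, and its differential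
2⟨q, ·⟩ is nonzero because ‖q‖ ≥ 1 - ε > 0. -/
theorem isCornerDomain_shell {ε : ℝ} (h0 : 0 < ε) (h1 : ε < 1) : IsCornerDomain (shell m ε) := by
  refine isCornerDomain_of_smooth_boundary (isClosed_shell m ε) fun p hp => ?_
  have hd : ∀ p : EuclideanSpace ℝ (Fin m) × (Fin m → ℝ), HasFDerivAt
      (fun p : EuclideanSpace ℝ (Fin m) × (Fin m → ℝ) => ‖p.1‖ ^ 2)
      ((2 • innerSL ℝ p.1).comp (ContinuousLinearMap.fst ℝ _ _)) p := fun p =>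
    (hasStrictFDerivAt_norm_sq p.1).hasFDerivAt.comp p hasFDerivAt_fst
  have hc : ContDiff ℝ ∞ fun p : EuclideanSpace ℝ (Fin m) × (Fin m → ℝ) => ‖p.1‖ ^ 2 :=
    contDiff_fst.norm_sq ℝ
  have hne : ∀ p : EuclideanSpace ℝ (Fin m) × (Fin m → ℝ), 0 < ‖p.1‖ →
      ((2 • innerSL ℝ p.1).comp (ContinuousLinearMap.fst ℝ _ (Fin m → ℝ))) (p.1, 0) ≠ 0 := by
    intro p hp
    simp [norm_pos_iff.1 hp]
  rcases hp.1.eq_or_lt with he | hl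
  · refine .inr ⟨fun q => ‖q.1‖ ^ 2 - (1 - ε) ^ 2, hc.contDiffAt.sub contDiffAt_const,
      by simp [he], fun h => ?_, ?_⟩
    · rw [((hd p).sub_const _).fderiv] at h
      exact hne p (by rw [← he]; linarith) (by rw [h]; rfl)
    · filter_upwards [continuous_fst.norm.continuousAt.eventually
        (gt_mem_nhds (show ‖p.1‖ < 1 + ε by linarith))] with q hq
      rw [sub_nonneg, pow_le_pow_iff_left₀ (by linarith) (norm_nonneg _) two_ne_zero]
      exact ⟨fun h => h.1, fun h => ⟨h, hq.le⟩⟩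
  · rcases hp.2.eq_or_lt with he | hu
    · refine .inr ⟨fun q => (1 + ε) ^ 2 - ‖q.1‖ ^ 2, contDiffAt_const.sub hc.contDiffAt,
        by simp [he], fun h => ?_, ?_⟩
      · rw [((hd p).const_sub _).fderiv, neg_eq_zero] at h
        exact hne p (by rw [he]; linarith) (by rw [h]; rfl)
      · filter_upwards [continuous_fst.norm.continuousAt.eventually (lt_mem_nhds hl)] with q hq
        rw [sub_nonneg, pow_le_pow_iff_left₀ (norm_nonneg _) (by linarith) two_ne_zero]
        exact ⟨fun h => h.2, fun h => ⟨hq.le, h⟩⟩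
    · exact .inl (mem_nhds_shell hl hu)

theorem isCompactQuotient_shell (m : ℕ) {ε : ℝ} (h0 : 0 < ε) (h1 : ε < 1) :
    IsCompactQuotient (2 * m) (shell m ε) (shellGroup m) where
  finiteDimensional := inferInstance
  dim := by simp [two_mul]
  domain := isCornerDomain_shell h0 h1
  discrete := by
    have := discreteTopology_pi (ι := Fin m) (AddSubgroup.zmultiples (2 * Real.pi))
    have h2 : DiscreteTopology (⊥ : AddSubgroup (EuclideanSpace ℝ (Fin m))) := inferInstance
    exact discreteTopology_prod _ _
  invariant p hp τ hτ := by
    have : τ.1 = 0 := by simpa using hτ.1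
    simpa [shell, this] using hp
  cocompact := by
    refine ⟨({q | 1 - ε ≤ ‖q‖} ∩ Metric.closedBall 0 (1 + ε)) ×ˢ
      Set.pi univ fun _ => Icc 0 (2 * Real.pi), ?_, ?_, ?_⟩
    · exact ((isCompact_closedBall _ _).inter_left (isClosed_le continuous_const
        continuous_norm)).prod (isCompact_univ_pi fun _ => isCompact_Icc)
    · rintro p ⟨⟨h1, h2⟩, -⟩
      exact ⟨h1, by simpa using h2⟩
    · intro p hp
      choose θ hθ hθ' using exists_mem_Icc_sub_mem_zmultiples
      refine ⟨(p.1, fun i => θ (p.2 i)), ⟨⟨hp.1, by simpa using hp.2⟩, fun i _ => hθ _⟩, ?_, ?_⟩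
      · simp
      · exact fun i _ => hθ' (p.2 i)

/-- The canonical symplectic form `∑ dqᵢ ∧ dθᵢ` of the cotangent bundle of the torus. -/
noncomputable def cotangentForm (m : ℕ) : (EuclideanSpace ℝ (Fin m) × (Fin m → ℝ)) →ₗ[ℝ]
    (EuclideanSpace ℝ (Fin m) × (Fin m → ℝ)) →ₗ[ℝ] ℝ :=
  LinearMap.mk₂ ℝ (fun v w => ∑ i, (v.1 i * w.2 i - v.2 i * w.1 i))
    (fun u v w => by
      rw [← Finset.sum_add_distrib]
      refine Finset.sum_congr rfl fun i _ => ?_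
      simp; ring)
    (fun c v w => by
      rw [smul_eq_mul, Finset.mul_sum]
      refine Finset.sum_congr rfl fun i _ => ?_
      simp; ring)
    (fun u v w => by
      rw [← Finset.sum_add_distrib]
      refine Finset.sum_congr rfl fun i _ => ?_
      simp; ring)
    (fun c v w => by
      rw [smul_eq_mul, Finset.mul_sum]
      refine Finset.sum_congr rfl fun i _ => ?_
      simp; ring)

theorem cotangentForm_apply (v w : EuclideanSpace ℝ (Fin m) × (Fin m → ℝ)) :
    cotangentForm m v w = ∑ i, (v.1 i * w.2 i - v.2 i * w.1 i) := rfl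

theorem cotangentForm_nondegenerate {v : EuclideanSpace ℝ (Fin m) × (Fin m → ℝ)}
    (h : ∀ w, cotangentForm m v w = 0) : v = 0 := by
  refine Prod.ext ?_ ?_
  · ext i
    have := h (0, Pi.single i 1)
    simpa [cotangentForm_apply, Pi.single_apply] using this
  · ext i
    have := h (EuclideanSpace.single i 1, 0)
    simpa [cotangentForm_apply, Pi.single_apply] using this

/-- The embedding of the shell by symplectic polar coordinates. -/
noncomputable def shellMap (m : ℕ) (p : EuclideanSpace ℝ (Fin m) × (Fin m → ℝ)) : StdSpace m :=
  fun i => polar (p.1 i + 2, p.2 i)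

/-- Polar coordinates need positive actions. The shift by 2 suffices because |qᵢ| ≤ ‖q‖ ≤ 1 + ε < 2,
and a constant shift does not affect the form. -/
theorem action_pos {ε : ℝ} (h1 : ε < 1) {p : EuclideanSpace ℝ (Fin m) × (Fin m → ℝ)}
    (hp : p ∈ shell m ε) (i : Fin m) : 0 < p.1 i + 2 := by
  have h2 : |p.1 i| ≤ ‖p.1‖ := PiLp.norm_apply_le p.1 i
  have := (abs_le.1 (h2.trans hp.2)).1
  linarith

/-- The action and the angle of a point of the shell in the `i`-th factor, without the shift. -/
noncomputable def actionAngle (i : Fin m) :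
    EuclideanSpace ℝ (Fin m) × (Fin m → ℝ) →L[ℝ] ℝ × ℝ :=
  ((EuclideanSpace.proj i).comp (ContinuousLinearMap.fst ℝ _ _)).prod
    ((ContinuousLinearMap.proj i).comp (ContinuousLinearMap.snd ℝ _ _))

theorem shellMap_eq (i : Fin m) : (fun p => shellMap m p i) =
    fun p => polar (actionAngle i p + (2, 0)) := by
  funext p
  simp [shellMap, actionAngle]

theorem contDiffAt_shellMap {ε : ℝ} (h1 : ε < 1) {p : EuclideanSpace ℝ (Fin m) × (Fin m → ℝ)}
    (hp : p ∈ shell m ε) : ContDiffAt ℝ ∞ (shellMap m) p := by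
  rw [contDiffAt_pi]
  intro i
  rw [shellMap_eq]
  exact ContDiffAt.comp p (contDiffAt_polar (action_pos h1 hp i))
    ((actionAngle i).contDiff.contDiffAt.add contDiffAt_const)

theorem fderiv_shellMap {ε : ℝ} (h1 : ε < 1) {p : EuclideanSpace ℝ (Fin m) × (Fin m → ℝ)}
    (hp : p ∈ shell m ε) (v : EuclideanSpace ℝ (Fin m) × (Fin m → ℝ)) (i : Fin m) :
    fderiv ℝ (shellMap m) p v i = fderiv ℝ polar (p.1 i + 2, p.2 i) (v.1 i, v.2 i) := by
  have h2 := ((contDiffAt_shellMap h1 hp).differentiableAt (by simp)).hasFDerivAt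
  have h3 := (hasFDerivAt_pi'.1 h2 i)
  rw [shellMap_eq] at h3
  have h4 : HasFDerivAt polar (fderiv ℝ polar (actionAngle i p + (2, 0)))
      (actionAngle i p + (2, 0)) :=
    ((contDiffAt_polar (action_pos h1 hp i)).differentiableAt (by simp)).hasFDerivAt
  have h5 := HasFDerivAt.comp p h4 ((actionAngle i).hasFDerivAt.add_const (2, 0))
  have h6 := DFunLike.congr_fun (h3.unique h5) v
  refine h6.trans ?_
  simp [actionAngle]

theorem stdForm_shellMap {ε : ℝ} (h1 : ε < 1) {p : EuclideanSpace ℝ (Fin m) × (Fin m → ℝ)}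
    (hp : p ∈ shell m ε) (v w : EuclideanSpace ℝ (Fin m) × (Fin m → ℝ)) :
    stdForm m (fderiv ℝ (shellMap m) p v) (fderiv ℝ (shellMap m) p w) = cotangentForm m v w := by
  rw [stdForm, cotangentForm_apply]
  refine Finset.sum_congr rfl fun i _ => ?_
  rw [fderiv_shellMap h1 hp, fderiv_shellMap h1 hp]
  exact polar_area (action_pos h1 hp i) _ _

theorem isEmbeddingOn_shellMap {ε : ℝ} (h1 : ε < 1) :
    IsEmbeddingOn (shell m ε) (shellGroup m) (shellMap m) where
  smooth _ hp := contDiffAt_shellMap h1 hp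
  periodic p _ τ hτ := by
    funext i
    have h2 : τ.1 = 0 := by simpa using hτ.1
    have h3 := hτ.2 i (mem_univ i)
    simp only [shellMap, Prod.fst_add, Prod.snd_add, h2, add_zero, Pi.add_apply]
    exact polar_add h3
  -- A vector killed by the derivative is in the kernel of the pulled-back form, which is
  -- nondegenerate.
  immersion p hp := by
    rw [injective_iff_map_eq_zero]
    intro v hv
    refine cotangentForm_nondegenerate fun w => ?_
    rw [← stdForm_shellMap h1 hp, hv]
    simp [stdForm]
  injective p hp q hq he := by
    have h2 := fun i => polar_injective (action_pos h1 hp i) (action_pos h1 hq i) (congrFun he i)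
    refine ⟨?_, fun i _ => (h2 i).2⟩
    have : p.1 = q.1 := by
      ext i
      have := (h2 i).1
      simp only at this
      linarith
    simp [this]

/-- The direction is (1, √2, 0, …, 0), normalized: a multiple with both leading coordinates in 2πℤ
would make √2 rational. This is where two angles are needed. -/
theorem exists_irrational_direction (hm : 2 ≤ m) : ∃ w : EuclideanSpace ℝ (Fin m), ‖w‖ = 1 ∧
    ∀ c : ℝ, c ≠ 0 → ∃ i, c * w i ∉ AddSubgroup.zmultiples (2 * Real.pi) := by
  let i₀ : Fin m := ⟨0, by omega⟩
  let i₁ : Fin m := ⟨1, by omega⟩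
  have hne : i₁ ≠ i₀ := by simp [i₀, i₁]
  let u : EuclideanSpace ℝ (Fin m) := EuclideanSpace.single i₀ 1 + EuclideanSpace.single i₁ (√2)
  have h0 : u i₀ = 1 := by simp [u, hne.symm]
  have h1 : u i₁ = √2 := by simp [u, hne]
  have hu : ‖u‖ ≠ 0 := by
    intro h
    rw [norm_eq_zero.1 h] at h0
    simp at h0
  refine ⟨‖u‖⁻¹ • u, by rw [norm_smul, norm_inv, norm_norm, inv_mul_cancel₀ hu], fun c hc => ?_⟩
  by_contra! h
  obtain ⟨k, hk⟩ := h i₀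
  obtain ⟨l, hl⟩ := h i₁
  simp only [PiLp.smul_apply, h0, h1, smul_eq_mul, zsmul_eq_mul, mul_one] at hk hl
  have hpi := Real.two_pi_pos.ne'
  have hk0 : (k : ℝ) ≠ 0 := by
    intro h0
    rw [h0, zero_mul] at hk
    exact mul_ne_zero hc (inv_ne_zero hu) hk.symm
  have h2 : (l : ℝ) = √2 * k := by
    refine mul_right_cancel₀ hpi ?_
    rw [hl, mul_assoc, hk]
    ring
  refine irrational_sqrt_two ⟨l / k, ?_⟩
  push_cast
  rw [h2]
  field_simp

end Shell

/-! ### Plugs in every dimension -/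

section ShellPlug

variable {m : ℕ}

/-- The weight of the bump in the directions transverse to the trap. -/
noncomputable def shellWeight (q : EuclideanSpace ℝ (Fin m) × ℝ) : ℝ :=
  decay ((1 / 4) ^ 2) (‖q.1‖ ^ 2) * twoPeaks q.2

/-- The first integral of the plug on the shell. -/
noncomputable def shellA (q : EuclideanSpace ℝ (Fin m) × ℝ × ℝ) : ℝ :=
  q.2.1 - bend (1 / 4) (q.2.1 - 1) * shellWeight (q.1, q.2.2)

/-- The function `B` of the plug on the shell. -/
noncomputable def shellB (b : ℝ × ℝ → ℝ) (q : EuclideanSpace ℝ (Fin m) × ℝ × ℝ) : ℝ :=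
  b (q.2.1 - 1, q.2.2) * decay ((1 / 4) ^ 2) (‖q.1‖ ^ 2)

theorem contDiff_shellWeight : ContDiff ℝ ∞ (shellWeight (m := m)) :=
  ((contDiff_decay _).comp (contDiff_fst.norm_sq ℝ)).mul (contDiff_twoPeaks.comp contDiff_snd)

theorem contDiff_shellA : ContDiff ℝ ∞ (shellA (m := m)) :=
  (contDiff_fst.comp contDiff_snd).sub
    (((contDiff_bend _).comp ((contDiff_fst.comp contDiff_snd).sub contDiff_const)).mul
      (contDiff_shellWeight.comp (contDiff_fst.prodMk (contDiff_snd.comp contDiff_snd))))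

theorem contDiff_shellB {b : ℝ × ℝ → ℝ} (hb : ContDiff ℝ ∞ b) :
    ContDiff ℝ ∞ (shellB (m := m) b) :=
  (hb.comp (((contDiff_fst.comp contDiff_snd).sub contDiff_const).prodMk
    (contDiff_snd.comp contDiff_snd))).mul ((contDiff_decay _).comp (contDiff_fst.norm_sq ℝ))

theorem shellWeight_nonneg (q : EuclideanSpace ℝ (Fin m) × ℝ) : 0 ≤ shellWeight q :=
  mul_nonneg (decay_nonneg _ _) (twoPeaks_nonneg _)

theorem shellWeight_le_one (q : EuclideanSpace ℝ (Fin m) × ℝ) : shellWeight q ≤ 1 :=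
  mul_le_one₀ (decay_le_one (by norm_num) (sq_nonneg _)) (twoPeaks_nonneg _) (twoPeaks_le_one _)

theorem eq_of_shellWeight_eq_one {q : EuclideanSpace ℝ (Fin m) × ℝ} (h : shellWeight q = 1) :
    q.1 = 0 ∧ (q.2 = 1 / 2 ∨ q.2 = -(1 / 2)) := by
  have h1 := decay_le_one (show (0 : ℝ) < (1 / 4) ^ 2 by norm_num) (sq_nonneg ‖q.1‖)
  have h2 := twoPeaks_le_one q.2
  have h3 := decay_nonneg ((1 / 4) ^ 2) (‖q.1‖ ^ 2)
  have h4 := twoPeaks_nonneg q.2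
  rw [shellWeight] at h
  have h5 : decay ((1 / 4) ^ 2) (‖q.1‖ ^ 2) = 1 := by nlinarith
  have h6 : twoPeaks q.2 = 1 := by nlinarith
  have h7 := decay_eq_one (by norm_num) (sq_nonneg _) h5
  exact ⟨norm_eq_zero.1 (pow_eq_zero_iff two_ne_zero |>.1 h7), twoPeaks_eq_one_iff.1 h6⟩

theorem fderiv_shellA (q v : EuclideanSpace ℝ (Fin m) × ℝ × ℝ) : fderiv ℝ shellA q v =
    v.2.1 - (deriv (bend (1 / 4)) (q.2.1 - 1) * v.2.1 * shellWeight (q.1, q.2.2) +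
      bend (1 / 4) (q.2.1 - 1) * fderiv ℝ shellWeight (q.1, q.2.2) (v.1, v.2.2)) := by
  let L : EuclideanSpace ℝ (Fin m) × ℝ × ℝ →L[ℝ] ℝ :=
    (ContinuousLinearMap.fst ℝ ℝ ℝ).comp (ContinuousLinearMap.snd ℝ _ _)
  let T : EuclideanSpace ℝ (Fin m) × ℝ × ℝ →L[ℝ] EuclideanSpace ℝ (Fin m) × ℝ :=
    (ContinuousLinearMap.fst ℝ _ _).prod
      ((ContinuousLinearMap.snd ℝ ℝ ℝ).comp (ContinuousLinearMap.snd ℝ _ _))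
  have h1 : HasFDerivAt (fun q => bend (1 / 4) (L q - 1))
      (deriv (bend (1 / 4)) (L q - 1) • L) q :=
    (((contDiff_bend (1 / 4)).differentiable (by simp) _).hasDerivAt).comp_hasFDerivAt q
      (L.hasFDerivAt.sub_const 1)
  have h2 : HasFDerivAt (fun q => shellWeight (T q)) ((fderiv ℝ shellWeight (T q)).comp T) q :=
    (contDiff_shellWeight.differentiable (by simp) _).hasFDerivAt.comp q T.hasFDerivAt
  have h3 := (L.hasFDerivAt.sub (h1.mul h2)).fderiv
  change fderiv ℝ shellA q = _ at h3
  rw [h3]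
  simp [L, T]
  ring

theorem fderiv_shellA_x (q : EuclideanSpace ℝ (Fin m) × ℝ × ℝ) :
    fderiv ℝ shellA q (0, 1, 0) =
      1 - deriv (bend (1 / 4)) (q.2.1 - 1) * shellWeight (q.1, q.2.2) := by
  rw [fderiv_shellA]
  simp [show ((0 : EuclideanSpace ℝ (Fin m)), (0 : ℝ)) = 0 from rfl]

theorem deriv_bend_mul_shellWeight_le (x : ℝ) (q : EuclideanSpace ℝ (Fin m) × ℝ) :
    deriv (bend (1 / 4)) x * shellWeight q ≤ 1 := by
  have h1 := deriv_bend_le_one (show (0 : ℝ) < 1 / 4 by norm_num) x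
  nlinarith [shellWeight_nonneg q, shellWeight_le_one q]

/-- The slope is 1 - bend'·weight with bend' ≤ 1 and 0 ≤ weight ≤ 1, so it vanishes only when both
factors equal 1, which pins x, y and t separately. -/
theorem shellA_trap {q : EuclideanSpace ℝ (Fin m) × ℝ × ℝ}
    (h : fderiv ℝ shellA q (0, 1, 0) = 0) :
    q.1 = 0 ∧ q.2.1 = 1 ∧ (q.2.2 = 1 / 2 ∨ q.2.2 = -(1 / 2)) := by
  rw [fderiv_shellA_x] at h
  have h1 := deriv_bend_le_one (show (0 : ℝ) < 1 / 4 by norm_num) (q.2.1 - 1)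
  have h2 := shellWeight_nonneg (q.1, q.2.2)
  have h3 := shellWeight_le_one (q.1, q.2.2)
  have h4 : shellWeight (q.1, q.2.2) = 1 := by nlinarith
  have h5 : deriv (bend (1 / 4)) (q.2.1 - 1) = 1 := by rw [h4] at h; linarith
  have h6 := deriv_bend_eq_one (show (0 : ℝ) < 1 / 4 by norm_num) h5
  obtain ⟨h7, h8⟩ := eq_of_shellWeight_eq_one h4
  exact ⟨h7, by linarith, h8⟩

theorem shellWeight_of_trap {t : ℝ} (ht : t = 1 / 2 ∨ t = -(1 / 2)) :
    shellWeight ((0 : EuclideanSpace ℝ (Fin m)), t) = 1 := by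
  rw [shellWeight, twoPeaks_eq_one_iff.2 ht]
  simp [decay_zero]

/-- The bump carries the factor `bend`, which vanishes at x = 1, so the derivatives in y and t
vanish there as well. -/
theorem fderiv_shellA_of_trap {t : ℝ} (ht : t = 1 / 2 ∨ t = -(1 / 2)) :
    fderiv ℝ shellA ((0 : EuclideanSpace ℝ (Fin m)), (1 : ℝ), t) = 0 := by
  ext v
  · simp only [ContinuousLinearMap.comp_apply, fderiv_shellA, sub_self, bend_zero]
    simp
  · simp only [ContinuousLinearMap.comp_apply, fderiv_shellA, sub_self, bend_zero,
      deriv_bend_zero (show (0 : ℝ) < 1 / 4 by norm_num), shellWeight_of_trap ht]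
    simp
  · simp only [ContinuousLinearMap.comp_apply, fderiv_shellA, sub_self, bend_zero]
    simp

theorem shellA_neg (y : EuclideanSpace ℝ (Fin m)) (x t : ℝ) :
    shellA (y, x, -t) = 1 * shellA (y, x, t) := by
  simp [shellA, shellWeight, twoPeaks_neg]

/-- The vector field of the plug along the torus. -/
noncomputable def shellW (w : EuclideanSpace ℝ (Fin m)) (b : ℝ × ℝ → ℝ)
    (q : EuclideanSpace ℝ (Fin m) × ℝ × ℝ) : EuclideanSpace ℝ (Fin m) × (Fin m → ℝ) :=
  (0, fun i => -(fderiv ℝ (shellB b) q (0, 1, 0) * (inner ℝ w (EuclideanSpace.single i 1) -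
      fderiv ℝ shellA q (EuclideanSpace.single i 1 - inner ℝ w (EuclideanSpace.single i 1) • w,
        0, 0)) +
    fderiv ℝ shellA q (0, 1, 0) * fderiv ℝ (shellB b) q
      (EuclideanSpace.single i 1 - inner ℝ w (EuclideanSpace.single i 1) • w, 0, 0)))

theorem contDiff_shellW (w : EuclideanSpace ℝ (Fin m)) {b : ℝ × ℝ → ℝ} (hb : ContDiff ℝ ∞ b) :
    ContDiff ℝ ∞ (shellW w b) := by
  have hA := contDiff_shellA (m := m) |>.fderiv_right (m := ∞) (by simp)
  have hB := contDiff_shellB (m := m) hb |>.fderiv_right (m := ∞) (by simp)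
  refine contDiff_const.prodMk (contDiff_pi.2 fun i => ?_)
  exact (((hB.clm_apply contDiff_const).mul (contDiff_const.sub (hA.clm_apply contDiff_const))).add
    ((hA.clm_apply contDiff_const).mul (hB.clm_apply contDiff_const))).neg

variable {κ : ℝ} {b : ℝ × ℝ → ℝ}

theorem IsOddBump.shellB_neg (hb : IsOddBump κ b) (y : EuclideanSpace ℝ (Fin m)) (x t : ℝ) :
    shellB b (y, x, -t) = -1 * shellB b (y, x, t) := by
  simp [shellB, hb.odd]

/-- On the line y = 0 the decay factor is 1, so B is b(x - 1, t), which is ±(x - 1) near the trap.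
-/
theorem IsOddBump.fderiv_shellB_trap (hb : IsOddBump κ b) {t : ℝ}
    (ht : t = 1 / 2 ∨ t = -(1 / 2)) :
    fderiv ℝ (shellB b) ((0 : EuclideanSpace ℝ (Fin m)), (1 : ℝ), t) (0, 1, 0) ≠ 0 := by
  have hd := (contDiff_shellB (m := m) hb.contDiff).differentiable (by simp)
  have hl : HasDerivAt (fun x : ℝ => ((0 : EuclideanSpace ℝ (Fin m)), x, t)) (0, 1, 0) 1 :=
    (hasDerivAt_const _ _).prodMk ((hasDerivAt_id _).prodMk (hasDerivAt_const _ _))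
  have h1 := (hd (0, 1, t)).hasFDerivAt.comp_hasDerivAt (1 : ℝ) hl
  have hc : Tendsto (fun x : ℝ => (x - 1, t)) (𝓝 1) (𝓝 (0, t)) := by
    have : Continuous fun x : ℝ => (x - 1, t) := by fun_prop
    simpa using this.tendsto 1
  have h0 : (shellB b ∘ fun x : ℝ => ((0 : EuclideanSpace ℝ (Fin m)), x, t)) =
      fun x => b (x - 1, t) := by
    funext x
    simp [shellB, decay_zero]
  rw [h0] at h1
  rcases ht with rfl | rfl
  · have h2 : HasDerivAt (fun x : ℝ => b (x - 1, 1 / 2)) 1 1 :=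
      ((hasDerivAt_id (1 : ℝ)).sub_const 1).congr_of_eventuallyEq (hc.eventually hb.near_pos)
    rw [h1.unique h2]
    exact one_ne_zero
  · have h2 : HasDerivAt (fun x : ℝ => b (x - 1, -(1 / 2))) (-1) 1 :=
      ((hasDerivAt_id (1 : ℝ)).sub_const 1).neg.congr_of_eventuallyEq (hc.eventually hb.near_neg)
    rw [h1.unique h2]
    norm_num

/-- The flow of the plug on the shell. -/
noncomputable def shellFlow {w : EuclideanSpace ℝ (Fin m)} (hw : ‖w‖ = 1)
    (hirr : ∀ c : ℝ, c ≠ 0 → ∃ i, c * w i ∉ AddSubgroup.zmultiples (2 * Real.pi))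
    (hb : IsOddBump κ b) : TrapFlow (EuclideanSpace ℝ (Fin m) × (Fin m → ℝ))
      (EuclideanSpace ℝ (Fin m)) where
  K := shell m (1 / 2)
  Γ := shellGroup m
  e := (w, 0)
  ξ := (innerSL ℝ w).comp (ContinuousLinearMap.fst ℝ _ _)
  υ := ((ContinuousLinearMap.id ℝ (EuclideanSpace ℝ (Fin m))) - (innerSL ℝ w).smulRight w).comp
    (ContinuousLinearMap.fst ℝ _ _)
  X := univ
  x₀ := 1
  a := shellA
  W := shellW w b
  ξ_e := by simp [hw]
  υ_e := by simp [hw]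
  ξ_W q := by simp [shellW]
  υ_W q := by simp [shellW]
  ξ_Γ τ hτ := by
    have : τ.1 = 0 := by simpa using hτ.1
    simp [this]
  ordConnected := ordConnected_univ
  x₀_mem := mem_univ _
  ξ_mem _ _ := mem_univ _
  contDiff_a := contDiff_shellA
  continuousOn_W := (contDiff_shellW w hb.contDiff).continuous.continuousOn
  nonneg y x _ t _ := by
    rw [fderiv_shellA_x, sub_nonneg]
    exact deriv_bend_mul_shellWeight_le _ _
  trap_eq y x _ t _ h := (shellA_trap h).2
  trap_critical y x _ t _ h := by
    obtain ⟨h1, h2, h3⟩ := shellA_trap h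
    simp only at h1 h2 h3
    rw [h1, h2]
    exact fderiv_shellA_of_trap h3
  trap_W y x _ t _ h c hc hmem := by
    obtain ⟨h1, h2, h3⟩ := shellA_trap h
    simp only at h1 h2 h3
    rw [h1, h2] at hmem
    set β := fderiv ℝ (shellB b) ((0 : EuclideanSpace ℝ (Fin m)), (1 : ℝ), t) (0, 1, 0) with hβ
    have hβ0 : β ≠ 0 := hb.fderiv_shellB_trap h3
    obtain ⟨i, hi⟩ := hirr (-(c * β)) (neg_ne_zero.2 (mul_ne_zero hc hβ0))
    refine hi ?_
    have h4 := hmem.2 i (mem_univ i)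
    -- On the trap a is critical, and W reduces to a nonzero multiple of w in the angle directions.
    have h5 : (c • shellW w b ((0 : EuclideanSpace ℝ (Fin m)), (1 : ℝ), t)).2 i =
        -(c * β) * w i := by
      simp only [shellW, fderiv_shellA_of_trap h3, ← hβ]
      simp [EuclideanSpace.inner_single_right]
      ring
    rwa [h5] at h4
  a_even y x _ t _ := by rw [shellA_neg, one_mul]
  ax_even y x _ t _ := by
    rw [fderiv_neg_time (contDiff_shellA.differentiable (by simp)) shellA_neg, one_mul]
  W_odd y x _ t _ := by
    have hA := fderiv_neg_time ((contDiff_shellA (m := m)).differentiable (by simp)) shellA_neg y x t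
    have hB := fderiv_neg_time ((contDiff_shellB (m := m) hb.contDiff).differentiable (by simp))
      hb.shellB_neg y x t
    refine Prod.ext (by simp [shellW]) ?_
    funext i
    simp only [shellW, hA, hB, Prod.snd_neg, Pi.neg_apply]
    ring

end ShellPlug

/-! ### The symplectic structure of the plug on the shell -/

section ShellPlugSymplectic

variable {m : ℕ} {κ : ℝ} {b : ℝ × ℝ → ℝ}

/-- The complement of the support of the perturbation. -/
def shellOuter (m : ℕ) : Set (EuclideanSpace ℝ (Fin m) × ℝ × ℝ) :=
  {q | 1 / 4 < |q.2.1 - 1| ∨ 1 / 4 < ‖q.1‖ ∨ 9 / 10 < |q.2.2|}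

theorem isOpen_shellOuter (m : ℕ) : IsOpen (shellOuter m) := by
  have h1 : Continuous fun q : EuclideanSpace ℝ (Fin m) × ℝ × ℝ => |q.2.1 - 1| := by fun_prop
  have h2 : Continuous fun q : EuclideanSpace ℝ (Fin m) × ℝ × ℝ => ‖q.1‖ := by fun_prop
  have h3 : Continuous fun q : EuclideanSpace ℝ (Fin m) × ℝ × ℝ => |q.2.2| := by fun_prop
  exact (isOpen_lt continuous_const h1).union
    ((isOpen_lt continuous_const h2).union (isOpen_lt continuous_const h3))

theorem shellA_of_mem_outer {q : EuclideanSpace ℝ (Fin m) × ℝ × ℝ} (hq : q ∈ shellOuter m) :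
    shellA q = q.2.1 := by
  rw [shellA, sub_eq_self]
  rcases hq with h | h | h
  · rw [bend_eq_zero (by norm_num) h.le, zero_mul]
  · rw [shellWeight, decay_eq_zero, zero_mul, mul_zero]
    exact pow_le_pow_left₀ (by norm_num) h.le 2
  · rw [shellWeight, twoPeaks_eq_zero h.le, mul_zero, mul_zero]

theorem shellB_of_mem_outer (hb : IsOddBump κ b) (hκ : κ ≤ 1 / 4)
    {q : EuclideanSpace ℝ (Fin m) × ℝ × ℝ} (hq : q ∈ shellOuter m) : shellB b q = 0 := by
  rcases hq with h | h | h
  · rw [shellB, hb.eq_zero _ _ (.inl (hκ.trans h.le)), zero_mul]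
  · rw [shellB, decay_eq_zero, mul_zero]
    exact pow_le_pow_left₀ (by norm_num) h.le 2
  · rw [shellB, hb.eq_zero _ _ (.inr (by linarith)), zero_mul]

theorem abs_shellB_le (hb : IsOddBump κ b) (q : EuclideanSpace ℝ (Fin m) × ℝ × ℝ) :
    |shellB b q| ≤ κ := by
  rw [shellB, abs_mul, abs_of_nonneg (decay_nonneg _ _)]
  exact (mul_le_of_le_one_right (abs_nonneg _) (decay_le_one (by norm_num) (sq_nonneg _))).trans
    (hb.abs_le _)

theorem norm_sq_eq_of_unit {w : EuclideanSpace ℝ (Fin m)} (hw : ‖w‖ = 1)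
    (q : EuclideanSpace ℝ (Fin m)) : ‖q‖ ^ 2 = inner ℝ w q ^ 2 + ‖q - inner ℝ w q • w‖ ^ 2 := by
  rw [@norm_sub_sq_real, inner_smul_right, norm_smul, hw, real_inner_comm, Real.norm_eq_abs,
    mul_one, sq_abs]
  ring

/-- By Pythagoras ‖q‖² lies between (3/4)² and (5/4)² + (1/4)², strictly inside the range from
(1/2)² to (3/2)². This is why width 1/2 accommodates a perturbation of radius 1/4. -/
theorem norm_mem_of_near {w : EuclideanSpace ℝ (Fin m)} (hw : ‖w‖ = 1)
    {q : EuclideanSpace ℝ (Fin m)} (h1 : |inner ℝ w q - 1| ≤ 1 / 4)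
    (h2 : ‖q - inner ℝ w q • w‖ ≤ 1 / 4) : 1 - 1 / 2 < ‖q‖ ∧ ‖q‖ < 1 + 1 / 2 := by
  have h3 := norm_sq_eq_of_unit hw q
  have h4 := abs_le.1 h1
  have h5 := norm_nonneg (q - inner ℝ w q • w)
  constructor
  · refine lt_of_pow_lt_pow_left₀ 2 (norm_nonneg _) ?_
    nlinarith
  · refine lt_of_pow_lt_pow_left₀ 2 (by norm_num) ?_
    nlinarith

variable {w : EuclideanSpace ℝ (Fin m)} (hw : ‖w‖ = 1)
    (hirr : ∀ c : ℝ, c ≠ 0 → ∃ i, c * w i ∉ AddSubgroup.zmultiples (2 * Real.pi))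
    (hb : IsOddBump κ b)

theorem shellFlow_coord (z : ℝ × (EuclideanSpace ℝ (Fin m) × (Fin m → ℝ))) :
    (shellFlow hw hirr hb).coord z =
      (z.2.1 - inner ℝ w z.2.1 • w, inner ℝ w z.2.1, z.1) := by
  simp [shellFlow]

/-- The support of the perturbation is contained in a box that lies in the interior of the plug. -/
theorem coord_mem_shellOuter {z : ℝ × (EuclideanSpace ℝ (Fin m) × (Fin m → ℝ))}
    (hz : z ∈ frontier (plugDomain (shell m (1 / 2)))) :
    (shellFlow hw hirr hb).coord z ∈ shellOuter m := by
  by_contra h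
  rw [shellFlow_coord, shellOuter, mem_ofPred_eq] at h
  push Not at h
  obtain ⟨h1, h2, h3⟩ := h
  obtain ⟨h4, h5⟩ := norm_mem_of_near hw h1 h2
  refine hz.2 (mem_interior_iff_mem_nhds.2 ?_)
  have h6 := abs_le.1 h3
  exact prod_mem_nhds (Icc_mem_nhds (by linarith) (by linarith)) (mem_nhds_shell h4 h5)

/-- The one-form `∑ Qᵢ dθᵢ + B dt` on the shell. -/
noncomputable def shellOneForm (z : ℝ × (EuclideanSpace ℝ (Fin m) × (Fin m → ℝ))) :
    ℝ × (EuclideanSpace ℝ (Fin m) × (Fin m → ℝ)) →L[ℝ] ℝ :=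
  ∑ i, ((shellFlow hw hirr hb).push 1 z).1 i • (ContinuousLinearMap.proj (R := ℝ) i).comp
      ((ContinuousLinearMap.snd ℝ (EuclideanSpace ℝ (Fin m)) (Fin m → ℝ)).comp
        (ContinuousLinearMap.snd ℝ ℝ _)) +
    shellB b ((shellFlow hw hirr hb).coord z) • ContinuousLinearMap.fst ℝ ℝ _

theorem TrapFlow.contDiff_push {E Y : Type*} [NormedAddCommGroup E] [NormedSpace ℝ E]
    [NormedAddCommGroup Y] [NormedSpace ℝ Y] (M : TrapFlow E Y) (s : ℝ) :
    ContDiff ℝ ∞ (M.push s) :=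
  contDiff_snd.add ((contDiff_const.mul ((M.contDiff_a.comp M.coord.contDiff).sub
    (M.ξ.contDiff.comp contDiff_snd))).smul contDiff_const)

theorem TrapFlow.fderiv_push {E Y : Type*} [NormedAddCommGroup E] [NormedSpace ℝ E]
    [NormedAddCommGroup Y] [NormedSpace ℝ Y] (M : TrapFlow E Y) (s : ℝ) (z v : ℝ × E) :
    fderiv ℝ (M.push s) z v = M.dpush s z v := by
  have ha : HasFDerivAt (fun z => M.a (M.coord z)) ((fderiv ℝ M.a (M.coord z)).comp M.coord) z :=
    (M.hasFDerivAt_a _).comp z M.coord.hasFDerivAt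
  have hξ : HasFDerivAt (fun z : ℝ × E => M.ξ z.2) (M.ξ.comp (ContinuousLinearMap.snd ℝ ℝ E)) z :=
    M.ξ.hasFDerivAt.comp z (ContinuousLinearMap.snd ℝ ℝ E).hasFDerivAt
  have hp := ((ContinuousLinearMap.snd ℝ ℝ E).hasFDerivAt (x := z) |>.add
    (((ha.sub hξ).const_mul s).smul_const M.e)).fderiv
  change fderiv ℝ (M.push s) z = _ at hp
  rw [hp]
  rfl

theorem contDiff_shellOneForm : ContDiff ℝ ∞ (shellOneForm hw hirr hb) := by
  have hp := (shellFlow hw hirr hb).contDiff_push 1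
  have hi : ∀ i, ContDiff ℝ ∞ fun z => ((shellFlow hw hirr hb).push 1 z).1 i := fun i =>
    (EuclideanSpace.proj (𝕜 := ℝ) i).contDiff.comp (contDiff_fst.comp hp)
  have hB : ContDiff ℝ ∞ fun z => shellB b ((shellFlow hw hirr hb).coord z) :=
    (contDiff_shellB hb.contDiff).comp (shellFlow hw hirr hb).coord.contDiff
  exact (ContDiff.sum fun i _ => (hi i).smul contDiff_const).add (hB.smul contDiff_const)

theorem fderiv_shellOneForm (z v u : ℝ × (EuclideanSpace ℝ (Fin m) × (Fin m → ℝ))) :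
    fderiv ℝ (shellOneForm hw hirr hb) z v u =
      ∑ i, ((shellFlow hw hirr hb).dpush 1 z v).1 i * u.2.2 i +
        (shellFlow hw hirr hb).db (shellB b) z v * u.1 := by
  set M := shellFlow hw hirr hb with hM
  have hp : HasFDerivAt (M.push 1) (fderiv ℝ (M.push 1) z) z :=
    ((M.contDiff_push 1).differentiable (by simp) z).hasFDerivAt
  have hb' : HasFDerivAt (fun z => shellB b (M.coord z))
      ((fderiv ℝ (shellB b) (M.coord z)).comp M.coord) z :=
    ((contDiff_shellB hb.contDiff).differentiable (by simp) _).hasFDerivAt.comp z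
      M.coord.hasFDerivAt
  have hi : ∀ i, HasFDerivAt (fun z => (M.push 1 z).1 i) (((EuclideanSpace.proj (𝕜 := ℝ) i).comp
      (ContinuousLinearMap.fst ℝ _ _)).comp (fderiv ℝ (M.push 1) z)) z := fun i =>
    HasFDerivAt.comp z (g := fun p : EuclideanSpace ℝ (Fin m) × (Fin m → ℝ) => p.1 i)
      (ContinuousLinearMap.hasFDerivAt ((EuclideanSpace.proj (𝕜 := ℝ) i).comp
        (ContinuousLinearMap.fst ℝ (EuclideanSpace ℝ (Fin m)) (Fin m → ℝ)))) hp
  have hs := (HasFDerivAt.fun_sum (u := Finset.univ) fun i _ => (hi i).smul_const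
    ((ContinuousLinearMap.proj (R := ℝ) i).comp
      ((ContinuousLinearMap.snd ℝ (EuclideanSpace ℝ (Fin m)) (Fin m → ℝ)).comp
        (ContinuousLinearMap.snd ℝ ℝ _)))).add (hb'.smul_const (ContinuousLinearMap.fst ℝ ℝ _))
  have h2 := hs.fderiv
  change fderiv ℝ (shellOneForm hw hirr hb) z = _ at h2
  rw [h2]
  simp only [add_apply, sum_apply, ContinuousLinearMap.smulRight_apply,
    ContinuousLinearMap.comp_apply, smul_apply, smul_eq_mul]
  simp only [TrapFlow.fderiv_push]
  rfl

/-- Here σ is the differential of ∑ Qᵢ dθᵢ + B dt with Q the pushed momentum, so `σ_eq` holds with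
the constant form ρ = ∑ dqᵢ ∧ dθᵢ. -/
theorem isSymplectic_shellFlow (hκ : κ ≤ 1 / 4) :
    (shellFlow hw hirr hb).IsSymplectic m (shellB b) (shellMap m) (fun _ => cotangentForm m)
      (extDeriv (oneForm (shellOneForm hw hirr hb))) where
  contDiff_b := contDiff_shellB hb.contDiff
  embedding := isEmbeddingOn_shellMap (by norm_num)
  pullback p hp := stdForm_shellMap (by norm_num : (1 / 2 : ℝ) < 1) hp
  nondegenerate _ _ _ h := cotangentForm_nondegenerate h
  trap_b z hz h := by
    obtain ⟨h1, h2, h3⟩ := shellA_trap h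
    have : (shellFlow hw hirr hb).coord z = (0, 1, ((shellFlow hw hirr hb).coord z).2.2) :=
      Prod.ext h1 (Prod.ext h2 rfl)
    rw [this]
    exact hb.fderiv_shellB_trap h3
  ρ_W z hz v := by
    set q := (shellFlow hw hirr hb).coord z
    set M := shellFlow hw hirr hb with hM
    let T : EuclideanSpace ℝ (Fin m) →L[ℝ] EuclideanSpace ℝ (Fin m) × ℝ × ℝ :=
      ((ContinuousLinearMap.id ℝ (EuclideanSpace ℝ (Fin m))) - (innerSL ℝ w).smulRight w).prod 0
    -- L is the right side of `ρ_W` as a linear form in the momentum. `shellW` has the angle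
    -- components -L(eᵢ), which is the vector that ρ = ∑ dqᵢ ∧ dθᵢ turns into L.
    let L : EuclideanSpace ℝ (Fin m) →L[ℝ] ℝ :=
      fderiv ℝ (shellB b) q (0, 1, 0) • (innerSL ℝ w - (fderiv ℝ shellA q).comp T) +
        fderiv ℝ shellA q (0, 1, 0) • (fderiv ℝ (shellB b) q).comp T
    have h1 : ∀ i, (shellW w b q).2 i = -L (EuclideanSpace.single i 1) := fun i => by
      simp [shellW, L, T]
      rfl
    have h2 : L v.1 = ∑ i, L (EuclideanSpace.single i 1) * v.1 i := by
      conv_lhs => rw [← (EuclideanSpace.basisFun (Fin m) ℝ).sum_repr v.1]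
      rw [map_sum]
      refine Finset.sum_congr rfl fun i _ => ?_
      rw [map_smul]
      simp [mul_comm]
    have h3 : cotangentForm m (shellW w b q) v = L v.1 := by
      rw [cotangentForm_apply, h2]
      refine Finset.sum_congr rfl fun i _ => ?_
      rw [h1]
      simp [shellW]
    exact h3
  σ_eq z hz v u := by
    have hd : DifferentiableAt ℝ (shellOneForm hw hirr hb) z :=
      (contDiff_shellOneForm hw hirr hb).differentiable (by simp) z
    have h2 : ∀ v, ((shellFlow hw hirr hb).dpush 1 z v).2 = v.2.2 := by
      intro v
      have : ((shellFlow hw hirr hb).dpush 1 z v).2 = v.2.2 + _ • (0 : Fin m → ℝ) := rfl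
      rw [this, smul_zero, add_zero]
    rw [extDeriv_oneForm_apply hd, fderiv_shellOneForm, fderiv_shellOneForm, cotangentForm_apply,
      h2, h2, Finset.sum_sub_distrib]
    have h3 : ∑ i, v.2.2 i * ((shellFlow hw hirr hb).dpush 1 z u).1 i =
        ∑ i, ((shellFlow hw hirr hb).dpush 1 z u).1 i * v.2.2 i :=
      Finset.sum_congr rfl fun i _ => mul_comm _ _
    rw [h3]
    ring
  exact := by
    refine ⟨oneForm (shellOneForm hw hirr hb), fun z _ =>
      contDiffAt_oneForm (contDiff_shellOneForm hw hirr hb).contDiffAt, fun z _ τ hτ => ?_,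
      fun _ _ => rfl⟩
    have h1 : τ.1 = 0 := by simpa using hτ.1
    have h2 : τ.2.1 = 0 := by simpa using hτ.2.1
    have h3 : (shellFlow hw hirr hb).coord (z + τ) = (shellFlow hw hirr hb).coord z := by
      rw [shellFlow_coord, shellFlow_coord]
      simp [h1, h2]
    have h4 : ((shellFlow hw hirr hb).push 1 (z + τ)).1 = ((shellFlow hw hirr hb).push 1 z).1 := by
      have e1 : (shellFlow hw hirr hb).ξ (z + τ).2 = (shellFlow hw hirr hb).ξ z.2 :=
        congrArg (fun q => q.2.1) h3
      rw [TrapFlow.push, TrapFlow.push, h3, e1]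
      simp [h2]
    have h5 : shellOneForm hw hirr hb (z + τ) = shellOneForm hw hirr hb z := by
      rw [shellOneForm, shellOneForm, h3, h4]
    simp only [oneForm, h5]
  push_mem z hz s hs := by
    -- Outside the box `push` is the identity. Inside, x - 1 is multiplied by a number in [0, 1] and
    -- y is kept, so the point stays in the box and hence in the shell.
    by_cases h : (shellFlow hw hirr hb).coord z ∈ shellOuter m
    · have h1 : (shellFlow hw hirr hb).a ((shellFlow hw hirr hb).coord z) =
          (shellFlow hw hirr hb).ξ z.2 := shellA_of_mem_outer h
      rw [TrapFlow.push, h1]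
      simpa using hz.2
    · have h0 := h
      rw [shellFlow_coord, shellOuter, mem_ofPred_eq] at h
      push Not at h
      obtain ⟨h1, h2, -⟩ := h
      set x := inner ℝ w z.2.1 with hx
      set c := s * (shellA ((shellFlow hw hirr hb).coord z) - x) with hc
      have hpush : ((shellFlow hw hirr hb).push s z).1 = z.2.1 + c • w := rfl
      have hin : inner ℝ w (z.2.1 + c • w) = x + c := by
        rw [inner_add_right, inner_smul_right, real_inner_self_eq_norm_sq, hw]
        simp [hx]
      have hy : z.2.1 + c • w - inner ℝ w (z.2.1 + c • w) • w = z.2.1 - x • w := by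
        rw [hin]; module
      have hxc : |x + c - 1| ≤ 1 / 4 := by
        have hweight := shellWeight_nonneg (z.2.1 - x • w, z.1)
        have hweight' := shellWeight_le_one (z.2.1 - x • w, z.1)
        have hdec := decay_nonneg ((1 / 4) ^ 2) ((x - 1) ^ 2)
        have hdec' := decay_le_one (show (0 : ℝ) < (1 / 4) ^ 2 by norm_num) (sq_nonneg (x - 1))
        have hce : x + c - 1 = (x - 1) * (1 - s * (decay ((1 / 4) ^ 2) ((x - 1) ^ 2) *
            shellWeight (z.2.1 - x • w, z.1))) := by
          rw [hc, shellFlow_coord, shellA, bend]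
          ring
        have hprod0 := mul_nonneg hdec hweight
        have hprod1 := mul_le_one₀ hdec' hweight hweight'
        rw [hce, abs_mul]
        refine (mul_le_of_le_one_right (abs_nonneg _) ?_).trans h1
        rw [abs_le]
        constructor
        · nlinarith [hs.1, hs.2, mul_le_one₀ hs.2 hprod0 hprod1]
        · nlinarith [hs.1, hs.2, mul_nonneg hs.1 hprod0]
      have := norm_mem_of_near hw (q := z.2.1 + c • w) (by rw [hin]; exact hxc)
        (by rw [hy]; exact h2)
      exact ⟨this.1.le, this.2.le⟩
  add_mem p hp τ hτ := by
    have : τ.1 = 0 := by simpa using hτ.1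
    change p + τ ∈ shell m (1 / 2)
    have hp' : p ∈ shell m (1 / 2) := hp
    simpa [shell, this] using hp'
  a_periodic z _ τ hτ := by
    have h1 : τ.1 = 0 := by simpa using hτ.1
    have h2 : τ.2.1 = 0 := by simpa using hτ.2.1
    rw [shellFlow_coord, shellFlow_coord]
    simp [h1, h2]
  b_periodic z _ τ hτ := by
    have h1 : τ.1 = 0 := by simpa using hτ.1
    have h2 : τ.2.1 = 0 := by simpa using hτ.2.1
    rw [shellFlow_coord, shellFlow_coord]
    simp [h1, h2]
  near := by
    have hopen : IsOpen ((shellFlow hw hirr hb).coord ⁻¹' shellOuter m) :=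
      (isOpen_shellOuter m).preimage (shellFlow hw hirr hb).coord.continuous
    refine mem_of_superset (hopen.mem_nhdsSet.2 fun z hz => coord_mem_shellOuter hw hirr hb hz) ?_
    intro z hz _
    have hnhds := (isOpen_shellOuter m).mem_nhds hz
    have hA : fderiv ℝ shellA ((shellFlow hw hirr hb).coord z) =
        (ContinuousLinearMap.fst ℝ ℝ ℝ).comp (ContinuousLinearMap.snd ℝ _ _) := by
      have h1 : shellA =ᶠ[𝓝 ((shellFlow hw hirr hb).coord z)]
          (ContinuousLinearMap.fst ℝ ℝ ℝ).comp
            (ContinuousLinearMap.snd ℝ (EuclideanSpace ℝ (Fin m)) (ℝ × ℝ)) := by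
        filter_upwards [hnhds] with q hq using shellA_of_mem_outer hq
      rw [h1.fderiv_eq, ContinuousLinearMap.fderiv]
    have hB : fderiv ℝ (shellB b) ((shellFlow hw hirr hb).coord z) = 0 := by
      have h1 : shellB b =ᶠ[𝓝 ((shellFlow hw hirr hb).coord z)] fun _ => (0 : ℝ) := by
        filter_upwards [hnhds] with q hq using shellB_of_mem_outer hb hκ hq
      rw [h1.fderiv_eq, fderiv_fun_const]
      rfl
    refine ⟨shellA_of_mem_outer hz, fun q => ?_, shellB_of_mem_outer hb hκ hz, hB, ?_⟩
    · exact DFunLike.congr_fun hA q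
    · change shellW w b _ = 0
      simp only [shellW, hB]
      refine Prod.ext rfl ?_
      funext i
      simp
  trapped := by
    have h1 : (shellFlow hw hirr hb).υ (w, 0) = 0 := by simp [shellFlow, hw]
    have h2 : (shellFlow hw hirr hb).ξ (w, 0) = 1 := by simp [shellFlow, hw]
    -- At x = 1 the bump vanishes for every t, so the entry point w lies on the level a = 1 of the
    -- trap.
    refine ⟨(w, 0), ?_, ?_, ?_⟩
    · change (1 - 1 / 2 ≤ ‖w‖ ∧ ‖w‖ ≤ 1 + 1 / 2)
      rw [hw]
      norm_num
    · rw [h1, h2]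
      change shellA _ = shellA (_, 1, _)
      simp [shellA, bend_zero]
    · rw [h1]
      change fderiv ℝ shellA ((0 : EuclideanSpace ℝ (Fin m)), (1 : ℝ), (1 / 2 : ℝ)) (0, 1, 0) = 0
      rw [fderiv_shellA_of_trap (.inl rfl)]
      rfl

end ShellPlugSymplectic

/-- The size of b is δ for the range of J, capped at 1/4 so that B is supported in the box of the
perturbation. -/
theorem exists_isSymplecticPlug_shell {n : ℕ} (hn : 3 ≤ n) {δ : ℝ} (hδ : 0 < δ) :
    ∃ σ j J, IsSymplecticPlug n (shell (n - 1) (1 / 2)) (shellGroup (n - 1)) δ σ j J := by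
  obtain ⟨w, hw, hirr⟩ := exists_irrational_direction (m := n - 1) (by omega)
  obtain ⟨b, hb⟩ := exists_odd_bump (κ := min δ (1 / 4)) (by positivity)
  have hK : IsCompactQuotient (2 * n - 2) (shell (n - 1) (1 / 2)) (shellGroup (n - 1)) := by
    have := isCompactQuotient_shell (n - 1) (ε := 1 / 2) (by norm_num) (by norm_num)
    rwa [show 2 * (n - 1) = 2 * n - 2 by omega] at this
  exact ⟨_, _, _, (isSymplectic_shellFlow hw hirr hb (min_le_right _ _)).isSymplecticPlug
    (by omega) hK fun z _ => (abs_shellB_le hb _).trans (min_le_left _ _)⟩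

/-! ### The forms of the plug over the torus -/

section CollarForms

/-- The value of `η` on a vector. -/
theorem eta_apply (R : ℝ) (θ w : Angles) :
    eta R θ w = R * Real.cos θ.2.2 * w.1 + R * Real.sin θ.2.2 * w.2.1 := rfl

theorem contDiff_eta (R : ℝ) : ContDiff ℝ ∞ (eta R) :=
  ((contDiff_const.mul (Real.contDiff_cos.comp (contDiff_snd.comp contDiff_snd))).smul
    contDiff_const).add ((contDiff_const.mul (Real.contDiff_sin.comp
      (contDiff_snd.comp contDiff_snd))).smul contDiff_const)

theorem eta_add (R : ℝ) (θ : Angles) {τ : Angles} (hτ : τ ∈ angleLattice) :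
    eta R (θ + τ) = eta R θ := by
  simp only [eta, Prod.snd_add, cos_add_of_mem_zmultiples hτ.2.2, sin_add_of_mem_zmultiples hτ.2.2]

theorem hasFDerivAt_eta_apply (R : ℝ) (θ w : Angles) : HasFDerivAt (fun θ => eta R θ w)
    ((R * (-Real.sin θ.2.2 * w.1 + Real.cos θ.2.2 * w.2.1)) •
      (ContinuousLinearMap.snd ℝ ℝ ℝ).comp (ContinuousLinearMap.snd ℝ ℝ (ℝ × ℝ))) θ := by
  let T : Angles →L[ℝ] ℝ := (ContinuousLinearMap.snd ℝ ℝ ℝ).comp (ContinuousLinearMap.snd ℝ ℝ (ℝ × ℝ))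
  have h1 : HasFDerivAt (fun θ => Real.cos (T θ)) (-Real.sin (T θ) • T) θ := T.hasFDerivAt.cos
  have h2 : HasFDerivAt (fun θ => Real.sin (T θ)) (Real.cos (T θ) • T) θ := T.hasFDerivAt.sin
  refine (((h1.const_mul R).mul_const w.1).add ((h2.const_mul R).mul_const w.2.1)).congr_fderiv ?_
  ext <;> simp [T]
  ring

/-- The exterior derivative of `f η + g dτ`, where `f` and `g` are functions and `τ` is linear. -/
theorem extDeriv_smul_eta_add {E : Type*} [NormedAddCommGroup E] [NormedSpace ℝ E] (R : ℝ)
    {f g : E → ℝ} {P : E →L[ℝ] Angles} {τ : E →L[ℝ] ℝ} {z : E} (hf : ContDiffAt ℝ ∞ f z)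
    (hg : ContDiffAt ℝ ∞ g z) (v w : E) :
    extDeriv (oneForm fun z => f z • (eta R (P z)).comp P + g z • τ) z ![v, w] =
      R * (fderiv ℝ f z v * (Real.cos (P z).2.2 * (P w).1 + Real.sin (P z).2.2 * (P w).2.1) -
        fderiv ℝ f z w * (Real.cos (P z).2.2 * (P v).1 + Real.sin (P z).2.2 * (P v).2.1) +
        f z * ((P v).2.2 * (-Real.sin (P z).2.2 * (P w).1 + Real.cos (P z).2.2 * (P w).2.1) -
          (P w).2.2 * (-Real.sin (P z).2.2 * (P v).1 + Real.cos (P z).2.2 * (P v).2.1))) +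
      (fderiv ℝ g z v * τ w - fderiv ℝ g z w * τ v) := by
  have hα : ContDiffAt ℝ ∞ (fun z => f z • (eta R (P z)).comp P + g z • τ) z := by
    have h1 : ContDiffAt ℝ ∞ (fun z => (eta R (P z)).comp P) z :=
      (((contDiff_eta R).comp P.contDiff).clm_comp contDiff_const).contDiffAt
    exact (hf.smul h1).add (hg.smul contDiffAt_const)
  have hd := hα.differentiableAt (by simp)
  have key : ∀ v w, fderiv ℝ (fun z => f z • (eta R (P z)).comp P + g z • τ) z v w =
      fderiv ℝ f z v * eta R (P z) (P w) + f z * ((R * (-Real.sin (P z).2.2 * (P w).1 +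
        Real.cos (P z).2.2 * (P w).2.1)) * (P v).2.2) + fderiv ℝ g z v * τ w := by
    intro v w
    have h1 := hd.hasFDerivAt.clm_apply (hasFDerivAt_const w z)
    have h2 : HasFDerivAt (fun z => eta R (P z) (P w)) _ z :=
      (hasFDerivAt_eta_apply R (P z) (P w)).comp z P.hasFDerivAt
    have h3 := ((hf.differentiableAt (by simp)).hasFDerivAt.mul h2).add
      ((hg.differentiableAt (by simp)).hasFDerivAt.mul_const (τ w))
    have h4 := DFunLike.congr_fun (h1.unique h3) v
    simp at h4
    rw [h4]
    ring
  rw [extDeriv_oneForm_apply hd, key, key, eta_apply, eta_apply]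
  ring

theorem extDeriv_eta (R : ℝ) (θ v w : Angles) : extDeriv (oneForm (eta R)) θ ![v, w] =
    R * (v.2.2 * (-Real.sin θ.2.2 * w.1 + Real.cos θ.2.2 * w.2.1) -
          w.2.2 * (-Real.sin θ.2.2 * v.1 + Real.cos θ.2.2 * v.2.1)) := by
  have h := extDeriv_smul_eta_add R (f := fun _ : Angles => (1 : ℝ)) (g := fun _ => (0 : ℝ))
    (P := ContinuousLinearMap.id ℝ Angles) (τ := 0) (z := θ) contDiffAt_const contDiffAt_const v w
  have e : (fun z : Angles => (1 : ℝ) • (eta R (ContinuousLinearMap.id ℝ Angles z)).comp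
      (ContinuousLinearMap.id ℝ Angles) + (0 : ℝ) • (0 : Angles →L[ℝ] ℝ)) = eta R := by
    funext z
    simp
  rw [e] at h
  rw [h]
  simp

/-- The form `d((1 + x) η)` at a point with `x`-coordinate `p.1`. -/
noncomputable def collarBilin (R : ℝ) (p : ℝ × Angles) :
    (ℝ × Angles) →ₗ[ℝ] (ℝ × Angles) →ₗ[ℝ] ℝ :=
  LinearMap.mk₂ ℝ (fun v w => R *
      (v.1 * (Real.cos p.2.2.2 * w.2.1 + Real.sin p.2.2.2 * w.2.2.1) -
        w.1 * (Real.cos p.2.2.2 * v.2.1 + Real.sin p.2.2.2 * v.2.2.1) +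
        (1 + p.1) * (v.2.2.2 * (-Real.sin p.2.2.2 * w.2.1 + Real.cos p.2.2.2 * w.2.2.1) -
          w.2.2.2 * (-Real.sin p.2.2.2 * v.2.1 + Real.cos p.2.2.2 * v.2.2.1))))
    (fun u v w => by simp; ring) (fun c v w => by simp; ring) (fun u v w => by simp; ring)
    (fun c v w => by simp; ring)

theorem collarBilin_apply (R : ℝ) (p v w : ℝ × Angles) : collarBilin R p v w = R *
      (v.1 * (Real.cos p.2.2.2 * w.2.1 + Real.sin p.2.2.2 * w.2.2.1) -
        w.1 * (Real.cos p.2.2.2 * v.2.1 + Real.sin p.2.2.2 * v.2.2.1) +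
        (1 + p.1) * (v.2.2.2 * (-Real.sin p.2.2.2 * w.2.1 + Real.cos p.2.2.2 * w.2.2.1) -
          w.2.2.2 * (-Real.sin p.2.2.2 * v.2.1 + Real.cos p.2.2.2 * v.2.2.1))) := rfl

theorem collarForm_apply (R : ℝ) (p v w : ℝ × Angles) :
    collarForm R p ![v, w] = collarBilin R p v w := by
  have h := extDeriv_smul_eta_add R (f := fun p : ℝ × Angles => 1 + p.1) (g := fun _ => (0 : ℝ))
    (P := ContinuousLinearMap.snd ℝ ℝ Angles) (τ := 0) (z := p)
    (contDiffAt_const.add contDiffAt_fst) contDiffAt_const v w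
  have e : (fun p : ℝ × Angles => (1 + p.1) • (eta R (ContinuousLinearMap.snd ℝ ℝ Angles p)).comp
      (ContinuousLinearMap.snd ℝ ℝ Angles) + (0 : ℝ) • (0 : ℝ × Angles →L[ℝ] ℝ)) =
      fun p => (1 + p.1) • (eta R p.2).comp (ContinuousLinearMap.snd ℝ ℝ Angles) := by
    funext z
    simp
  rw [e] at h
  have hd : fderiv ℝ (fun p : ℝ × Angles => 1 + p.1) p = ContinuousLinearMap.fst ℝ ℝ Angles :=
    (hasFDerivAt_fst.const_add 1).fderiv
  rw [collarForm, h, hd, collarBilin_apply]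
  simp

/-- With η' = cos θ₃ dθ₁ + sin θ₃ dθ₂ and its quarter turn η'', the form is R(dx ∧ η' + (1 + x) dθ₃
∧ η''). Rotating the equations by θ₃ decouples the two planes. -/
theorem collarBilin_nondegenerate {R : ℝ} (hR : 0 < R) {p : ℝ × Angles} (hp : 0 < 1 + p.1)
    {v : ℝ × Angles} (h : ∀ w, collarBilin R p v w = 0) : v = 0 := by
  have h1 := h (1, 0, 0, 0)
  have h2 := h (0, 1, 0, 0)
  have h3 := h (0, 0, 1, 0)
  have h4 := h (0, 0, 0, 1)
  simp only [collarBilin_apply, mul_eq_zero, hR.ne', false_or] at h1 h2 h3 h4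
  have hcs := Real.cos_sq_add_sin_sq p.2.2.2
  set c := Real.cos p.2.2.2
  set s := Real.sin p.2.2.2
  have e1 : c * v.2.1 + s * v.2.2.1 = 0 := by linarith
  have e4 : -s * v.2.1 + c * v.2.2.1 = 0 := by
    have : (1 + p.1) * (-s * v.2.1 + c * v.2.2.1) = 0 := by linarith
    exact (mul_eq_zero.1 this).resolve_left hp.ne'
  have e2 : v.1 * c - (1 + p.1) * v.2.2.2 * s = 0 := by linarith
  have e3 : v.1 * s + (1 + p.1) * v.2.2.2 * c = 0 := by linarith
  have f1 : v.2.1 = 0 := by linear_combination c * e1 - s * e4 - v.2.1 * hcs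
  have f2 : v.2.2.1 = 0 := by linear_combination s * e1 + c * e4 - v.2.2.1 * hcs
  have f3 : v.1 = 0 := by linear_combination c * e2 + s * e3 - v.1 * hcs
  have f4 : (1 + p.1) * v.2.2.2 = 0 := by
    linear_combination c * e3 - s * e2 - (1 + p.1) * v.2.2.2 * hcs
  exact Prod.ext f3 (Prod.ext f1 (Prod.ext f2 ((mul_eq_zero.1 f4).resolve_left hp.ne')))

end CollarForms

/-! ### The collar and its symplectic embedding -/

section Collar

variable {R ε : ℝ}

theorem one_add_pos_of_mem_collar (h1 : ε < 1) {p : ℝ × Angles} (hp : p ∈ collar ε) :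
    0 < 1 + p.1 ∧ 1 + p.1 < 2 := by
  have := hp.1
  constructor <;> linarith [this.1, this.2]

/-- The shifted actions and the angles of a point of the collar. -/
noncomputable def collarActionAngle (R : ℝ) (i : Fin 2) (p : ℝ × Angles) : ℝ × ℝ :=
  if i = 0 then ((1 + p.1) * (R * Real.cos p.2.2.2) + 3 * R, p.2.1)
  else ((1 + p.1) * (R * Real.sin p.2.2.2) + 3 * R, p.2.2.1)

/-- The embedding of the collar by symplectic polar coordinates. -/
noncomputable def collarMap (R : ℝ) (p : ℝ × Angles) : StdSpace 2 :=
  fun i => polar (collarActionAngle R i p)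

/-- The momentum (1 + x)R·u with |u| ≤ 1 exceeds -2R because 1 + x < 2, so the shift 3R suffices. -/
theorem collar_action_pos (hR : 0 < R) (h1 : ε < 1) {p : ℝ × Angles} (hp : p ∈ collar ε)
    (i : Fin 2) : 0 < (collarActionAngle R i p).1 := by
  obtain ⟨hp1, hp2⟩ := one_add_pos_of_mem_collar h1 hp
  have key : ∀ u : ℝ, -1 ≤ u → 0 < (1 + p.1) * (R * u) + 3 * R := by
    intro u hu
    have : -((1 + p.1) * R) ≤ (1 + p.1) * R * u := by nlinarith [mul_pos hp1 hR]
    nlinarith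
  unfold collarActionAngle
  split_ifs
  · exact key _ (Real.neg_one_le_cos _)
  · exact key _ (Real.neg_one_le_sin _)

theorem contDiff_collarActionAngle (R : ℝ) (i : Fin 2) :
    ContDiff ℝ ∞ (collarActionAngle R i) := by
  unfold collarActionAngle
  split_ifs
  · fun_prop
  · fun_prop

theorem contDiffAt_collarMap (hR : 0 < R) (h1 : ε < 1) {p : ℝ × Angles} (hp : p ∈ collar ε) :
    ContDiffAt ℝ ∞ (collarMap R) p := by
  rw [contDiffAt_pi]
  intro i
  exact ContDiffAt.comp p (contDiffAt_polar (collar_action_pos hR h1 hp i))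
    (contDiff_collarActionAngle R i).contDiffAt

theorem fderiv_collarMap (hR : 0 < R) (h1 : ε < 1) {p : ℝ × Angles} (hp : p ∈ collar ε)
    (v : ℝ × Angles) (i : Fin 2) : fderiv ℝ (collarMap R) p v i =
      fderiv ℝ polar (collarActionAngle R i p) (fderiv ℝ (collarActionAngle R i) p v) := by
  have h2 := ((contDiffAt_collarMap hR h1 hp).differentiableAt (by simp)).hasFDerivAt
  have h3 := hasFDerivAt_pi'.1 h2 i
  have h4 := ((contDiffAt_polar (collar_action_pos hR h1 hp i)).differentiableAt
    (by simp)).hasFDerivAt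
  have h5 := HasFDerivAt.comp p h4
    ((contDiff_collarActionAngle R i).differentiable (by simp) p).hasFDerivAt
  exact DFunLike.congr_fun (h3.unique h5) v

theorem fderiv_collarActionAngle_zero (p v : ℝ × Angles) :
    fderiv ℝ (collarActionAngle R 0) p v = (R * (v.1 * Real.cos p.2.2.2 -
      (1 + p.1) * Real.sin p.2.2.2 * v.2.2.2), v.2.1) := by
  let T : ℝ × Angles →L[ℝ] ℝ := (ContinuousLinearMap.snd ℝ ℝ ℝ).comp
    ((ContinuousLinearMap.snd ℝ ℝ (ℝ × ℝ)).comp (ContinuousLinearMap.snd ℝ ℝ Angles))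
  let T₁ : ℝ × Angles →L[ℝ] ℝ := (ContinuousLinearMap.fst ℝ ℝ (ℝ × ℝ)).comp
    (ContinuousLinearMap.snd ℝ ℝ Angles)
  have h1 : HasFDerivAt (fun p => Real.cos (T p)) (-Real.sin (T p) • T) p := T.hasFDerivAt.cos
  have h2 := ((((hasFDerivAt_fst (p := p)).const_add 1).mul (h1.const_mul R)).add_const
    (3 * R)).prodMk T₁.hasFDerivAt
  have h3 := h2.fderiv
  change fderiv ℝ (collarActionAngle R 0) p = _ at h3
  rw [h3]
  refine Prod.ext ?_ ?_
  · simp [T]; ring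
  · simp [T₁]

theorem fderiv_collarActionAngle_one (p v : ℝ × Angles) :
    fderiv ℝ (collarActionAngle R 1) p v = (R * (v.1 * Real.sin p.2.2.2 +
      (1 + p.1) * Real.cos p.2.2.2 * v.2.2.2), v.2.2.1) := by
  let T : ℝ × Angles →L[ℝ] ℝ := (ContinuousLinearMap.snd ℝ ℝ ℝ).comp
    ((ContinuousLinearMap.snd ℝ ℝ (ℝ × ℝ)).comp (ContinuousLinearMap.snd ℝ ℝ Angles))
  let T₁ : ℝ × Angles →L[ℝ] ℝ := (ContinuousLinearMap.fst ℝ ℝ ℝ).comp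
    ((ContinuousLinearMap.snd ℝ ℝ (ℝ × ℝ)).comp (ContinuousLinearMap.snd ℝ ℝ Angles))
  have h1 : HasFDerivAt (fun p => Real.sin (T p)) (Real.cos (T p) • T) p := T.hasFDerivAt.sin
  have h2 := ((((hasFDerivAt_fst (p := p)).const_add 1).mul (h1.const_mul R)).add_const
    (3 * R)).prodMk T₁.hasFDerivAt
  have h3 := h2.fderiv
  change fderiv ℝ (collarActionAngle R 1) p = _ at h3
  rw [h3]
  refine Prod.ext ?_ ?_
  · simp [T]; ring
  · simp [T₁]

/-- With p = (1 + x)R(cos θ₃, sin θ₃) one has (1 + x)η = p₁ dθ₁ + p₂ dθ₂, so its differential is the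
standard form in the actions p and the angles θ₁, θ₂. -/
theorem stdForm_collarMap (hR : 0 < R) (h1 : ε < 1) {p : ℝ × Angles} (hp : p ∈ collar ε)
    (v w : ℝ × Angles) :
    stdForm 2 (fderiv ℝ (collarMap R) p v) (fderiv ℝ (collarMap R) p w) =
      collarBilin R p v w := by
  rw [stdForm, Fin.sum_univ_two]
  simp only [fderiv_collarMap hR h1 hp]
  rw [polar_area (collar_action_pos hR h1 hp 0), polar_area (collar_action_pos hR h1 hp 1)]
  simp only [fderiv_collarActionAngle_zero, fderiv_collarActionAngle_one, collarBilin_apply]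
  ring

theorem isCollarEmbedding_collarMap (hR : 0 < R) (h1 : ε < 1) :
    IsCollarEmbedding R ε (collarMap R) := by
  refine ⟨⟨fun p hp => contDiffAt_collarMap hR h1 hp, ?_, ?_, ?_⟩, fun p hp v w => ?_⟩
  · intro p _ τ hτ
    have h2 : τ.1 = 0 := by simpa using hτ.1
    obtain ⟨h3, h4, h5⟩ := hτ.2
    funext i
    simp only [collarMap, collarActionAngle, Prod.fst_add, Prod.snd_add, h2, add_zero,
      cos_add_of_mem_zmultiples h5, sin_add_of_mem_zmultiples h5]
    split_ifs
    · exact polar_add h3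
    · exact polar_add h4
  · intro p hp
    rw [injective_iff_map_eq_zero]
    intro v hv
    refine collarBilin_nondegenerate hR (one_add_pos_of_mem_collar h1 hp).1 fun w => ?_
    rw [← stdForm_collarMap hR h1 hp, hv]
    simp [stdForm]
  · intro p hp q hq he
    have h2 := fun i => polar_injective (collar_action_pos hR h1 hp i)
      (collar_action_pos hR h1 hq i) (congrFun he i)
    obtain ⟨h3, h4⟩ := h2 0
    obtain ⟨h5, h6⟩ := h2 1
    simp only [collarActionAngle, one_ne_zero, if_true, if_false] at h3 h4 h5 h6
    have hp1 := (one_add_pos_of_mem_collar h1 hp).1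
    have hq1 := (one_add_pos_of_mem_collar h1 hq).1
    have e1 : (1 + p.1) * Real.cos p.2.2.2 = (1 + q.1) * Real.cos q.2.2.2 := by
      refine mul_left_cancel₀ hR.ne' ?_
      linarith
    have e2 : (1 + p.1) * Real.sin p.2.2.2 = (1 + q.1) * Real.sin q.2.2.2 := by
      refine mul_left_cancel₀ hR.ne' ?_
      linarith
    -- The length of the momentum recovers 1 + x, and its direction then recovers θ₃.
    have e3 : 1 + p.1 = 1 + q.1 := by
      have c1 := Real.cos_sq_add_sin_sq p.2.2.2
      have c2 := Real.cos_sq_add_sin_sq q.2.2.2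
      have : (1 + p.1) ^ 2 = (1 + q.1) ^ 2 := by
        calc (1 + p.1) ^ 2 = ((1 + p.1) * Real.cos p.2.2.2) ^ 2 +
              ((1 + p.1) * Real.sin p.2.2.2) ^ 2 := by linear_combination -(1 + p.1) ^ 2 * c1
          _ = (1 + q.1) ^ 2 := by rw [e1, e2]; linear_combination (1 + q.1) ^ 2 * c2
      exact (pow_left_inj₀ hp1.le hq1.le two_ne_zero).1 this
    rw [e3] at e1 e2
    refine ⟨?_, h4, h6, sub_mem_zmultiples_of_cos_sin (mul_left_cancel₀ hq1.ne' e1)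
      (mul_left_cancel₀ hq1.ne' e2)⟩
    have : p.1 = q.1 := by linarith
    simp [this]
  · rw [stdForm_collarMap hR h1 hp, collarForm_apply]

theorem isClosed_collar (ε : ℝ) : IsClosed (collar ε) := isClosed_Icc.prod isClosed_univ

theorem mem_nhds_collar {p : ℝ × Angles} (hp : |p.1| < ε) : collar ε ∈ 𝓝 p := by
  obtain ⟨h1, h2⟩ := abs_lt.1 hp
  exact prod_mem_nhds (Icc_mem_nhds h1 h2) univ_mem

theorem isCornerDomain_collar (h0 : 0 < ε) : IsCornerDomain (collar ε) := by
  refine isCornerDomain_of_smooth_boundary (isClosed_collar ε) fun p hp => ?_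
  obtain ⟨⟨hp1, hp2⟩, -⟩ := hp
  rcases hp1.eq_or_lt with he | hl
  · refine .inr ⟨fun q => q.1 + ε, contDiffAt_fst.add contDiffAt_const, by simp [← he],
      fun h => ?_, ?_⟩
    · rw [((hasFDerivAt_fst (p := p)).add_const ε).fderiv] at h
      have := DFunLike.congr_fun h (1, 0)
      simp at this
    · filter_upwards [continuous_fst.continuousAt.eventually
        (gt_mem_nhds (show p.1 < ε by linarith))] with q hq
      exact ⟨fun h => by linarith [h.1.1], fun h => ⟨⟨by linarith, hq.le⟩, mem_univ _⟩⟩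
  · rcases hp2.eq_or_lt with he | hu
    · refine .inr ⟨fun q => ε - q.1, contDiffAt_const.sub contDiffAt_fst, by simp [he],
        fun h => ?_, ?_⟩
      · rw [((hasFDerivAt_fst (p := p)).const_sub ε).fderiv] at h
        have := DFunLike.congr_fun h (1, 0)
        simp at this
      · filter_upwards [continuous_fst.continuousAt.eventually (lt_mem_nhds hl)] with q hq
        exact ⟨fun h => by linarith [h.1.2], fun h => ⟨⟨hq.le, by linarith⟩, mem_univ _⟩⟩
    · exact .inl (mem_nhds_collar (abs_lt.2 ⟨hl, hu⟩))

theorem isCompactQuotient_collar (h0 : 0 < ε) : IsCompactQuotient 4 (collar ε) collarGroup where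
  finiteDimensional := inferInstance
  dim := by simp
  domain := isCornerDomain_collar h0
  discrete := by
    have h1 : DiscreteTopology (⊥ : AddSubgroup ℝ) := inferInstance
    have h2 := discreteTopology_prod (AddSubgroup.zmultiples (2 * Real.pi))
      (AddSubgroup.zmultiples (2 * Real.pi))
    have h3 : DiscreteTopology angleLattice :=
      discreteTopology_prod (AddSubgroup.zmultiples (2 * Real.pi)) _
    exact discreteTopology_prod _ _
  invariant p hp τ hτ := by
    have : τ.1 = 0 := by simpa using hτ.1
    refine ⟨?_, mem_univ _⟩
    rw [Prod.fst_add, this, add_zero]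
    exact hp.1
  cocompact := by
    refine ⟨Icc (-ε) ε ×ˢ (Icc 0 (2 * Real.pi) ×ˢ (Icc 0 (2 * Real.pi) ×ˢ Icc 0 (2 * Real.pi))),
      isCompact_Icc.prod (isCompact_Icc.prod (isCompact_Icc.prod isCompact_Icc)),
      fun p hp => ⟨hp.1, mem_univ _⟩, fun p hp => ?_⟩
    choose θ hθ hθ' using exists_mem_Icc_sub_mem_zmultiples
    refine ⟨(p.1, θ p.2.1, θ p.2.2.1, θ p.2.2.2), ⟨hp.1, hθ _, hθ _, hθ _⟩, ?_, hθ' _, hθ' _,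
      hθ' _⟩
    simp

end Collar

/-! ### Trapped curves -/

section Trapped

/-- A primitive of a continuous function on a half-open interval. -/
theorem exists_primitive_Ico {E : Type*} [NormedAddCommGroup E] [NormedSpace ℝ E]
    [CompleteSpace E] {g : ℝ → E} {α β : ℝ} (hαβ : α < β) (hg : ContinuousOn g (Ico α β)) :
    ∃ G : ℝ → E, G α = 0 ∧ ∀ t ∈ Ico α β, HasDerivWithinAt G (g t) (Ico α β) t := by
  -- Extending g by a constant to the left of α makes it continuous on both sides of every point, so
  -- the two-sided fundamental theorem of calculus also applies at α.
  set g' : ℝ → E := fun t => g (max t α) with hg'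
  have hc : ContinuousOn g' (Iio β) := hg.comp (continuous_id.max continuous_const).continuousOn
    fun t ht => ⟨le_max_right _ _, max_lt ht hαβ⟩
  refine ⟨fun t => ∫ x in α..t, g' x, intervalIntegral.integral_same, fun t ht => ?_⟩
  have h1 : ContinuousOn g' (uIcc α t) := hc.mono fun x hx => by
    rw [uIcc_of_le ht.1] at hx
    exact hx.2.trans_lt ht.2
  have h2 := intervalIntegral.integral_hasDerivAt_right h1.intervalIntegrable
    (hc.stronglyMeasurableAtFilter isOpen_Iio t ht.2) (hc.continuousAt (Iio_mem_nhds ht.2))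
  have h3 : g' t = g t := by simp [hg', max_eq_left ht.1]
  rw [h3] at h2
  exact h2.hasDerivWithinAt

theorem contDiffOn_of_hasDerivWithinAt {E : Type*} [NormedAddCommGroup E] [NormedSpace ℝ E]
    {S : Set ℝ} (hS : UniqueDiffOn ℝ S) {G g : ℝ → E} (hg : ContDiffOn ℝ ∞ g S)
    (h : ∀ t ∈ S, HasDerivWithinAt G (g t) S t) : ContDiffOn ℝ ∞ G S := by
  rw [contDiffOn_infty_iff_derivWithin hS]
  exact ⟨fun t ht => (h t ht).differentiableWithinAt,
    hg.congr fun t ht => (h t ht).derivWithin (hS t ht)⟩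

/-- A continuous solution of `f (X t, t) = c` is smooth where `∂ₓf` does not vanish. -/
theorem contDiffWithinAt_of_implicit {f : ℝ × ℝ → ℝ} (hf : ContDiff ℝ ∞ f) {S : Set ℝ}
    {X : ℝ → ℝ} {c t : ℝ} (ht : t ∈ S) (hX : ContinuousWithinAt X S t)
    (hc : ∀ u ∈ S, f (X u, u) = c) (h0 : fderiv ℝ f (X t, t) (1, 0) ≠ 0) :
    ContDiffWithinAt ℝ ∞ X S t := by
  -- F = (f, t) is a local diffeomorphism at the point, and X(u) is the first component of its
  -- inverse at (c, u).
  set F : ℝ × ℝ → ℝ × ℝ := fun q => (f q, q.2) with hF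
  have hFc : ContDiff ℝ ∞ F := hf.prodMk contDiff_snd
  set q₀ : ℝ × ℝ := (X t, t) with hq₀
  set L : ℝ × ℝ →L[ℝ] ℝ × ℝ := (fderiv ℝ f q₀).prod (ContinuousLinearMap.snd ℝ ℝ ℝ) with hL
  have hFd : HasFDerivAt F L q₀ :=
    (hf.differentiable (by simp) q₀).hasFDerivAt.prodMk hasFDerivAt_snd
  have hinj : LinearMap.ker (L : ℝ × ℝ →ₗ[ℝ] ℝ × ℝ) = ⊥ := by
    rw [LinearMap.ker_eq_bot']
    intro v hv
    have hv' : fderiv ℝ f q₀ v = 0 ∧ v.2 = 0 := Prod.mk_eq_zero.1 hv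
    have h1 : v = v.1 • ((1 : ℝ), (0 : ℝ)) := by
      refine Prod.ext (by simp) (by simp [hv'.2])
    rw [h1, map_smul, smul_eq_mul] at hv'
    have := (mul_eq_zero.1 hv'.1).resolve_right h0
    rw [h1, this, zero_smul]
  let L' : (ℝ × ℝ) ≃L[ℝ] ℝ × ℝ :=
    (LinearEquiv.ofInjectiveEndo (L : ℝ × ℝ →ₗ[ℝ] ℝ × ℝ)
      (LinearMap.ker_eq_bot.1 hinj)).toContinuousLinearEquiv
  have hL' : (L' : ℝ × ℝ →L[ℝ] ℝ × ℝ) = L := by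
    ext <;> rfl
  rw [← hL'] at hFd
  have hn : (∞ : WithTop ℕ∞) ≠ 0 := by simp
  let Φ := hFc.contDiffAt.toOpenPartialHomeomorph F hFd hn
  have hinv : ContDiffAt ℝ ∞ (hFc.contDiffAt.localInverse hFd hn) (F q₀) :=
    hFc.contDiffAt.to_localInverse hFd hn
  have hsrc : q₀ ∈ Φ.source := hFc.contDiffAt.mem_toOpenPartialHomeomorph_source hFd hn
  have hcurve : ContDiffAt ℝ ∞ (fun u : ℝ => (hFc.contDiffAt.localInverse hFd hn (c, u)).1) t := by
    have h1 : F q₀ = (c, t) := by rw [hF, ← hc t ht]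
    rw [h1] at hinv
    exact contDiffAt_fst.comp t (ContDiffAt.comp t hinv (contDiffAt_const.prodMk contDiffAt_id))
  -- Continuity of X keeps the curve in the domain of the local inverse.
  have hev : ∀ᶠ u in 𝓝[S] t, (X u, u) ∈ Φ.source := by
    have h1 : ContinuousWithinAt (fun u => (X u, u)) S t := hX.prodMk continuousWithinAt_id
    exact h1 (Φ.open_source.mem_nhds hsrc)
  have heq : ∀ u ∈ S, (X u, u) ∈ Φ.source →
      X u = (hFc.contDiffAt.localInverse hFd hn (c, u)).1 := by
    intro u hu hus
    have h1 : Φ.symm (Φ (X u, u)) = (X u, u) := Φ.left_inv hus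
    have h2 : Φ (X u, u) = (c, u) := by
      change F (X u, u) = (c, u)
      rw [hF, ← hc u hu]
    rw [h2] at h1
    exact (congrArg Prod.fst h1).symm
  refine hcurve.contDiffWithinAt.congr_of_eventuallyEq ?_ (heq t ht hsrc)
  filter_upwards [hev, self_mem_nhdsWithin] with u hu huS using heq u huS hu

end Trapped

namespace TrapFlow

variable {E Y : Type*} [NormedAddCommGroup E] [NormedSpace ℝ E] [CompleteSpace E]
    [NormedAddCommGroup Y] [NormedSpace ℝ Y] (M : TrapFlow E Y)

/-- The orbit that enters on the level of the trap converges to it. -/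
theorem exists_trapped_curve {p₀ : E} {α β : ℝ} (hX : Icc α β ⊆ M.X) (h0 : M.x₀ ∈ Ioo α β)
    (hp₀ : M.ξ p₀ ∈ Icc α β)
    (hlevel : M.a (M.υ p₀, M.ξ p₀, -1) = M.a (M.υ p₀, M.x₀, -(1 / 2)))
    (hα : ∀ t ∈ Icc (-1 : ℝ) 1, M.a (M.υ p₀, α, t) < M.a (M.υ p₀, M.x₀, -(1 / 2)))
    (hβ : ∀ t ∈ Icc (-1 : ℝ) 1, M.a (M.υ p₀, M.x₀, -(1 / 2)) < M.a (M.υ p₀, β, t))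
    (hW : ∀ x ∈ Icc α β, ∀ t ∈ Icc (-1 : ℝ) 1, ContDiffAt ℝ ∞ M.W (M.υ p₀, x, t)) :
    ∃ p : ℝ → E, ContDiffOn ℝ ∞ p (Ico (-1) (-(1 / 2))) ∧ p (-1) = p₀ ∧
      (∀ t ∈ Ico (-1 : ℝ) (-(1 / 2)), M.ξ (p t) ∈ Icc α β ∧ M.υ (p t) = M.υ p₀ ∧
        M.ax (M.coord (t, p t)) ≠ 0 ∧
        HasDerivWithinAt p ((M.ax (M.coord (t, p t)))⁻¹ • (M.field (t, p t)).2)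
          (Ico (-1) (-(1 / 2))) t) ∧
      Tendsto (fun t => M.ξ (p t)) (𝓝[Ico (-1) (-(1 / 2))] (-(1 / 2))) (𝓝 M.x₀) := by
  set y := M.υ p₀ with hy
  set c := M.a (y, M.x₀, -(1 / 2)) with hc
  set S : Set ℝ := Ico (-1) (-(1 / 2)) with hS
  have hSI : ∀ t ∈ S, t ∈ Icc (-1 : ℝ) 1 := fun t ht => ⟨ht.1, by linarith [ht.2]⟩
  have hSu : UniqueDiffOn ℝ S := uniqueDiffOn_Ico _ _
  have hline : ∀ t : ℝ, Continuous fun x : ℝ => M.a (y, x, t) := fun t =>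
    M.contDiff_a.continuous.comp (by fun_prop)
  have htime : ∀ x : ℝ, Continuous fun t : ℝ => M.a (y, x, t) := fun x =>
    M.contDiff_a.continuous.comp (by fun_prop)
  have hαβ : α ≤ β := (h0.1.trans h0.2).le
  -- X(t) is the unique point of the level c at time t, between the endpoints α and β on which a is
  -- below and above c. It is defined on all of [-1, 1], so its continuity at -1/2 will give the
  -- limit.
  have hex : ∀ t, ∃ x, t ∈ Icc (-1 : ℝ) 1 → x ∈ Ioo α β ∧ M.a (y, x, t) = c := by
    intro t
    by_cases ht : t ∈ Icc (-1 : ℝ) 1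
    · obtain ⟨x, hx, hx'⟩ := intermediate_value_Ioo hαβ (hline t).continuousOn
        ⟨hα t ht, hβ t ht⟩
      exact ⟨x, fun _ => ⟨hx, hx'⟩⟩
    · exact ⟨0, fun h => absurd h ht⟩
  choose X hXs using hex
  have huniq : ∀ t ∈ Icc (-1 : ℝ) 1, ∀ x ∈ Icc α β, M.a (y, x, t) = c → X t = x := by
    intro t ht x hx hxc
    refine (M.strictMonoOn_a y ht).injOn (hX (Ioo_subset_Icc_self (hXs t ht).1)) (hX hx) ?_
    exact (hXs t ht).2.trans hxc.symm
  -- If l' < X(t) < u', then a is below c at l' and above c at u'; this persists for nearby times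
  -- and traps X between l' and u'.
  have htend : ∀ t ∈ Icc (-1 : ℝ) 1, Tendsto X (𝓝[Icc (-1) 1] t) (𝓝 (X t)) := by
    intro t ht
    obtain ⟨⟨hx1, hx2⟩, hxc⟩ := hXs t ht
    refine tendsto_order.2 ⟨fun l hl => ?_, fun u hu => ?_⟩
    · set l' := max l α
      have hl1 : l' < X t := max_lt hl hx1
      have hl2 : l' ∈ Icc α β := ⟨le_max_right _ _, hl1.le.trans hx2.le⟩
      have h1 : M.a (y, l', t) < c :=
        hxc ▸ M.strictMonoOn_a y ht (hX hl2) (hX ⟨hx1.le, hx2.le⟩) hl1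
      filter_upwards [(htime l').continuousWithinAt.eventually (gt_mem_nhds h1),
        self_mem_nhdsWithin] with r hr hrI
      have h2 := (M.strictMonoOn_a y hrI).lt_iff_lt (hX hl2)
        (hX (Ioo_subset_Icc_self (hXs r hrI).1))
      exact (le_max_left _ _).trans_lt (h2.1 (by simpa only [(hXs r hrI).2] using hr))
    · set u' := min u β
      have hu1 : X t < u' := lt_min hu hx2
      have hu2 : u' ∈ Icc α β := ⟨hx1.le.trans hu1.le, min_le_right _ _⟩
      have h1 : c < M.a (y, u', t) :=
        hxc ▸ M.strictMonoOn_a y ht (hX ⟨hx1.le, hx2.le⟩) (hX hu2) hu1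
      filter_upwards [(htime u').continuousWithinAt.eventually (lt_mem_nhds h1),
        self_mem_nhdsWithin] with r hr hrI
      have h2 := (M.strictMonoOn_a y hrI).lt_iff_lt
        (hX (Ioo_subset_Icc_self (hXs r hrI).1)) (hX hu2)
      exact (h2.1 (by simpa only [(hXs r hrI).2] using hr)).trans_le (min_le_left _ _)
  -- Before t = -1/2 the level curve avoids the trap, so X is smooth there by the implicit function
  -- theorem.
  have hax : ∀ t ∈ S, M.ax (y, X t, t) ≠ 0 := by
    intro t ht h
    have := (M.trap_eq y (X t) (hX (Ioo_subset_Icc_self (hXs t (hSI t ht)).1)) t (hSI t ht) h).2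
    rcases this with h | h <;> linarith [ht.2]
  have hXsm : ContDiffOn ℝ ∞ X S := by
    intro t ht
    have hf : ContDiff ℝ ∞ fun q : ℝ × ℝ => M.a (y, q) :=
      M.contDiff_a.comp (contDiff_const.prodMk contDiff_id)
    refine contDiffWithinAt_of_implicit hf ht
      ((htend t (hSI t ht)).mono_left (nhdsWithin_mono _ hSI))
      (fun u hu => (hXs u (hSI u hu)).2) ?_
    have hd : HasFDerivAt (fun q : ℝ × ℝ => M.a (y, q)) ((fderiv ℝ M.a (y, X t, t)).comp
        ((0 : ℝ × ℝ →L[ℝ] Y).prod (ContinuousLinearMap.id ℝ (ℝ × ℝ)))) (X t, t) :=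
      (M.hasFDerivAt_a _).comp (X t, t) ((hasFDerivAt_const y _).prodMk (hasFDerivAt_id _))
    rw [hd.fderiv]
    exact hax t ht
  have hcurve : ContDiffOn ℝ ∞ (fun t => (y, X t, t)) S :=
    contDiffOn_const.prodMk (hXsm.prodMk contDiffOn_id)
  have hXd : ∀ t ∈ S, HasDerivWithinAt X (-M.at' (y, X t, t) / M.ax (y, X t, t)) S t := by
    intro t ht
    have h1 := ((hXsm t ht).differentiableWithinAt (by simp)).hasDerivWithinAt
    have h2 : HasDerivWithinAt (fun t => (y, X t, t)) ((0 : Y), derivWithin X S t, (1 : ℝ)) S t :=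
      (hasDerivWithinAt_const _ _ _).prodMk (h1.prodMk (hasDerivWithinAt_id _ _))
    have h3 := (M.hasFDerivAt_a _).comp_hasDerivWithinAt t h2
    have h4 : HasDerivWithinAt (fun t => M.a (y, X t, t)) 0 S t :=
      (hasDerivWithinAt_const t S c).congr (fun u hu => (hXs u (hSI u hu)).2)
        (hXs t (hSI t ht)).2
    have h5 := (hSu t ht).eq_deriv _ h3 h4
    rw [fderiv_a_apply, show ((0 : Y), (0 : ℝ), (0 : ℝ)) = 0 from rfl, map_zero] at h5
    refine h1.congr_deriv ?_
    rw [eq_div_iff (hax t ht)]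
    linarith
  -- The drift per unit of t. Its primitive gives the remaining components of the curve and does not
  -- change x or y.
  set g : ℝ → E := fun t => (M.ax (y, X t, t))⁻¹ • M.W (y, X t, t) with hg
  have hgsm : ContDiffOn ℝ ∞ g S := by
    refine ContDiffOn.smul ((M.contDiff_ax.comp_contDiffOn hcurve).inv hax) fun t ht => ?_
    exact ContDiffAt.comp_contDiffWithinAt t
      (hW _ (Ioo_subset_Icc_self (hXs t (hSI t ht)).1) t (hSI t ht)) (hcurve t ht)
  obtain ⟨G, hG0, hGd⟩ := exists_primitive_Ico (show (-1 : ℝ) < -(1 / 2) by norm_num)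
    hgsm.continuousOn
  have hGsm := contDiffOn_of_hasDerivWithinAt hSu hgsm hGd
  have hm1 : (-1 : ℝ) ∈ S := by norm_num [hS]
  have hSo : S.OrdConnected := ordConnected_Ico
  have hGξ : ∀ t ∈ S, M.ξ (G t) = 0 := by
    intro t ht
    have := eq_of_hasDerivWithinAt_zero hSo (f := fun t => M.ξ (G t)) (fun s hs => by
      refine (M.ξ.hasFDerivAt.comp_hasDerivWithinAt s (hGd s hs)).congr_deriv ?_
      simp [hg, M.ξ_W]) hm1 ht
    simpa [hG0] using this
  have hGυ : ∀ t ∈ S, M.υ (G t) = 0 := by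
    intro t ht
    have := eq_of_hasDerivWithinAt_zero hSo (f := fun t => M.υ (G t)) (fun s hs => by
      refine (M.υ.hasFDerivAt.comp_hasDerivWithinAt s (hGd s hs)).congr_deriv ?_
      simp [hg, M.υ_W]) hm1 ht
    simpa [hG0] using this
  have hξp : ∀ t ∈ S, M.ξ (p₀ + (X t - M.ξ p₀) • M.e + G t) = X t := by
    intro t ht
    simp [hGξ t ht, M.ξ_e]
  have hυp : ∀ t ∈ S, M.υ (p₀ + (X t - M.ξ p₀) • M.e + G t) = y := by
    intro t ht
    simp [hGυ t ht, M.υ_e, hy]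
  have hcoord : ∀ t ∈ S, M.coord (t, p₀ + (X t - M.ξ p₀) • M.e + G t) = (y, X t, t) := by
    intro t ht
    simp only [coord_apply, hξp t ht, hυp t ht]
  refine ⟨fun t => p₀ + (X t - M.ξ p₀) • M.e + G t, ?_, ?_, fun t ht => ⟨?_, ?_, ?_, ?_⟩, ?_⟩
  · exact (contDiffOn_const.add ((hXsm.sub contDiffOn_const).smul contDiffOn_const)).add hGsm
  · have : X (-1) = M.ξ p₀ := huniq (-1) (by norm_num) _ hp₀ hlevel
    simp [this, hG0]
  · rw [hξp t ht]
    exact Ioo_subset_Icc_self (hXs t (hSI t ht)).1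
  · exact hυp t ht
  · rw [hcoord t ht]
    exact hax t ht
  · refine ((((hXd t ht).sub_const (M.ξ p₀)).smul_const M.e).const_add p₀ |>.add
      (hGd t ht)).congr_deriv ?_
    simp only [field, hcoord t ht, hg]
    rw [smul_add, smul_smul, div_eq_inv_mul]
  · have h1 : X (-(1 / 2)) = M.x₀ := huniq _ (by norm_num) _ (Ioo_subset_Icc_self h0) rfl
    have h2 := (htend (-(1 / 2)) (by norm_num)).mono_left (nhdsWithin_mono _ hSI)
    rw [h1] at h2
    refine h2.congr' ?_
    filter_upwards [self_mem_nhdsWithin] with t ht using (hξp t ht).symm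

end TrapFlow

/-! ### Admissible functions over the torus -/

section CollarFunctions

/-- The weight of the bump in the directions transverse to the trap. -/
noncomputable def collarWeight (θ₀ : ℝ) (q : ℝ × ℝ) : ℝ :=
  (1 + Real.cos (q.1 - θ₀)) / 2 * twoPeaks q.2

/-- The first integral of the plug over the torus. -/
noncomputable def collarA (r θ₀ θ x t : ℝ) : ℝ := 1 + x - bend r x * collarWeight θ₀ (θ, t)

theorem contDiff_collarWeight (θ₀ : ℝ) : ContDiff ℝ ∞ (collarWeight θ₀) :=
  ((contDiff_const.add (Real.contDiff_cos.comp (contDiff_fst.sub contDiff_const))).div_const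
    2).mul (contDiff_twoPeaks.comp contDiff_snd)

theorem collarWeight_nonneg (θ₀ : ℝ) (q : ℝ × ℝ) : 0 ≤ collarWeight θ₀ q :=
  mul_nonneg (by linarith [Real.neg_one_le_cos (q.1 - θ₀)]) (twoPeaks_nonneg _)

theorem collarWeight_le_one (θ₀ : ℝ) (q : ℝ × ℝ) : collarWeight θ₀ q ≤ 1 :=
  mul_le_one₀ (by linarith [Real.cos_le_one (q.1 - θ₀)]) (twoPeaks_nonneg _) (twoPeaks_le_one _)

theorem collarWeight_eq_one_iff {θ₀ : ℝ} {q : ℝ × ℝ} : collarWeight θ₀ q = 1 ↔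
    q.1 - θ₀ ∈ AddSubgroup.zmultiples (2 * Real.pi) ∧ (q.2 = 1 / 2 ∨ q.2 = -(1 / 2)) := by
  rw [← twoPeaks_eq_one_iff, collarWeight]
  have hcos : Real.cos (q.1 - θ₀) = 1 ↔ q.1 - θ₀ ∈ AddSubgroup.zmultiples (2 * Real.pi) := by
    rw [Real.cos_eq_one_iff, AddSubgroup.mem_zmultiples_iff]
    simp only [zsmul_eq_mul]
  rw [← hcos]
  constructor
  · intro h
    have h1 := Real.cos_le_one (q.1 - θ₀)
    have h2 := twoPeaks_le_one q.2
    have h3 := Real.neg_one_le_cos (q.1 - θ₀)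
    have h4 := twoPeaks_nonneg q.2
    constructor <;> nlinarith
  · rintro ⟨h1, h2⟩
    rw [h1, h2]
    norm_num

theorem contDiff_collarA (r θ₀ : ℝ) :
    ContDiff ℝ ∞ fun q : ℝ × ℝ × ℝ => collarA r θ₀ q.1 q.2.1 q.2.2 :=
  (contDiff_const.add (contDiff_fst.comp contDiff_snd)).sub
    (((contDiff_bend r).comp (contDiff_fst.comp contDiff_snd)).mul
      ((contDiff_collarWeight θ₀).comp (contDiff_fst.prodMk (contDiff_snd.comp contDiff_snd))))

theorem fderiv_collarA (r θ₀ : ℝ) (q v : ℝ × ℝ × ℝ) :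
    fderiv ℝ (fun q : ℝ × ℝ × ℝ => collarA r θ₀ q.1 q.2.1 q.2.2) q v =
      v.2.1 - (deriv (bend r) q.2.1 * v.2.1 * collarWeight θ₀ (q.1, q.2.2) +
        bend r q.2.1 * fderiv ℝ (collarWeight θ₀) (q.1, q.2.2) (v.1, v.2.2)) := by
  let L : ℝ × ℝ × ℝ →L[ℝ] ℝ :=
    (ContinuousLinearMap.fst ℝ ℝ ℝ).comp (ContinuousLinearMap.snd ℝ _ _)
  let T : ℝ × ℝ × ℝ →L[ℝ] ℝ × ℝ :=
    (ContinuousLinearMap.fst ℝ _ _).prod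
      ((ContinuousLinearMap.snd ℝ ℝ ℝ).comp (ContinuousLinearMap.snd ℝ _ _))
  have h1 : HasFDerivAt (fun q => bend r (L q)) (deriv (bend r) (L q) • L) q :=
    (((contDiff_bend r).differentiable (by simp) _).hasDerivAt).comp_hasFDerivAt q L.hasFDerivAt
  have h2 : HasFDerivAt (fun q => collarWeight θ₀ (T q))
      ((fderiv ℝ (collarWeight θ₀) (T q)).comp T) q :=
    ((contDiff_collarWeight θ₀).differentiable (by simp) _).hasFDerivAt.comp q T.hasFDerivAt
  have h3 := ((L.hasFDerivAt.const_add 1).sub (h1.mul h2)).fderiv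
  change fderiv ℝ (fun q : ℝ × ℝ × ℝ => collarA r θ₀ q.1 q.2.1 q.2.2) q = _ at h3
  rw [h3]
  simp [L, T]
  ring

theorem deriv_collarA (r θ₀ θ x t : ℝ) : deriv (fun y => collarA r θ₀ θ y t) x =
    1 - deriv (bend r) x * collarWeight θ₀ (θ, t) :=
  (((hasDerivAt_id x).const_add 1).sub
    (((contDiff_bend r).differentiable (by simp) x).hasDerivAt.mul_const _)).deriv

theorem deriv_collarA_nonneg {r : ℝ} (hr : 0 < r) (θ₀ θ x t : ℝ) :
    0 ≤ deriv (fun y => collarA r θ₀ θ y t) x := by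
  rw [deriv_collarA]
  have h1 := deriv_bend_le_one hr x
  nlinarith [collarWeight_nonneg θ₀ (θ, t), collarWeight_le_one θ₀ (θ, t)]

theorem deriv_collarA_eq_zero_iff {r : ℝ} (hr : 0 < r) {θ₀ θ x t : ℝ} :
    deriv (fun y => collarA r θ₀ θ y t) x = 0 ↔ IsTrapPoint θ₀ θ x t := by
  rw [deriv_collarA, IsTrapPoint]
  constructor
  · intro h
    have h1 := deriv_bend_le_one hr x
    have h2 := collarWeight_nonneg θ₀ (θ, t)
    have h3 := collarWeight_le_one θ₀ (θ, t)
    have h4 : collarWeight θ₀ (θ, t) = 1 := by nlinarith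
    rw [h4] at h
    obtain ⟨h5, h6⟩ := collarWeight_eq_one_iff.1 h4
    exact ⟨h5, deriv_bend_eq_one hr (by linarith), h6⟩
  · rintro ⟨h1, h2, h3⟩
    rw [collarWeight_eq_one_iff.2 ⟨h1, h3⟩, h2, deriv_bend_zero hr]
    norm_num

/-- At x = 0 the factor `bend` vanishes and removes the derivatives in θ₃ and t, so only the slope
in x can be nonzero. -/
theorem fderiv_collarA_eq_zero_iff {r : ℝ} (hr : 0 < r) {θ₀ θ x t : ℝ} :
    fderiv ℝ (fun q : ℝ × ℝ × ℝ => collarA r θ₀ q.1 q.2.1 q.2.2) (θ, x, t) = 0 ↔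
      IsTrapPoint θ₀ θ x t := by
  rw [← deriv_collarA_eq_zero_iff hr]
  constructor
  · intro h
    have h1 := fderiv_collarA r θ₀ (θ, x, t) (0, 1, 0)
    rw [h, show ((0 : ℝ), (0 : ℝ)) = 0 from rfl, map_zero] at h1
    rw [deriv_collarA]
    simpa using h1.symm
  · intro h
    have h2 := ((deriv_collarA_eq_zero_iff hr).1 h).2.1
    rw [deriv_collarA] at h
    refine ContinuousLinearMap.ext fun v => ?_
    rw [fderiv_collarA]
    simp only [h2, bend_zero] at h ⊢
    rw [zero_apply]
    linear_combination v.2.1 * h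

theorem plugFunctions_collarA {ε θ₀ κ : ℝ} (h0 : 0 < ε) (h1 : ε < 1) (hκ : κ ≤ ε / 2)
    {b : ℝ × ℝ → ℝ} (hb : IsOddBump κ b) :
    PlugFunctions ε θ₀ (collarA (ε / 2) θ₀) (fun x t => b (x, t)) where
  smooth_A := contDiff_collarA _ _
  smooth_B := hb.contDiff
  periodic_A θ x t := by
    simp [collarA, collarWeight, add_sub_right_comm]
  A1 θ x hx t _ := by
    have hw := collarWeight_nonneg θ₀ (θ, t)
    have hw' := collarWeight_le_one θ₀ (θ, t)
    have hd := decay_nonneg ((ε / 2) ^ 2) (x ^ 2)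
    have hd' := decay_le_one (show 0 < (ε / 2) ^ 2 by positivity) (sq_nonneg x)
    have hp0 := mul_nonneg hd hw
    have hp1 := mul_le_one₀ hd' hw hw'
    -- Here A = 1 + x(1 - k) with 0 ≤ k ≤ 1, so A ≥ 1 - ε > 0.
    rw [collarA, bend]
    nlinarith [hx.1, hx.2]
  A2 θ x _ t _ := ⟨deriv_collarA_nonneg (by positivity) _ _ _ _,
    deriv_collarA_eq_zero_iff (by positivity)⟩
  A2_critical θ x _ t _ := fderiv_collarA_eq_zero_iff (by positivity)
  A3 := by
    -- `bend (ε / 2)` vanishes for |x| ≥ ε/2 and `twoPeaks` for |t| ≥ 9/10.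
    refine ⟨min (ε / 2) (1 / 10), by positivity, fun θ x _ t _ h => ?_⟩
    rw [collarA, sub_eq_self]
    rcases h with h | h
    · rw [bend_eq_zero (by positivity) (by linarith [min_le_left (ε / 2) (1 / 10)]), zero_mul]
    · rw [collarWeight, twoPeaks_eq_zero (by linarith [min_le_right (ε / 2) (1 / 10)]), mul_zero,
        mul_zero]
  A4 θ x _ t _ := by simp [collarA, collarWeight, twoPeaks_neg]
  B1 := by
    refine ⟨min (ε / 2) (1 / 10), by positivity, fun x _ t _ h => hb.eq_zero _ _ ?_⟩
    rcases h with h | h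
    · exact .inl (by linarith [min_le_left (ε / 2) (1 / 10)])
    · exact .inr (by linarith [min_le_right (ε / 2) (1 / 10)])
  B2_pos := hb.near_pos
  B2_neg := hb.near_neg
  B3 x _ t _ := hb.odd x t

end CollarFunctions

/-! ### Properties of admissible functions -/

/-- The conditions on A and B hold on the closed box only. At boundary points the full derivative is
still determined by the restriction, because the box has unique differentials. -/
theorem UniqueDiffWithinAt.fderiv_eq {E F : Type*} [NormedAddCommGroup E] [NormedSpace ℝ E]
    [NormedAddCommGroup F] [NormedSpace ℝ F] {s : Set E} {p : E} (hs : UniqueDiffWithinAt ℝ s p)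
    {f g : E → F} (hf : DifferentiableAt ℝ f p) (hg : DifferentiableAt ℝ g p) (h : EqOn f g s)
    (hp : p ∈ s) : fderiv ℝ f p = fderiv ℝ g p :=
  hs.eq hf.hasFDerivAt.hasFDerivWithinAt
    (hg.hasFDerivAt.hasFDerivWithinAt.congr h (h hp))

/-- The domain of the arguments `(θ₃, x, t)`. -/
def collarBox (ε : ℝ) : Set (ℝ × ℝ × ℝ) := univ ×ˢ Icc (-ε) ε ×ˢ Icc (-1) 1

theorem uniqueDiffOn_collarBox {ε : ℝ} (h0 : 0 < ε) : UniqueDiffOn ℝ (collarBox ε) :=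
  uniqueDiffOn_univ.prod ((uniqueDiffOn_Icc (by linarith)).prod (uniqueDiffOn_Icc (by norm_num)))

theorem fderiv_neg_time_of_collarBox {ε : ℝ} (h0 : 0 < ε) {f : ℝ × ℝ × ℝ → ℝ}
    (hf : Differentiable ℝ f) {c : ℝ} (h : ∀ y, ∀ x ∈ Icc (-ε) ε, ∀ t ∈ Icc (-1 : ℝ) 1,
      f (y, x, -t) = c * f (y, x, t)) {y x t : ℝ} (hx : x ∈ Icc (-ε) ε) (ht : t ∈ Icc (-1 : ℝ) 1)
    (u r : ℝ) : fderiv ℝ f (y, x, -t) (u, r, 0) = c * fderiv ℝ f (y, x, t) (u, r, 0) := by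
  let L : ℝ × ℝ × ℝ →L[ℝ] ℝ × ℝ × ℝ := (ContinuousLinearMap.fst ℝ ℝ (ℝ × ℝ)).prod
    (((ContinuousLinearMap.fst ℝ ℝ ℝ).comp (ContinuousLinearMap.snd ℝ ℝ (ℝ × ℝ))).prod
      (-((ContinuousLinearMap.snd ℝ ℝ ℝ).comp (ContinuousLinearMap.snd ℝ ℝ (ℝ × ℝ)))))
  have h1 : HasFDerivAt (f ∘ L) ((fderiv ℝ f (y, x, -t)).comp L) (y, x, t) :=
    HasFDerivAt.comp (y, x, t) (hf (L (y, x, t))).hasFDerivAt L.hasFDerivAt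
  have h2 := (hf (y, x, t)).hasFDerivAt.const_mul c
  have hmem : (y, x, t) ∈ collarBox ε := ⟨mem_univ _, hx, ht⟩
  have h3 := (uniqueDiffOn_collarBox h0 _ hmem).fderiv_eq h1.differentiableAt h2.differentiableAt
    (fun q hq => h q.1 q.2.1 hq.2.1 q.2.2 hq.2.2) hmem
  rw [h1.fderiv, h2.fderiv] at h3
  have h4 := DFunLike.congr_fun h3 (u, r, 0)
  simpa [L] using h4

namespace PlugFunctions

variable {ε θ₀ : ℝ} {A : ℝ → ℝ → ℝ → ℝ} {B : ℝ → ℝ → ℝ}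

/-- The first integral `A - 1` as a function of `(θ₃, x, t)`. -/
def integral (A : ℝ → ℝ → ℝ → ℝ) (q : ℝ × ℝ × ℝ) : ℝ := A q.1 q.2.1 q.2.2 - 1

/-- `B` as a function of `(θ₃, x, t)`. -/
def time (B : ℝ → ℝ → ℝ) (q : ℝ × ℝ × ℝ) : ℝ := B q.2.1 q.2.2

theorem fderiv_integral (q : ℝ × ℝ × ℝ) : fderiv ℝ (integral A) q =
    fderiv ℝ (fun q : ℝ × ℝ × ℝ => A q.1 q.2.1 q.2.2) q :=
  fderiv_sub_const (f := fun q : ℝ × ℝ × ℝ => A q.1 q.2.1 q.2.2) 1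

theorem fderiv_integral_angle (q : ℝ × ℝ × ℝ) (u : ℝ) :
    fderiv ℝ (integral A) q (u, 0, 0) = u * fderiv ℝ (integral A) q (1, 0, 0) := by
  rw [← smul_eq_mul, ← map_smul]
  simp

variable (H : PlugFunctions ε θ₀ A B)
include H

theorem contDiff_integral : ContDiff ℝ ∞ (integral A) := H.smooth_A.sub contDiff_const

theorem contDiff_time : ContDiff ℝ ∞ (time B) := H.smooth_B.comp contDiff_snd

theorem fderiv_integral_x (y x t : ℝ) :
    fderiv ℝ (integral A) (y, x, t) (0, 1, 0) = deriv (fun x => A y x t) x := by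
  have hl : HasDerivAt (fun x : ℝ => (y, x, t)) ((0 : ℝ), (1 : ℝ), (0 : ℝ)) x :=
    (hasDerivAt_const _ _).prodMk ((hasDerivAt_id _).prodMk (hasDerivAt_const _ _))
  rw [fderiv_integral]
  exact ((H.smooth_A.differentiable (by simp) (y, x, t)).hasFDerivAt.comp_hasDerivAt x hl).deriv.symm

theorem fderiv_time_angle (q : ℝ × ℝ × ℝ) (u : ℝ) : fderiv ℝ (time B) q (u, 0, 0) = 0 := by
  have h1 : HasFDerivAt (time B) _ q :=
    (H.smooth_B.differentiable (by simp) q.2).hasFDerivAt.comp q hasFDerivAt_snd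
  rw [h1.fderiv]
  simp [show ((0 : ℝ), (0 : ℝ)) = 0 from rfl]

theorem fderiv_time_trap (y : ℝ) {t : ℝ} (ht : t = 1 / 2 ∨ t = -(1 / 2)) :
    fderiv ℝ (time B) (y, 0, t) (0, 1, 0) ≠ 0 := by
  have hl : HasDerivAt (fun x : ℝ => (y, x, t)) ((0 : ℝ), (1 : ℝ), (0 : ℝ)) 0 :=
    (hasDerivAt_const _ _).prodMk ((hasDerivAt_id _).prodMk (hasDerivAt_const _ _))
  have h1 : HasDerivAt (fun x => B x t) (fderiv ℝ (time B) (y, 0, t) (0, 1, 0)) 0 :=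
    HasFDerivAt.comp_hasDerivAt (l := time B) 0
      (H.contDiff_time.differentiable (by simp) (y, 0, t)).hasFDerivAt hl
  have hc : Tendsto (fun x : ℝ => (x, t)) (𝓝 0) (𝓝 (0, t)) :=
    (continuous_id.prodMk continuous_const).tendsto 0
  rcases ht with rfl | rfl
  · have h2 : HasDerivAt (fun x : ℝ => B x (1 / 2)) 1 0 :=
      (hasDerivAt_id (0 : ℝ)).congr_of_eventuallyEq (hc.eventually H.B2_pos)
    rw [h1.unique h2]
    exact one_ne_zero
  · have h2 : HasDerivAt (fun x : ℝ => B x (-(1 / 2))) (-1) 0 :=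
      (hasDerivAt_id (0 : ℝ)).neg.congr_of_eventuallyEq (hc.eventually H.B2_neg)
    rw [h1.unique h2]
    norm_num

theorem periodic_of_mem {θ x t τ : ℝ} (hτ : τ ∈ AddSubgroup.zmultiples (2 * Real.pi)) :
    A (θ + τ) x t = A θ x t := by
  obtain ⟨k, rfl⟩ := hτ
  have h : Function.Periodic (fun θ => A θ x t) (2 * Real.pi) := fun θ => H.periodic_A θ x t
  exact h.zsmul k θ

theorem fderiv_integral_neg (h0 : 0 < ε) {y x t : ℝ} (hx : x ∈ Icc (-ε) ε)
    (ht : t ∈ Icc (-1 : ℝ) 1) (u r : ℝ) : fderiv ℝ (integral A) (y, x, -t) (u, r, 0) =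
      fderiv ℝ (integral A) (y, x, t) (u, r, 0) := by
  rw [fderiv_neg_time_of_collarBox h0 (H.contDiff_integral.differentiable (by simp)) (c := 1)
    (fun y x hx t ht => by simp [integral, H.A4 y x hx t ht]) hx ht, one_mul]

theorem fderiv_time_neg (h0 : 0 < ε) {y x t : ℝ} (hx : x ∈ Icc (-ε) ε)
    (ht : t ∈ Icc (-1 : ℝ) 1) (u r : ℝ) : fderiv ℝ (time B) (y, x, -t) (u, r, 0) =
      -fderiv ℝ (time B) (y, x, t) (u, r, 0) := by
  rw [fderiv_neg_time_of_collarBox h0 (H.contDiff_time.differentiable (by simp)) (c := -1)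
    (fun y x hx t ht => by simp [time, H.B3 x hx t ht]) hx ht, neg_one_mul]

/-- Near the boundary `A = 1 + x` and `B = 0`, to first order. -/
theorem exists_outer (h0 : 0 < ε) : ∃ U : Set (ℝ × ℝ × ℝ), IsOpen U ∧
    (∀ q, |q.2.1| = ε ∨ |q.2.2| = 1 → q ∈ U) ∧ ∀ q ∈ collarBox ε ∩ U, integral A q = q.2.1 ∧
      (∀ v, fderiv ℝ (integral A) q v = v.2.1) ∧ time B q = 0 ∧ fderiv ℝ (time B) q = 0 := by
  obtain ⟨r₁, hr₁, h1⟩ := H.A3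
  obtain ⟨r₂, hr₂, h2⟩ := H.B1
  set r := min r₁ r₂ with hr
  have hr0 : 0 < r := lt_min hr₁ hr₂
  set U : Set (ℝ × ℝ × ℝ) := {q | ε - r < |q.2.1|} ∪ {q | 1 - r < |q.2.2|} with hU
  have hUo : IsOpen U :=
    (isOpen_lt continuous_const (by fun_prop)).union (isOpen_lt continuous_const (by fun_prop))
  have hmem : ∀ q ∈ U, ε - r < |q.2.1| ∨ 1 - r < |q.2.2| := fun _ hq => hq
  have hA : EqOn (integral A) (fun q => q.2.1) (collarBox ε ∩ U) := by
    rintro q ⟨⟨-, hx, ht⟩, hq⟩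
    have := h1 q.1 q.2.1 hx q.2.2 ht ((hmem q hq).imp
      (sub_le_sub_left (min_le_left _ _) _).trans_lt
      (sub_le_sub_left (min_le_left _ _) _).trans_lt)
    simp only [integral, this]
    ring
  have hB : EqOn (time B) (fun _ => 0) (collarBox ε ∩ U) := by
    rintro q ⟨⟨-, hx, ht⟩, hq⟩
    exact h2 q.2.1 hx q.2.2 ht ((hmem q hq).imp
      (sub_le_sub_left (min_le_right _ _) _).trans_lt
      (sub_le_sub_left (min_le_right _ _) _).trans_lt)
  refine ⟨U, hUo, fun q hq => hq.imp (fun h => ?_) (fun h => ?_), fun q hq => ?_⟩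
  · change ε - r < _
    linarith
  · change 1 - r < _
    linarith
  · have hu : UniqueDiffWithinAt ℝ (collarBox ε ∩ U) q :=
      (uniqueDiffOn_collarBox h0 q hq.1).inter (hUo.mem_nhds hq.2)
    refine ⟨hA hq, fun v => ?_, hB hq, ?_⟩
    · have hL := ((ContinuousLinearMap.fst ℝ ℝ ℝ).comp
        (ContinuousLinearMap.snd ℝ ℝ (ℝ × ℝ))).hasFDerivAt (x := q)
      rw [hu.fderiv_eq (H.contDiff_integral.differentiable (by simp) q) hL.differentiableAt hA hq,
        hL.fderiv]
      rfl
    · rw [hu.fderiv_eq (H.contDiff_time.differentiable (by simp) q) (differentiableAt_const 0) hB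
        hq]
      simp

end PlugFunctions

/-- From s cos θ = 2πk and s sin θ = 2πl follows l cos θ - k sin θ = 0, so k = l = 0 and both cos θ
and sin θ would vanish. -/
theorem IrrationalAngle.notMem_zmultiples {θ : ℝ} (h : IrrationalAngle θ) {s : ℝ} (hs : s ≠ 0) :
    ¬ (s * Real.cos θ ∈ AddSubgroup.zmultiples (2 * Real.pi) ∧
      s * Real.sin θ ∈ AddSubgroup.zmultiples (2 * Real.pi)) := by
  rintro ⟨⟨k, hk⟩, ⟨l, hl⟩⟩
  simp only [zsmul_eq_mul] at hk hl
  have h1 := h l (-k) (mul_left_cancel₀ hs (by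
    push_cast
    linear_combination (l : ℝ) * -hk + k * hl))
  have h2 : k = 0 := by simpa using h1.2
  rw [h1.1, Int.cast_zero, zero_mul] at hl
  rw [h2, Int.cast_zero, zero_mul] at hk
  have h3 := Real.cos_sq_add_sin_sq θ
  have h4 : Real.cos θ = 0 := (mul_eq_zero.1 hk.symm).resolve_left hs
  have h5 : Real.sin θ = 0 := (mul_eq_zero.1 hl.symm).resolve_left hs
  rw [h4, h5] at h3
  norm_num at h3

/-! ### The plug over the torus -/

section CollarFlow

open PlugFunctions

variable {R ε θ₀ : ℝ} {A : ℝ → ℝ → ℝ → ℝ} {B : ℝ → ℝ → ℝ}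

/-- The vector field of the plug along the tori. -/
noncomputable def collarW (R : ℝ) (A : ℝ → ℝ → ℝ → ℝ) (B : ℝ → ℝ → ℝ) (q : ℝ × ℝ × ℝ) :
    ℝ × Angles :=
  fderiv ℝ (time B) q (0, 1, 0) • ((0 : ℝ),
    -(Real.cos q.1 / R) -
      fderiv ℝ (integral A) q (1, 0, 0) / (R * (1 + integral A q)) * Real.sin q.1,
    -(Real.sin q.1 / R) +
      fderiv ℝ (integral A) q (1, 0, 0) / (R * (1 + integral A q)) * Real.cos q.1, (0 : ℝ))

theorem one_add_integral_pos (H : PlugFunctions ε θ₀ A B) {q : ℝ × ℝ × ℝ}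
    (hq : q ∈ collarBox ε) : 0 < 1 + integral A q := by
  have := H.A1 q.1 q.2.1 hq.2.1 q.2.2 hq.2.2
  rw [integral]
  linarith

theorem contDiffAt_collarW (hR : 0 < R) (H : PlugFunctions ε θ₀ A B) {q : ℝ × ℝ × ℝ}
    (hq : q ∈ collarBox ε) : ContDiffAt ℝ ∞ (collarW R A B) q := by
  have hA := (H.contDiff_integral.fderiv_right (m := ∞) (by simp)).clm_apply
    (contDiff_const (c := ((1 : ℝ), (0 : ℝ), (0 : ℝ))))
  have hB := (H.contDiff_time.fderiv_right (m := ∞) (by simp)).clm_apply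
    (contDiff_const (c := ((0 : ℝ), (1 : ℝ), (0 : ℝ))))
  have hg : ContDiffAt ℝ ∞ (fun q => fderiv ℝ (integral A) q (1, 0, 0) /
      (R * (1 + integral A q))) q :=
    hA.contDiffAt.div (contDiff_const.mul (contDiff_const.add H.contDiff_integral)).contDiffAt
      (mul_pos hR (one_add_integral_pos H hq)).ne'
  have hc : ContDiffAt ℝ ∞ (fun q : ℝ × ℝ × ℝ => Real.cos q.1) q :=
    (Real.contDiff_cos.comp contDiff_fst).contDiffAt
  have hs : ContDiffAt ℝ ∞ (fun q : ℝ × ℝ × ℝ => Real.sin q.1) q :=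
    (Real.contDiff_sin.comp contDiff_fst).contDiffAt
  exact hB.contDiffAt.smul (contDiffAt_const.prodMk (((hc.div_const R).neg.sub (hg.mul hs)).prodMk
    (((hs.div_const R).neg.add (hg.mul hc)).prodMk contDiffAt_const)))

theorem fderiv_integral_x_eq_zero (H : PlugFunctions ε θ₀ A B) {q : ℝ × ℝ × ℝ}
    (hq : q ∈ collarBox ε) :
    fderiv ℝ (integral A) q (0, 1, 0) = 0 ↔ IsTrapPoint θ₀ q.1 q.2.1 q.2.2 := by
  rw [← (H.A2 q.1 q.2.1 hq.2.1 q.2.2 hq.2.2).2, ← H.fderiv_integral_x]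

theorem fderiv_integral_of_trap (H : PlugFunctions ε θ₀ A B) {q : ℝ × ℝ × ℝ}
    (hq : q ∈ collarBox ε) (h : IsTrapPoint θ₀ q.1 q.2.1 q.2.2) :
    fderiv ℝ (integral A) q = 0 := by
  rw [fderiv_integral]
  exact (H.A2_critical q.1 q.2.1 hq.2.1 q.2.2 hq.2.2).2 h

/-- The derivative of A vanishes at the trap, and with it the correction orthogonal to the geodesic
direction. -/
theorem collarW_of_trap (H : PlugFunctions ε θ₀ A B) {q : ℝ × ℝ × ℝ}
    (hq : q ∈ collarBox ε) (h : IsTrapPoint θ₀ q.1 q.2.1 q.2.2) :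
    collarW R A B q = (-(fderiv ℝ (time B) q (0, 1, 0) / R)) •
      ((0 : ℝ), Real.cos q.1, Real.sin q.1, (0 : ℝ)) := by
  rw [collarW, fderiv_integral_of_trap H hq h]
  simp only [Prod.smul_mk, smul_eq_mul, zero_apply, zero_div, zero_mul, sub_zero, add_zero,
    mul_zero]
  refine Prod.ext rfl (Prod.ext ?_ (Prod.ext ?_ rfl))
  · ring
  · ring

theorem fderiv_time_ne_zero_of_trap (H : PlugFunctions ε θ₀ A B) {q : ℝ × ℝ × ℝ}
    (h : IsTrapPoint θ₀ q.1 q.2.1 q.2.2) : fderiv ℝ (time B) q (0, 1, 0) ≠ 0 := by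
  have : q = (q.1, 0, q.2.2) := Prod.ext rfl (Prod.ext h.2.1 rfl)
  rw [this]
  exact H.fderiv_time_trap q.1 h.2.2

/-- The third angle. -/
def lastAngle : ℝ × Angles →L[ℝ] ℝ := (ContinuousLinearMap.snd ℝ ℝ ℝ).comp
  ((ContinuousLinearMap.snd ℝ ℝ (ℝ × ℝ)).comp (ContinuousLinearMap.snd ℝ ℝ Angles))

/-- The characteristic flow of the plug over the torus. -/
noncomputable def collarFlow (hR : 0 < R) (h0 : 0 < ε) (hθ : IrrationalAngle θ₀)
    (H : PlugFunctions ε θ₀ A B) : TrapFlow (ℝ × Angles) ℝ where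
  K := collar ε
  Γ := collarGroup
  e := (1, 0)
  ξ := ContinuousLinearMap.fst ℝ ℝ Angles
  υ := lastAngle
  X := Icc (-ε) ε
  x₀ := 0
  a := integral A
  W := collarW R A B
  ξ_e := rfl
  υ_e := rfl
  ξ_W q := mul_zero _
  υ_W q := mul_zero _
  ξ_Γ τ hτ := hτ.1
  ordConnected := ordConnected_Icc
  x₀_mem := ⟨by linarith, h0.le⟩
  ξ_mem p hp := hp.1
  contDiff_a := H.contDiff_integral
  continuousOn_W q hq := (contDiffAt_collarW hR H hq).continuousAt.continuousWithinAt
  nonneg y x hx t ht := by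
    rw [H.fderiv_integral_x]
    exact (H.A2 y x hx t ht).1
  trap_eq y x hx t ht h :=
    ((fderiv_integral_x_eq_zero H (q := (y, x, t)) ⟨mem_univ _, hx, ht⟩).1 h).2
  trap_critical y x hx t ht h := by
    have hq : (y, x, t) ∈ collarBox ε := ⟨mem_univ _, hx, ht⟩
    exact fderiv_integral_of_trap H hq ((fderiv_integral_x_eq_zero H hq).1 h)
  trap_W y x hx t ht h c hc hmem := by
    have hq : (y, x, t) ∈ collarBox ε := ⟨mem_univ _, hx, ht⟩
    have htrap := (fderiv_integral_x_eq_zero H hq).1 h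
    rw [collarW_of_trap H hq htrap, smul_smul] at hmem
    have h1 : Real.cos y = Real.cos θ₀ := by
      rw [← cos_add_of_mem_zmultiples (a := θ₀) htrap.1, add_sub_cancel]
    have h2 : Real.sin y = Real.sin θ₀ := by
      rw [← sin_add_of_mem_zmultiples (a := θ₀) htrap.1, add_sub_cancel]
    refine hθ.notMem_zmultiples (mul_ne_zero hc (neg_ne_zero.2
      (div_ne_zero (fderiv_time_ne_zero_of_trap H htrap) hR.ne'))) ⟨?_, ?_⟩
    · rw [← h1]
      exact hmem.2.1
    · rw [← h2]
      exact hmem.2.2.1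
  a_even y x hx t ht := by simp only [integral, H.A4 y x hx t ht]
  ax_even y x hx t ht := H.fderiv_integral_neg h0 hx ht 0 1
  W_odd y x hx t ht := by
    have h1 : integral A (y, x, -t) = integral A (y, x, t) := by
      simp only [integral, H.A4 y x hx t ht]
    rw [collarW, collarW, H.fderiv_time_neg h0 hx ht, H.fderiv_integral_neg h0 hx ht, h1, neg_smul]

variable (hR : 0 < R) (h0 : 0 < ε) (hθ : IrrationalAngle θ₀) (H : PlugFunctions ε θ₀ A B)

theorem collarFlow_coord (z : ℝ × (ℝ × Angles)) :
    (collarFlow hR h0 hθ H).coord z = (z.2.2.2.2, z.2.1, z.1) := rfl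

theorem collarFlow_coord_mem {z : ℝ × (ℝ × Angles)} (hz : z ∈ plugDomain (collar ε)) :
    (collarFlow hR h0 hθ H).coord z ∈ collarBox ε := ⟨mem_univ _, hz.2.1, hz.1⟩

theorem collarFlow_push (s : ℝ) (z : ℝ × (ℝ × Angles)) : (collarFlow hR h0 hθ H).push s z =
    (z.2.1 + s * (integral A (z.2.2.2.2, z.2.1, z.1) - z.2.1), z.2.2) := by
  refine Prod.ext ?_ ?_
  · change z.2.1 + _ * 1 = _
    rw [mul_one]
    rfl
  · change z.2.2 + _ • (0 : Angles) = _
    rw [smul_zero, add_zero]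

theorem collarFlow_dpush (z v : ℝ × (ℝ × Angles)) : (collarFlow hR h0 hθ H).dpush 1 z v =
    (fderiv ℝ (integral A) (z.2.2.2.2, z.2.1, z.1) (v.2.2.2.2, v.2.1, v.1), v.2.2) := by
  refine Prod.ext (TrapFlow.ξ_dpush (M := collarFlow hR h0 hθ H) z v) ?_
  change v.2.2 + _ • (0 : Angles) = _
  rw [smul_zero, add_zero]

theorem integral_ends (h0 : 0 < ε) (H : PlugFunctions ε θ₀ A B) (y : ℝ) {t : ℝ}
    (ht : t ∈ Icc (-1 : ℝ) 1) : integral A (y, -ε, t) = -ε ∧ integral A (y, ε, t) = ε := by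
  obtain ⟨U, -, hU, hU'⟩ := H.exists_outer h0
  exact ⟨(hU' (y, -ε, t) ⟨⟨mem_univ _, ⟨le_rfl, by linarith⟩, ht⟩,
      hU _ (.inl (by rw [abs_neg, abs_of_pos h0]))⟩).1,
    (hU' (y, ε, t) ⟨⟨mem_univ _, ⟨by linarith, le_rfl⟩, ht⟩, hU _ (.inl (abs_of_pos h0))⟩).1⟩

/-- A - 1 is monotone in x and equals ±ε at x = ±ε. Hence `push` maps into the domain of φ;
`collarFlow` enters only through its strict monotonicity. -/
theorem integral_mem_Icc (hR : 0 < R) (h0 : 0 < ε) (hθ : IrrationalAngle θ₀)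
    (H : PlugFunctions ε θ₀ A B) {q : ℝ × ℝ × ℝ} (hq : q ∈ collarBox ε) :
    integral A q ∈ Icc (-ε) ε := by
  have hm := ((collarFlow hR h0 hθ H).strictMonoOn_a q.1 hq.2.2).monotoneOn
  obtain ⟨h1, h2⟩ := integral_ends h0 H q.1 hq.2.2
  have h3 := hm ⟨le_rfl, by linarith⟩ hq.2.1 hq.2.1.1
  have h4 := hm hq.2.1 ⟨by linarith, le_rfl⟩ hq.2.1.2
  exact ⟨h1.symm.trans_le h3, h4.trans_eq h2⟩

theorem frontier_plugDomain_collar {z : ℝ × (ℝ × Angles)}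
    (hz : z ∈ frontier (plugDomain (collar ε))) : |z.2.1| = ε ∨ |z.1| = 1 := by
  have hcl : IsClosed (plugDomain (collar ε)) := isClosed_Icc.prod (isClosed_collar ε)
  have hmem : z ∈ plugDomain (collar ε) := hcl.frontier_subset hz
  by_contra! h
  have h1 : |z.2.1| < ε := lt_of_le_of_ne (abs_le.2 hmem.2.1) h.1
  have h2 : |z.1| < 1 := lt_of_le_of_ne (abs_le.2 hmem.1) h.2
  obtain ⟨h3, h4⟩ := abs_lt.1 h2
  exact hz.2 (mem_interior_iff_mem_nhds.2 (prod_mem_nhds (Icc_mem_nhds h3 h4) (mem_nhds_collar h1)))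

/-- Aη is the pull-back of (1 + x)η under x ↦ A - 1, so σ is dB ∧ dt plus the pull-back of ρ. -/
theorem plugForm_apply (H : PlugFunctions ε θ₀ A B) (z v w : ℝ × (ℝ × Angles)) :
    plugForm R A B z ![v, w] =
      ((collarFlow hR h0 hθ H).db (time B) z v * w.1 -
        v.1 * (collarFlow hR h0 hθ H).db (time B) z w) +
      collarBilin R ((collarFlow hR h0 hθ H).push 1 z) ((collarFlow hR h0 hθ H).dpush 1 z v)
        ((collarFlow hR h0 hθ H).dpush 1 z w) := by
  set M := collarFlow hR h0 hθ H
  have hA : HasFDerivAt (fun z => A z.2.2.2.2 z.2.1 z.1)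
      ((fderiv ℝ (integral A) (M.coord z)).comp M.coord) z := by
    have h1 : HasFDerivAt (fun q : ℝ × ℝ × ℝ => A q.1 q.2.1 q.2.2)
        (fderiv ℝ (integral A) (M.coord z)) (M.coord z) := by
      rw [fderiv_integral]
      exact (H.smooth_A.differentiable (by simp) _).hasFDerivAt
    exact h1.comp z M.coord.hasFDerivAt
  have hB : HasFDerivAt (fun z : ℝ × (ℝ × Angles) => B z.2.1 z.1)
      ((fderiv ℝ (time B) (M.coord z)).comp M.coord) z :=
    HasFDerivAt.comp (g := time B) z
      (H.contDiff_time.differentiable (by simp) _).hasFDerivAt M.coord.hasFDerivAt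
  have hAs : ContDiffAt ℝ ∞ (fun z : ℝ × (ℝ × Angles) => A z.2.2.2.2 z.2.1 z.1) z :=
    (H.smooth_A.comp M.coord.contDiff).contDiffAt
  have hBs : ContDiffAt ℝ ∞ (fun z : ℝ × (ℝ × Angles) => B z.2.1 z.1) z :=
    (H.contDiff_time.comp M.coord.contDiff).contDiffAt
  have h1 := extDeriv_smul_eta_add R (P := (ContinuousLinearMap.snd ℝ ℝ Angles).comp
    (ContinuousLinearMap.snd ℝ ℝ (ℝ × Angles))) (τ := ContinuousLinearMap.fst ℝ ℝ (ℝ × Angles))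
    hAs hBs v w
  rw [hA.fderiv, hB.fderiv] at h1
  refine h1.trans ?_
  rw [collarFlow_push, collarFlow_dpush, collarFlow_dpush, collarBilin_apply]
  simp only [TrapFlow.db, integral]
  simp only [ContinuousLinearMap.comp_apply, ContinuousLinearMap.coe_fst',
    ContinuousLinearMap.coe_snd', M, collarFlow_coord]
  ring

end CollarFlow

/-! ### The symplectic plug for n = 3 -/

section CollarPlug

open PlugFunctions

variable {R ε θ₀ : ℝ} {A : ℝ → ℝ → ℝ → ℝ} {B : ℝ → ℝ → ℝ} (hR : 0 < R) (h0 : 0 < ε)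
    (hθ : IrrationalAngle θ₀) (H : PlugFunctions ε θ₀ A B)

theorem isExactOn_plugForm (R : ℝ) (H : PlugFunctions ε θ₀ A B) :
    IsExactOn (plugDomain (collar ε)) (plugGroup collarGroup) (plugForm R A B) := by
  let C : ℝ × (ℝ × Angles) →L[ℝ] ℝ × ℝ × ℝ :=
    (lastAngle.comp (ContinuousLinearMap.snd ℝ ℝ _)).prod
      (((ContinuousLinearMap.fst ℝ ℝ Angles).comp (ContinuousLinearMap.snd ℝ ℝ _)).prod
        (ContinuousLinearMap.fst ℝ ℝ _))
  refine ⟨_, fun z _ => contDiffAt_oneForm (ContDiff.contDiffAt ?_), fun z _ τ hτ => ?_,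
    fun z _ => rfl⟩
  · have hA : ContDiff ℝ ∞ fun z : ℝ × (ℝ × Angles) => A z.2.2.2.2 z.2.1 z.1 :=
      H.smooth_A.comp C.contDiff
    have hB : ContDiff ℝ ∞ fun z : ℝ × (ℝ × Angles) => B z.2.1 z.1 :=
      H.contDiff_time.comp C.contDiff
    have hη : ContDiff ℝ ∞ fun z : ℝ × (ℝ × Angles) => eta R z.2.2 :=
      (contDiff_eta R).comp (contDiff_snd.comp contDiff_snd)
    exact (hA.smul (hη.clm_comp contDiff_const)).add (hB.smul contDiff_const)
  · have h1 : τ.1 = 0 := hτ.1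
    have h2 : τ.2.1 = 0 := hτ.2.1
    have h3 : τ.2.2 ∈ angleLattice := hτ.2.2
    simp only [oneForm, Prod.fst_add, Prod.snd_add, h1, h2, add_zero, eta_add R _ h3,
      H.periodic_of_mem h3.2.2]

theorem isSymplectic_collarFlow (h1 : ε < 1) {φ : ℝ × Angles → StdSpace 2}
    (hφ : IsCollarEmbedding R ε φ) :
    (collarFlow hR h0 hθ H).IsSymplectic 2 (time B) φ (collarBilin R) (plugForm R A B) where
  contDiff_b := H.contDiff_time
  embedding := hφ.1
  pullback p hp v w := by rw [hφ.2 p hp, collarForm_apply]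
  nondegenerate p hp v h := collarBilin_nondegenerate hR (one_add_pos_of_mem_collar h1 hp).1 h
  trap_b z hz h := fderiv_time_ne_zero_of_trap H
    ((fderiv_integral_x_eq_zero H (collarFlow_coord_mem hR h0 hθ H hz)).1 h)
  ρ_W z hz w := by
    set q := (collarFlow hR h0 hθ H).coord z with hq
    have hpos : 0 < 1 + integral A q :=
      one_add_integral_pos H (collarFlow_coord_mem hR h0 hθ H hz)
    have e1 : fderiv ℝ (collarFlow hR h0 hθ H).a q ((collarFlow hR h0 hθ H).υ w, 0, 0) =
        w.2.2.2 * fderiv ℝ (integral A) q (1, 0, 0) := fderiv_integral_angle q w.2.2.2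
    have e2 : (collarFlow hR h0 hθ H).ξ w = w.1 := rfl
    have e3 : (1 + ((collarFlow hR h0 hθ H).push 1 z).1) = 1 + integral A q := by
      rw [collarFlow_push, one_mul, add_sub_cancel]
      rfl
    have e4 : ((collarFlow hR h0 hθ H).push 1 z).2.2.2 = q.1 := by
      rw [collarFlow_push]
      rfl
    have e5 : (collarFlow hR h0 hθ H).W q = collarW R A B q := rfl
    have hcs := Real.cos_sq_add_sin_sq q.1
    -- B does not depend on θ₃, so the last term of `ρ_W` is zero.
    rw [H.fderiv_time_angle, e1, e2, e5, collarBilin_apply, e3, e4, collarW]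
    simp only [Prod.smul_mk, smul_eq_mul, mul_zero, zero_mul, add_zero, zero_sub]
    field_simp
    linear_combination (1 + integral A q) * fderiv ℝ (time B) q (0, 1, 0) *
      (w.1 - w.2.2.2 * fderiv ℝ (integral A) q (1, 0, 0)) * hcs
  σ_eq z _ v w := plugForm_apply hR h0 hθ H z v w
  exact := isExactOn_plugForm R H
  push_mem z hz s hs := by
    have h2 := integral_mem_Icc hR h0 hθ H (collarFlow_coord_mem hR h0 hθ H hz)
    rw [collarFlow_push]
    refine ⟨?_, mem_univ _⟩
    exact (convex_Icc (-ε) ε).add_smul_sub_mem hz.2.1 h2 hs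
  add_mem p hp τ hτ := (isCompactQuotient_collar h0).invariant p hp τ hτ
  a_periodic z _ τ hτ := by
    have h1 : τ.1 = 0 := hτ.1
    have h2 : τ.2.1 = 0 := hτ.2.1
    change integral A _ = integral A _
    simp only [collarFlow_coord, integral, Prod.fst_add, Prod.snd_add, h1, h2, add_zero,
      H.periodic_of_mem hτ.2.2.2.2]
  b_periodic z _ τ hτ := by
    have h1 : τ.1 = 0 := hτ.1
    have h2 : τ.2.1 = 0 := hτ.2.1
    simp only [collarFlow_coord, time, Prod.fst_add, Prod.snd_add, h1, h2, add_zero]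
  near := by
    obtain ⟨U, hUo, hU, hU'⟩ := H.exists_outer h0
    have hopen : IsOpen ((collarFlow hR h0 hθ H).coord ⁻¹' U) :=
      hUo.preimage (collarFlow hR h0 hθ H).coord.continuous
    refine mem_of_superset (hopen.mem_nhdsSet.2 fun z hz => hU _ (frontier_plugDomain_collar hz)) ?_
    intro z hz hzP
    obtain ⟨h2, h3, h4, h5⟩ := hU' _ ⟨collarFlow_coord_mem hR h0 hθ H hzP, hz⟩
    refine ⟨h2, h3, h4, h5, ?_⟩
    change collarW R A B _ = 0
    rw [collarW, h5]
    exact zero_smul _ _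
  trapped := by
    have hmem : (θ₀, (0 : ℝ), (1 / 2 : ℝ)) ∈ collarBox ε :=
      ⟨mem_univ _, ⟨by linarith, h0.le⟩, by norm_num⟩
    obtain ⟨h2, h3⟩ := integral_mem_Icc hR h0 hθ H hmem
    -- Near t = -1 the function A - 1 equals x, so the entry point on the level of the trap has that
    -- level as its x-coordinate.
    refine ⟨(integral A (θ₀, 0, 1 / 2), 0, 0, θ₀), ⟨⟨h2, h3⟩, mem_univ _⟩, ?_, ?_⟩
    · obtain ⟨U, -, hU, hU'⟩ := H.exists_outer h0
      exact (hU' (θ₀, integral A (θ₀, 0, 1 / 2), -1)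
        ⟨⟨mem_univ _, ⟨h2, h3⟩, by norm_num⟩, hU _ (.inr (by norm_num))⟩).1
    · exact (fderiv_integral_x_eq_zero H hmem).2 ⟨by simp, rfl, .inl rfl⟩

include hR h0 hθ H in
theorem isSymplecticPlug_collar (h1 : ε < 1) {φ : ℝ × Angles → StdSpace 2}
    (hφ : IsCollarEmbedding R ε φ) {δ : ℝ}
    (hδ : ∀ x ∈ Icc (-ε) ε, ∀ t ∈ Icc (-1 : ℝ) 1, |B x t| ≤ δ) :
    IsSymplecticPlug 3 (collar ε) collarGroup δ (plugForm R A B) (plugJ φ) (plugBigJ A B φ) := by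
  have h2 := (isSymplectic_collarFlow hR h0 hθ H h1 hφ).isSymplecticPlug (n := 3) (by norm_num)
    (isCompactQuotient_collar h0) (δ := δ) fun z hz => hδ _ hz.2.1 _ hz.1
  -- At s = 1 the push sends x to x + ((A - 1) - x) = A - 1.
  have h3 : plugBigJ A B φ = (collarFlow hR h0 hθ H).isotopy (time B) φ 1 := by
    funext z
    rw [TrapFlow.isotopy, collarFlow_push, one_mul, one_mul, add_sub_cancel]
    rfl
  rw [h3]
  exact h2

end CollarPlug

/-! ### The trap for n = 3 and the trapped characteristic -/

section CollarTrap

open PlugFunctions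

variable {R ε θ₀ : ℝ} {A : ℝ → ℝ → ℝ → ℝ} {B : ℝ → ℝ → ℝ}

theorem formKer_extDeriv_eta (hR : 0 < R) (θ : Angles) :
    formKer (extDeriv (oneForm (eta R)) θ) = Submodule.span ℝ {geodesicField θ} := by
  have hcs := Real.cos_sq_add_sin_sq θ.2.2
  refine le_antisymm (fun v hv => ?_) ((Submodule.span_singleton_le_iff_mem _ _).2 fun w => ?_)
  -- The test vectors are ∂θ₃ and the quarter turn of the geodesic field.
  · have h1 := hv (0, 0, 1)
    have h2 := hv (-Real.sin θ.2.2, Real.cos θ.2.2, 0)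
    rw [extDeriv_eta] at h1 h2
    simp only [mul_zero, add_zero, zero_sub, one_mul, mul_neg, neg_eq_zero, mul_eq_zero, hR.ne',
      false_or, zero_mul, sub_zero, neg_mul, neg_neg] at h1 h2
    have h3 : v.2.2 = 0 := by
      refine h2.resolve_right fun h => ?_
      nlinarith
    rw [Submodule.mem_span_singleton]
    refine ⟨Real.cos θ.2.2 * v.1 + Real.sin θ.2.2 * v.2.1, ?_⟩
    rw [geodesicField]
    refine Prod.ext ?_ (Prod.ext ?_ ?_)
    · change _ * _ = _
      linear_combination v.1 * hcs + Real.sin θ.2.2 * h1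
    · change _ * _ = _
      linear_combination v.2.1 * hcs - Real.cos θ.2.2 * h1
    · change _ * (0 : ℝ) = _
      rw [mul_zero, h3]
  · rw [extDeriv_eta, geodesicField]
    ring

variable (hR : 0 < R) (h0 : 0 < ε) (hθ : IrrationalAngle θ₀) (H : PlugFunctions ε θ₀ A B)

/-- The kernel does not involve φ; `collarMap` serves as an arbitrary choice of embedding. -/
theorem formKer_plugForm (h1 : ε < 1) {z : ℝ × (ℝ × Angles)} (hz : z ∈ plugDomain (collar ε)) :
    formKer (plugForm R A B z) = Submodule.span ℝ {(collarFlow hR h0 hθ H).field z} :=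
  (isSymplectic_collarFlow hR h0 hθ H h1 (isCollarEmbedding_collarMap hR h1)).formKer_eq hz

include hR h0 hθ H in
theorem formKer_plugForm_trap (h1 : ε < 1) {t : ℝ} (ht : t = 1 / 2 ∨ t = -(1 / 2)) {θ : Angles}
    (h : θ.2.2 = θ₀) : formKer (plugForm R A B (t, (0, θ))) =
      Submodule.span ℝ {((0 : ℝ), ((0 : ℝ), geodesicField θ))} := by
  have ht' : t ∈ Icc (-1 : ℝ) 1 := by rcases ht with rfl | rfl <;> norm_num
  have hz : (t, ((0 : ℝ), θ)) ∈ plugDomain (collar ε) :=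
    ⟨ht', ⟨by linarith, h0.le⟩, mem_univ _⟩
  set M := collarFlow hR h0 hθ H with hM
  have hmem : M.coord (t, (0, θ)) ∈ collarBox ε := collarFlow_coord_mem hR h0 hθ H hz
  have htrap : IsTrapPoint θ₀ θ.2.2 0 t := ⟨by simp [h], rfl, ht⟩
  have h2 : M.ax (M.coord (t, (0, θ))) = 0 := (fderiv_integral_x_eq_zero H hmem).2 htrap
  have h3 : M.at' (M.coord (t, (0, θ))) = 0 := M.at_eq_zero hz h2
  have h4 : M.field (t, (0, θ)) =
      (-(fderiv ℝ (time B) (M.coord (t, (0, θ))) (0, 1, 0) / R)) •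
        ((0 : ℝ), ((0 : ℝ), geodesicField θ)) := by
    have h5 : M.W (M.coord (t, (0, θ))) = _ := collarW_of_trap (R := R) H hmem htrap
    rw [TrapFlow.field, h2, h3, h5, neg_zero, zero_smul, zero_add]
    exact Prod.ext (mul_zero _).symm rfl
  rw [formKer_plugForm hR h0 hθ H h1 hz, ← hM, h4]
  refine Submodule.span_singleton_smul_eq (IsUnit.mk0 _ (neg_ne_zero.2 (div_ne_zero ?_ hR.ne'))) _
  exact fderiv_time_ne_zero_of_trap H htrap

include hR h0 hθ H in
theorem hasFlatGeodesicTrap_plugForm (h1 : ε < 1) :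
    HasFlatGeodesicTrap R ε θ₀ (plugForm R A B) where
  geodesic := formKer_extDeriv_eta hR
  aperiodic θ h s hs hmem := by
    rw [← h] at hθ
    exact hθ.notMem_zmultiples hs ⟨hmem.1, hmem.2.1⟩
  tori t ht θ h := formKer_plugForm_trap hR h0 hθ H h1 ht h
  trapped := by
    set M := collarFlow hR h0 hθ H with hM
    have h0m : (0 : ℝ) ∈ Icc (-ε) ε := ⟨by linarith, h0.le⟩
    -- Here c is both the level of the trap and the entry coordinate, as A - 1 = x at t = -1.
    set c := integral A (θ₀, 0, -(1 / 2)) with hc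
    have hcm : c ∈ Icc (-ε) ε :=
      integral_mem_Icc hR h0 hθ H (q := (θ₀, 0, -(1 / 2))) ⟨mem_univ _, h0m, by norm_num⟩
    have hlevel : integral A (θ₀, c, -1) = c := by
      obtain ⟨U, -, hU, hU'⟩ := H.exists_outer h0
      exact (hU' (θ₀, c, -1) ⟨⟨mem_univ _, hcm, by norm_num⟩, hU _ (.inr (by norm_num))⟩).1
    have hhalf : (-(1 / 2) : ℝ) ∈ Icc (-1 : ℝ) 1 := by norm_num
    have hmono := M.strictMonoOn_a θ₀ hhalf
    obtain ⟨he1, he2⟩ := integral_ends h0 H θ₀ hhalf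
    have hlow : -ε < c := he1.symm.trans_lt (hmono ⟨le_rfl, by linarith⟩ h0m (neg_lt_zero.2 h0))
    have hhigh : c < ε := (hmono h0m ⟨by linarith, le_rfl⟩ h0).trans_eq he2
    obtain ⟨p, hp1, hp2, hp3, hp4⟩ := M.exists_trapped_curve (p₀ := (c, 0, 0, θ₀)) (α := -ε)
      (β := ε) subset_rfl ⟨neg_lt_zero.2 h0, h0⟩ hcm hlevel
      (fun t ht => (integral_ends h0 H θ₀ ht).1.trans_lt hlow)
      (fun t ht => hhigh.trans_eq (integral_ends h0 H θ₀ ht).2.symm)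
      (fun x hx t ht => contDiffAt_collarW hR H ⟨mem_univ _, hx, ht⟩)
    -- The curve is given as a graph over t ∈ [-1, -1/2); the substitution t = -1 + s/2 makes its
    -- interval [0, 1).
    have hmaps : MapsTo (fun s : ℝ => -1 + s / 2) (Ico 0 1) (Ico (-1) (-(1 / 2))) :=
      fun s hs => ⟨by linarith [hs.1], by linarith [hs.2]⟩
    have hdom : ∀ s ∈ Ico (0 : ℝ) 1,
        (-1 + s / 2, p (-1 + s / 2)) ∈ plugDomain (collar ε) := fun s hs =>
      ⟨⟨(hmaps hs).1, by linarith [(hmaps hs).2]⟩, (hp3 _ (hmaps hs)).1, mem_univ _⟩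
    refine ⟨(c, 0, 0, θ₀), ⟨hcm, mem_univ _⟩,
      ⟨fun s => (-1 + s / 2, p (-1 + s / 2)), ⟨ordConnected_Ico, ?_, hdom, fun s hs => ?_⟩, ?_, ?_⟩,
      fun S γ hγ s hs hsp u hu => ?_⟩
    · have hline : ContDiffOn ℝ ∞ (fun s : ℝ => -1 + s / 2) (Ico 0 1) :=
        (contDiff_const.add (contDiff_id.div_const 2)).contDiffOn
      exact hline.prodMk (hp1.comp hline hmaps)
    · obtain ⟨-, -, hne, hd⟩ := hp3 _ (hmaps hs)
      have hline : HasDerivWithinAt (fun s : ℝ => -1 + s / 2) (1 / 2) (Ico 0 1) s :=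
        (((hasDerivAt_id s).div_const 2).const_add (-1)).hasDerivWithinAt
      have h2 := hline.prodMk (hd.scomp s hline hmaps)
      have h3 := h2.derivWithin (uniqueDiffOn_Ico 0 1 s hs)
      rw [formKer_plugForm hR h0 hθ H h1 (hdom s hs)]
      change _ = Submodule.span ℝ {derivWithin (fun s => (-1 + s / 2, (p ∘ fun s => -1 + s / 2) s))
        (Ico 0 1) s}
      rw [h3]
      set z := (-1 + s / 2, p (-1 + s / 2)) with hz
      have h4 : ((1 / 2 : ℝ), (1 / 2 : ℝ) • (M.ax (M.coord z))⁻¹ • (M.field z).2) =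
          (1 / 2 * (M.ax (M.coord z))⁻¹) • M.field z := by
        refine Prod.ext ?_ ?_
        · change _ = 1 / 2 * (M.ax (M.coord z))⁻¹ * M.ax (M.coord z)
          rw [mul_assoc, inv_mul_cancel₀ hne, mul_one]
        · exact smul_smul _ _ _
      rw [h4]
      exact (Submodule.span_singleton_smul_eq
        (IsUnit.mk0 _ (mul_ne_zero (by norm_num) (inv_ne_zero hne))) _).symm
    · simp only [zero_div, add_zero, hp2]
    · have hlim : Tendsto (fun s : ℝ => -1 + s / 2) (𝓝[<] 1) (𝓝 (-(1 / 2))) := by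
        have : Continuous fun s : ℝ => -1 + s / 2 := by fun_prop
        have h2 := this.tendsto 1
        norm_num at h2
        exact (h2.mono_left nhdsWithin_le_nhds).congr fun s => rfl
      have hev : ∀ᶠ s in 𝓝[<] (1 : ℝ), s ∈ Ico (0 : ℝ) 1 := Ico_mem_nhdsLT one_pos
      have hlim' : Tendsto (fun s : ℝ => -1 + s / 2) (𝓝[<] 1)
          (𝓝[Ico (-1) (-(1 / 2))] (-(1 / 2))) :=
        tendsto_nhdsWithin_iff.2 ⟨hlim, hev.mono fun s hs => hmaps hs⟩
      refine hlim.prodMk_nhds ((hp4.comp hlim').prodMk_nhds (tendsto_const_nhds.congr' ?_))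
      exact hev.mono fun s hs => (hp3 _ (hmaps hs)).2.1.symm
    -- The obstruction to crossing is stated at t = 1/2; evenness of A transfers the level from t =
    -- -1/2.
    · have hneg : integral A (θ₀, 0, -(1 / 2)) = integral A (θ₀, 0, 1 / 2) :=
        M.a_even θ₀ 0 h0m (1 / 2) (by norm_num)
      refine (isSymplectic_collarFlow hR h0 hθ H h1
        (isCollarEmbedding_collarMap hR h1)).fst_ne_one (p := (c, 0, 0, θ₀))
        (hlevel.trans hneg) ?_ hγ hs hsp hu
      exact (fderiv_integral_x_eq_zero H (q := (θ₀, 0, 1 / 2)) ⟨mem_univ _, h0m, by norm_num⟩).2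
        ⟨by simp, rfl, .inl rfl⟩

end CollarTrap

/-- First part: the plug for `n = 3`. For every radius `R`, width `ε < 1` and irrational angle `θ₀`
there are a symplectic embedding `φ` and functions `A` and `B`, with `B` arbitrarily small; and
whatever `A`, `B` and `φ` are chosen, they give a symplectic plug whose trap is the flat geodesic
flow. Second part: there are symplectic plugs for all `n ≥ 3`. -/
theorem mainTheorem1 :
    (∀ R ε θ₀ : ℝ, 0 < R → 0 < ε → ε < 1 → IrrationalAngle θ₀ →
      (∃ φ : ℝ × Angles → StdSpace 2, IsCollarEmbedding R ε φ) ∧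
      (∃ A : ℝ → ℝ → ℝ → ℝ, ∀ δ > 0, ∃ B : ℝ → ℝ → ℝ, PlugFunctions ε θ₀ A B ∧
        ∀ x ∈ Set.Icc (-ε) ε, ∀ t ∈ Set.Icc (-1 : ℝ) 1, |B x t| ≤ δ) ∧
      (∀ (A : ℝ → ℝ → ℝ → ℝ) (B : ℝ → ℝ → ℝ), PlugFunctions ε θ₀ A B →
        HasFlatGeodesicTrap R ε θ₀ (plugForm R A B) ∧
        ∀ φ : ℝ × Angles → StdSpace 2, IsCollarEmbedding R ε φ →
          ∀ δ > 0, (∀ x ∈ Set.Icc (-ε) ε, ∀ t ∈ Set.Icc (-1 : ℝ) 1, |B x t| ≤ δ) →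
            IsSymplecticPlug 3 (collar ε) collarGroup δ (plugForm R A B) (plugJ φ)
              (plugBigJ A B φ))) ∧
    (∀ n : ℕ, 3 ≤ n → ∃ ε : ℝ, 0 < ε ∧ ε < 1 ∧ ∀ δ > 0,
      ∃ (σ : ℝ × (EuclideanSpace ℝ (Fin (n - 1)) × (Fin (n - 1) → ℝ)) →
          (ℝ × (EuclideanSpace ℝ (Fin (n - 1)) × (Fin (n - 1) → ℝ))) [⋀^Fin 2]→L[ℝ] ℝ)
        (j : ℝ × (EuclideanSpace ℝ (Fin (n - 1)) × (Fin (n - 1) → ℝ)) →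
          ℝ × StdSpace (n - 1))
        (J : ℝ × (EuclideanSpace ℝ (Fin (n - 1)) × (Fin (n - 1) → ℝ)) →
          ℝ × (ℝ × StdSpace (n - 1))),
        IsSymplecticPlug n (shell (n - 1) ε) (shellGroup (n - 1)) δ σ j J) := by
  refine ⟨fun R ε θ₀ hR h0 h1 hθ => ⟨⟨collarMap R, isCollarEmbedding_collarMap hR h1⟩,
    ⟨collarA (ε / 2) θ₀, fun δ hδ => ?_⟩, fun A B H => ⟨hasFlatGeodesicTrap_plugForm hR h0 hθ H h1,
      fun φ hφ δ _ hB => isSymplecticPlug_collar hR h0 hθ H h1 hφ hB⟩⟩,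
    fun n hn => ⟨1 / 2, by norm_num, by norm_num, fun δ hδ => exists_isSymplecticPlug_shell hn hδ⟩⟩
  -- A does not depend on δ: only b shrinks, with size at most δ and support in |x| ≤ ε/2.
  obtain ⟨b, hb⟩ := exists_odd_bump (lt_min hδ (half_pos h0))
  exact ⟨fun x t => b (x, t), plugFunctions_collarA h0 h1 (min_le_right _ _) hb,
    fun x _ t _ => (hb.abs_le _).trans (min_le_left _ _)⟩
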